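/- A marked spherical rectangle is an oriented closed disk $Q$ with four boundary points (corners) $a_0,a_1,a_2,a_3$, enumerated cyclically in the positive direction of $\partial Q$, equipped with a Riemannian metric of constant curvature $1$ with geodesic sides $(a_j,a_{j+1})$ (indices mod $4$) and conic singularities at the corners, where the interior angles are odd multiples of $\pi/2$. Let $f\colon Q\to S^2$ be its developing map, that is, a continuous map which is a local isometry away from the corners. The net of $Q$ is the preimage under $f$ of the union of the great circles that contain the $f$-images of the sides. An arc of the net is a connected component of $f^{-1}(c)\setminus\partial Q$, where $c$ is one of these circles, and it is called short if it does not intersect any other arc of the net. The angle of $Q$ is the number $\theta\in(0,1)$ such that the short arcs of the net connecting opposite corners of $Q$ have length $\pi(1-\theta)$. (Two opposite sides are mapped to the same great circle, and the other two to distinct great circles $C'$ and $C''$; $\theta$ is one of the two angles between $C'$ and $C''$, in half-turns.) Two nets are equivalent if there is an orientation-preserving homeomorphism between the disks which maps corners to corners, sides to sides, the initial corner $a_0$ to the initial corner, and one net onto the other. Proposition. If two marked spherical rectangles $Q$ and $Q'$ have equivalent nets and the same angle $\theta\in(0,1)$, then they are congruent: there is an orientation-preserving isometry $Q\to Q'$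 sending each corner $a_j$ of $Q$ to the corresponding corner $a_j'$ of $Q'$. -/

import Mathlib

open Set Topology

noncomputable section

/-- The unit sphere of Euclidean three-space (the Riemann sphere with its metric of curvature 1).
Its intrinsic distance is the angle between unit vectors, see `sphDist`. -/
abbrev UnitSphere : Type := Metric.sphere (0 : EuclideanSpace ℝ (Fin 3)) 1

/-- The intrinsic (great-circle) distance on the unit sphere. -/
def sphDist (u v : UnitSphere) : ℝ :=
  InnerProductGeometry.angle (u : EuclideanSpace ℝ (Fin 3)) (v : EuclideanSpace ℝ (Fin 3))

/-- The spherical inner product of two points, i.e. the cosine of their distance. -/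
def sphInner (u v : UnitSphere) : ℝ :=
  inner ℝ (u : EuclideanSpace ℝ (Fin 3)) (v : EuclideanSpace ℝ (Fin 3))

/-- Great circles. -/
def IsGreatCircle (c : Set UnitSphere) : Prop :=
  ∃ n : UnitSphere, c = {v | sphInner n v = 0}

/-- The distance, in a spherical cone, between the points with polar coordinates `(s, t)` and
`(s', t')`, where `s, s'` are the distances to the apex and `t, t'` are the polar angles. If the
polar angles differ by at least `π`, the shortest path passes through the apex. -/
def coneDist (s t s' t' : ℝ) : ℝ :=
  Real.arccos (Real.cos s * Real.cos s' +
    Real.sin s * Real.sin s' * Real.cos (min |t - t'| Real.pi))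

/-- The triangle `x y z` in the plane is positively oriented. For points of the unit circle: going
counterclockwise from `x` one meets `y` before `z`. -/
def Ccw (x y z : ℂ) : Prop := 0 < ((starRingEnd ℂ) (y - x) * (z - x)).im

/-- The closed unit disk of the complex plane. -/
abbrev ClosedDisk : Type := Metric.closedBall (0 : ℂ) 1

section LocalModels

variable {Q : Type*} [MetricSpace Q]

/-- Near `x`, the space `Q` is isometric to an open cap of the unit sphere. -/
def IsSphericalAt (x : Q) : Prop :=
  ∃ r : ℝ, 0 < r ∧ r ≤ Real.pi / 2 ∧ ∃ e : Q → UnitSphere,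
    (∀ y ∈ Metric.ball x r, ∀ z ∈ Metric.ball x r, dist y z = sphDist (e y) (e z)) ∧
    e '' Metric.ball x r = {v | sphDist (e x) v < r}

/-- Near `x`, the space `Q` is isometric to half a cap of the unit sphere, cut by a great circle
through the center of the cap; the points on that circle are the points of `Q` in `B`.
This says that near `x` the boundary `B` is geodesic. -/
def IsHalfSphericalAt (B : Set Q) (x : Q) : Prop :=
  ∃ r : ℝ, 0 < r ∧ r ≤ Real.pi / 2 ∧ ∃ (e : Q → UnitSphere) (n : UnitSphere),
    sphInner n (e x) = 0 ∧
    (∀ y ∈ Metric.ball x r, ∀ z ∈ Metric.ball x r, dist y z = sphDist (e y) (e z)) ∧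
    e '' Metric.ball x r = {v | sphDist (e x) v < r ∧ 0 ≤ sphInner n v} ∧
    ∀ y ∈ Metric.ball x r, y ∈ B ↔ sphInner n (e y) = 0

/-- Near `x`, the space `Q` is isometric to a sector of angle `β` (in radians) of a spherical cone
with apex `x`, the two radii bounding the sector being the points of `Q` in `B`. Thus `x` is a
conic corner with interior angle `β`. The map `p` gives polar coordinates. -/
def IsConicCornerAt (B : Set Q) (x : Q) (β : ℝ) : Prop :=
  ∃ r : ℝ, 0 < r ∧ r ≤ Real.pi / 2 ∧ ∃ p : ℝ → ℝ → Q,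
    (∀ t ∈ Icc 0 β, p 0 t = x) ∧
    (∀ s ∈ Ico 0 r, ∀ t ∈ Icc 0 β, ∀ s' ∈ Ico 0 r, ∀ t' ∈ Icc 0 β,
      dist (p s t) (p s' t') = coneDist s t s' t') ∧
    {y | ∃ s ∈ Ico 0 r, ∃ t ∈ Icc 0 β, p s t = y} = Metric.ball x r ∧
    ∀ s ∈ Ico 0 r, ∀ t ∈ Icc 0 β, p s t ∈ B ↔ (s = 0 ∨ t = 0 ∨ t = β)

end LocalModels

/-- A marked spherical rectangle: an oriented closed disk `Q`, with four corners on its boundary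
enumerated cyclically in the positive direction, equipped with an intrinsic metric of curvature 1
with geodesic sides and conic corners whose interior angles are odd multiples of `π / 2`.
The field `chart` identifies `Q` with the standard disk and is used only to fix the boundary and
the orientation of `Q`. -/
structure MarkedSphericalRectangle (Q : Type*) [MetricSpace Q] where
  chart : Q ≃ₜ ClosedDisk
  corner : Fin 4 → Q
  corner_mem : ∀ j, ‖(chart (corner j) : ℂ)‖ = 1
  corner_order : ∀ i j k : Fin 4, i < j → j < k →
    Ccw (chart (corner i)) (chart (corner j)) (chart (corner k))
  /-- The distance is the infimum of the lengths of paths. -/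
  length_metric : ∀ x y : Q, edist x y = ⨅ γ : Path x y, eVariationOn γ univ
  spherical_interior : ∀ x : Q, ‖(chart x : ℂ)‖ < 1 → IsSphericalAt x
  geodesic_sides : ∀ x : Q, ‖(chart x : ℂ)‖ = 1 → x ∉ range corner →
    IsHalfSphericalAt {y | ‖(chart y : ℂ)‖ = 1} x
  conic_corners : ∀ j, ∃ A : ℕ,
    IsConicCornerAt {y | ‖(chart y : ℂ)‖ = 1} (corner j) (Real.pi * (A + 1 / 2))

namespace MarkedSphericalRectangle

section One

variable {Q : Type*} [MetricSpace Q] (R : MarkedSphericalRectangle Q)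

/-- The boundary circle of the disk. -/
def boundary : Set Q := {x | ‖(R.chart x : ℂ)‖ = 1}

/-- The open side from the corner `j` to the next corner (cyclically). -/
def side (j : Fin 4) : Set Q :=
  {x | x ∈ R.boundary ∧
    Ccw (R.chart (R.corner j)) (R.chart x) (R.chart (R.corner (j + 1)))}

/-- A developing map: a continuous map to the sphere that is a local isometry off the corners. -/
def IsDevelopingMap (f : Q → UnitSphere) : Prop :=
  Continuous f ∧
    ∀ x, x ∉ range R.corner → ∃ U ∈ 𝓝 x, ∀ y ∈ U, ∀ z ∈ U, dist y z = sphDist (f y) (f z)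

/-- The great circles to which the developing map sends the sides. -/
def IsNetCircle (f : Q → UnitSphere) (c : Set UnitSphere) : Prop :=
  IsGreatCircle c ∧ ∃ j, f '' R.side j ⊆ c

/-- The net: the preimage of the great circles to which the sides are mapped. -/
def net (f : Q → UnitSphere) : Set Q := {x | ∃ c, R.IsNetCircle f c ∧ f x ∈ c}

/-- An arc of the net: a connected component of `f ⁻¹' c \ ∂Q`, for one of the circles `c`. -/
def IsArc (f : Q → UnitSphere) (γ : Set Q) : Prop :=
  ∃ c, R.IsNetCircle f c ∧
    ∃ x ∈ f ⁻¹' c \ R.boundary, γ = connectedComponentIn (f ⁻¹' c \ R.boundary) x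

/-- An arc is short if it does not intersect other arcs of the net. -/
def IsShortArc (f : Q → UnitSphere) (γ : Set Q) : Prop :=
  R.IsArc f γ ∧ ∀ γ', R.IsArc f γ' → γ' ≠ γ → Disjoint γ γ'

/-- `θ` is the angle (in half-turns) of the rectangle: `π * (1 - θ)` is the length of a short arc
of the net connecting two opposite corners. -/
def HasAngle (f : Q → UnitSphere) (θ : ℝ) : Prop :=
  ∃ (γ : Set Q) (j : Fin 4) (c : Path (R.corner j) (R.corner (j + 2))),
    R.IsShortArc f γ ∧ Function.Injective c ∧ c '' Ioo 0 1 = γ ∧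
      eVariationOn c univ = ENNReal.ofReal (Real.pi * (1 - θ))

end One

section Two

variable {Q Q' : Type*} [MetricSpace Q] [MetricSpace Q']
  (R : MarkedSphericalRectangle Q) (R' : MarkedSphericalRectangle Q')

/-- A homeomorphism of closed disks is orientation-preserving if it maps the boundary circle to the
boundary circle and preserves the cyclic order of its points. -/
def OrientationPreserving (h : Q ≃ₜ Q') : Prop :=
  (∀ x, h x ∈ R'.boundary ↔ x ∈ R.boundary) ∧
    ∀ x ∈ R.boundary, ∀ y ∈ R.boundary, ∀ z ∈ R.boundary,
      Ccw (R.chart x) (R.chart y) (R.chart z) →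
        Ccw (R'.chart (h x)) (R'.chart (h y)) (R'.chart (h z))

/-- Combinatorial equivalence of nets: an orientation-preserving homeomorphism that respects the
initial corner (hence, by orientation, the numbering of the corners) and the sides, and that
carries one net onto the other. -/
def NetEquivalent (f : Q → UnitSphere) (f' : Q' → UnitSphere) : Prop :=
  ∃ h : Q ≃ₜ Q', R.OrientationPreserving R' h ∧ (∀ j, h (R.corner j) = R'.corner j) ∧
    (∀ j, h '' R.side j = R'.side j) ∧ h '' R.net f = R'.net f'

/-- Congruence: an orientation-preserving isometry that sends each corner to the corresponding
corner. -/
def Congruent : Prop :=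
  ∃ φ : Q ≃ᵢ Q', R.OrientationPreserving R' φ.toHomeomorph ∧
    ∀ j, φ (R.corner j) = R'.corner j

end Two

end MarkedSphericalRectangle

end

/-! A rectangle is glued from spherical triangles, and the net together with the angle determines
both the triangles and the gluing.

Corner angles are odd multiples of π/2, so circles of adjacent sides are perpendicular
(`sphInner_side_normal_eq_zero`). Consequently two opposite sides lie on one circle, the "double"
one, perpendicular to the circles of the other two sides. Since `0 < θ < 1`, the images of two
opposite corners are neither equal nor antipodal, which forces these two other circles to be
distinct (`HasAngle.exists_isNetFrame`). Three independent normals cut the sphere into eight open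
triangles. Over each of them `f` is a covering, and the triangle is simply connected, so `f` maps
the closure of every face of the net homeomorphically onto a closed triangle (`exists_isFaceChart`).

An equivalence `e` of nets maps faces to faces. Vertices are recognised by the number of faces
meeting there, so they are preserved, and so are the edges. Hence on a closed face the signs of `f'
∘ e` with respect to the circles arise from those of `f` by a permutation `σ` and sign changes `ε`.
Faces with a common edge have the same `(σ, ε)`, and the interior without the finitely many vertices
is connected, so one pair serves for the whole rectangle (`exists_match`).

The arcs that define the angle lie on the double circle and join corresponding pairs of corners in
both rectangles: arcs joining different pairs would cross in the disk, hence be one component of the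
same preimage, with two sets of ends. The images of the two ends determine the double circle, and
each of the other circles passes through one of them perpendicularly to it. With equal angles, some
orthogonal `A` therefore carries one configuration of circles to the other with the right signs
(`exists_isometry`).

Applying `A ∘ f` and then inverting `f'` on the corresponding closed face defines, face by face, a
bijection `φ` with `f' ∘ φ = A ∘ f` (`exists_isTransfer`). It is a local isometry off the corners
and preserves small distances to the corners, so it does not lengthen paths; neither does its
inverse. Both metrics are length metrics, so `φ` is an isometry. Its orientation is read off from
three corners. -/

noncomputable section

/-! ### Spherical geometry -/

/-- Euclidean three-space. -/
abbrev Space3 : Type := EuclideanSpace ℝ (Fin 3)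

theorem UnitSphere.norm_eq (v : UnitSphere) : ‖(v : Space3)‖ = 1 := by
  simp

theorem UnitSphere.ne_zero (v : UnitSphere) : (v : Space3) ≠ 0 := by
  intro h; have := v.norm_eq; rw [h] at this; simp at this

theorem UnitSphere.inner_self (v : UnitSphere) : inner ℝ (v : Space3) (v : Space3) = 1 := by
  rw [real_inner_self_eq_norm_sq, v.norm_eq]; norm_num

theorem sphInner_comm (u v : UnitSphere) : sphInner u v = sphInner v u := real_inner_comm _ _

theorem sphDist_eq_arccos (u v : UnitSphere) : sphDist u v = Real.arccos (sphInner u v) := by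
  simp [sphDist, sphInner, InnerProductGeometry.angle]

theorem cos_sphDist (u v : UnitSphere) : Real.cos (sphDist u v) = sphInner u v := by
  simp [sphDist, sphInner, InnerProductGeometry.cos_angle]

theorem sphDist_nonneg (u v : UnitSphere) : 0 ≤ sphDist u v := InnerProductGeometry.angle_nonneg _ _

theorem sphDist_le_pi (u v : UnitSphere) : sphDist u v ≤ Real.pi :=
  InnerProductGeometry.angle_le_pi _ _

theorem sphDist_self (u : UnitSphere) : sphDist u u = 0 :=
  InnerProductGeometry.angle_self u.ne_zero

theorem eq_of_sphInner_eq_one {u v : UnitSphere} (h : sphInner u v = 1) : u = v := by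
  apply Subtype.ext
  exact (inner_eq_one_iff_of_norm_eq_one u.norm_eq v.norm_eq).1 h

theorem sphInner_eq_of_sphDist_eq {u v u' v' : UnitSphere} (h : sphDist u v = sphDist u' v') :
    sphInner u v = sphInner u' v' := by
  rw [← cos_sphDist, ← cos_sphDist, h]

theorem sphDist_eq_of_sphInner_eq {u v u' v' : UnitSphere} (h : sphInner u v = sphInner u' v') :
    sphDist u v = sphDist u' v' := by
  rw [sphDist_eq_arccos, sphDist_eq_arccos, h]

theorem continuous_sphInner : Continuous fun p : UnitSphere × UnitSphere => sphInner p.1 p.2 := by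
  unfold sphInner; fun_prop

theorem sphDist_lt_iff {u v : UnitSphere} {r : ℝ} (h0 : 0 ≤ r) (hr : r ≤ Real.pi) :
    sphDist u v < r ↔ Real.cos r < sphInner u v := by
  rw [← cos_sphDist]
  exact (Real.strictAntiOn_cos.lt_iff_gt ⟨h0, hr⟩ ⟨sphDist_nonneg _ _, sphDist_le_pi _ _⟩).symm

/-- Orthogonal transformations act on the sphere. -/
def sphMap (A : Space3 ≃ₗᵢ[ℝ] Space3) (v : UnitSphere) : UnitSphere :=
  ⟨A v, by simp⟩

@[simp] theorem coe_sphMap (A : Space3 ≃ₗᵢ[ℝ] Space3) (v : UnitSphere) :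
    (sphMap A v : Space3) = A v := rfl

@[simp] theorem sphInner_sphMap (A : Space3 ≃ₗᵢ[ℝ] Space3) (u v : UnitSphere) :
    sphInner (sphMap A u) (sphMap A v) = sphInner u v := by
  simp [sphInner]

@[simp] theorem sphDist_sphMap (A : Space3 ≃ₗᵢ[ℝ] Space3) (u v : UnitSphere) :
    sphDist (sphMap A u) (sphMap A v) = sphDist u v :=
  sphDist_eq_of_sphInner_eq (sphInner_sphMap A u v)

@[simp] theorem sphMap_symm_sphMap (A : Space3 ≃ₗᵢ[ℝ] Space3) (u : UnitSphere) :
    sphMap A.symm (sphMap A u) = u := by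
  apply Subtype.ext; simp

@[simp] theorem sphMap_sphMap_symm (A : Space3 ≃ₗᵢ[ℝ] Space3) (u : UnitSphere) :
    sphMap A (sphMap A.symm u) = u := by
  apply Subtype.ext; simp

theorem continuous_sphMap (A : Space3 ≃ₗᵢ[ℝ] Space3) : Continuous (sphMap A) := by
  unfold sphMap; fun_prop

/-- The vectors of `S` have no common nonzero orthogonal vector. -/
def Spanning (S : Set Space3) : Prop := ∀ w : Space3, (∀ v ∈ S, inner ℝ w v = 0) → w = 0

theorem Spanning.mono {S T : Set Space3} (h : Spanning S) (hST : S ⊆ T) : Spanning T :=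
  fun w hw => h w fun v hv => hw v (hST hv)

theorem Spanning.span_eq_top {S : Set Space3} (h : Spanning S) : Submodule.span ℝ S = ⊤ := by
  rw [← Submodule.orthogonal_eq_bot_iff, Submodule.eq_bot_iff]
  intro w hw
  apply h
  intro v hv
  rw [real_inner_comm]
  exact (Submodule.mem_orthogonal _ _).1 hw v (Submodule.subset_span hv)

/-- A map that preserves inner products on a spanning set is the restriction of an orthogonal
transformation. -/
theorem exists_isometry_of_inner_eq {S : Set Space3} (hS : Spanning S) (g : Space3 → Space3)
    (hg : ∀ u ∈ S, ∀ v ∈ S, inner ℝ (g u) (g v) = inner ℝ u v) :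
    ∃ A : Space3 ≃ₗᵢ[ℝ] Space3, ∀ v ∈ S, g v = A v := by
  classical
  let b := Module.Basis.ofSpan hS.span_eq_top.ge
  have hb : ∀ i, b i ∈ S := fun i => Module.Basis.ofSpan_subset hS.span_eq_top.ge ⟨i, rfl⟩
  have : Finite _ := Module.Finite.finite_basis b
  let L : Space3 →ₗ[ℝ] Space3 := b.constr ℝ (fun i => g (b i))
  have hL : ∀ i, L (b i) = g (b i) := fun i => b.constr_basis ℝ _ i
  have h1 : ∀ i, ∀ y, inner ℝ (g (b i)) (L y) = inner ℝ (b i) y := by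
    intro i y
    have : (innerₛₗ ℝ (g (b i))) ∘ₗ L = innerₛₗ ℝ (b i) := by
      apply b.ext
      intro j
      simp [hL, hg _ (hb i) _ (hb j)]
    simpa using LinearMap.congr_fun this y
  have h2 : ∀ x y, inner ℝ (L x) (L y) = inner ℝ x y := by
    intro x y
    have : (innerₛₗ ℝ (L y)) ∘ₗ L = innerₛₗ ℝ y := by
      apply b.ext
      intro j
      simp only [LinearMap.comp_apply, innerₛₗ_apply_apply, hL]
      rw [real_inner_comm, h1, real_inner_comm]
    have := LinearMap.congr_fun this x
    simp only [LinearMap.comp_apply, innerₛₗ_apply_apply] at this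
    rw [real_inner_comm, this, real_inner_comm]
  refine ⟨(L.isometryOfInner h2).toLinearIsometryEquiv rfl, fun v hv => ?_⟩
  rw [LinearIsometry.coe_toLinearIsometryEquiv]
  change g v = L v
  have h3 : ∀ i, inner ℝ (b i) (v) = inner ℝ (g (b i)) (g v) := fun i => (hg _ (hb i) _ hv).symm
  have h4 : inner ℝ (L v) (g v) = inner ℝ v v := by
    have : (innerₛₗ ℝ (g v)) ∘ₗ L = innerₛₗ ℝ v := by
      apply b.ext
      intro j
      simp only [LinearMap.comp_apply, innerₛₗ_apply_apply, hL]
      exact hg _ hv _ (hb j)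
    have := LinearMap.congr_fun this v
    simp only [LinearMap.comp_apply, innerₛₗ_apply_apply] at this
    rw [real_inner_comm, this]
  -- `g v` and `L v` have the norm of `v`, and their inner product is `‖v‖²`, so they coincide.
  have h5 : inner ℝ (g v - L v) (g v - L v) = 0 := by
    rw [inner_sub_sub_self]
    simp only [hg v hv v hv, h2, h4, real_inner_comm (L v) (g v)]
    simp
  rw [inner_self_eq_zero, sub_eq_zero] at h5
  exact h5

/-- Two orthogonal transformations that agree on a spanning set are equal. -/
theorem Spanning.isometry_ext {S : Set Space3} (hS : Spanning S) {A B : Space3 ≃ₗᵢ[ℝ] Space3}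
    (h : ∀ v ∈ S, A v = B v) : A = B := by
  apply LinearIsometryEquiv.ext
  intro x
  have : A.toLinearEquiv.toLinearMap = B.toLinearEquiv.toLinearMap := by
    apply LinearMap.ext_on hS.span_eq_top
    intro v hv
    exact h v hv
  exact LinearMap.congr_fun this x

/-- The point reached after moving by `a` from `u` in the direction `m`. -/
def arcVec (u m : Space3) (a : ℝ) : Space3 := Real.cos a • u + Real.sin a • m

theorem inner_arcVec {u m : Space3} (hu : ‖u‖ = 1) (hm : ‖m‖ = 1) (hum : inner ℝ u m = 0)
    (a b : ℝ) : inner ℝ (arcVec u m a) (arcVec u m b) = Real.cos (a - b) := by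
  have h1 : inner ℝ u u = (1 : ℝ) := by rw [real_inner_self_eq_norm_sq, hu]; norm_num
  have h2 : inner ℝ m m = (1 : ℝ) := by rw [real_inner_self_eq_norm_sq, hm]; norm_num
  have h3 : inner ℝ m u = (0 : ℝ) := by rw [real_inner_comm, hum]
  simp only [arcVec, inner_add_left, inner_add_right, real_inner_smul_left, real_inner_smul_right,
    h1, h2, h3, hum, Real.cos_sub]
  ring

theorem norm_arcVec {u m : Space3} (hu : ‖u‖ = 1) (hm : ‖m‖ = 1) (hum : inner ℝ u m = 0)
    (a : ℝ) : ‖arcVec u m a‖ = 1 := by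
  have := inner_arcVec hu hm hum a a
  rw [real_inner_self_eq_norm_sq] at this
  simp at this
  rcases this with h | h
  · exact h
  · have := norm_nonneg (arcVec u m a); linarith

/-- The great circle through `u` in the orthogonal direction `m`. -/
def sphArc (u m : UnitSphere) (hum : sphInner u m = 0) (a : ℝ) : UnitSphere :=
  ⟨arcVec u m a, by simpa using norm_arcVec u.norm_eq m.norm_eq hum a⟩

theorem sphInner_sphArc (u m : UnitSphere) (hum : sphInner u m = 0) (a b : ℝ) :
    sphInner (sphArc u m hum a) (sphArc u m hum b) = Real.cos (a - b) :=
  inner_arcVec u.norm_eq m.norm_eq hum a b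

theorem sphDist_sphArc (u m : UnitSphere) (hum : sphInner u m = 0) {a b : ℝ}
    (h : |a - b| ≤ Real.pi) : sphDist (sphArc u m hum a) (sphArc u m hum b) = |a - b| := by
  rw [sphDist_eq_arccos, sphInner_sphArc, ← Real.cos_abs, Real.arccos_cos (abs_nonneg _) h]

theorem continuous_sphArc (u m : UnitSphere) (hum : sphInner u m = 0) :
    Continuous (sphArc u m hum) := by
  unfold sphArc arcVec; fun_prop

@[simp] theorem sphArc_zero (u m : UnitSphere) (hum : sphInner u m = 0) :
    sphArc u m hum 0 = u := by
  apply Subtype.ext; simp [sphArc, arcVec]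

theorem sphInner_sphArc_right (n u m : UnitSphere) (hum : sphInner u m = 0) (a : ℝ) :
    sphInner n (sphArc u m hum a) = Real.cos a * sphInner n u + Real.sin a * sphInner n m := by
  simp [sphInner, sphArc, arcVec, inner_add_right, real_inner_smul_right]

/-- Normalization of nonzero vectors. -/
def sphNormalize (w : Space3) : UnitSphere :=
  -- The value at `0` is arbitrary; it only makes the map total.
  if h : w = 0 then ⟨EuclideanSpace.single 0 1, by simp⟩
  else ⟨‖w‖⁻¹ • w, by simp [norm_smul, h]⟩

theorem coe_sphNormalize {w : Space3} (h : w ≠ 0) : (sphNormalize w : Space3) = ‖w‖⁻¹ • w := by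
  simp [sphNormalize, h]

theorem sphNormalize_coe (v : UnitSphere) : sphNormalize v = v := by
  apply Subtype.ext
  rw [coe_sphNormalize v.ne_zero, v.norm_eq]; simp

theorem continuousOn_sphNormalize : ContinuousOn sphNormalize {0}ᶜ := by
  rw [continuousOn_iff_continuous_domRestrict, Topology.IsInducing.subtypeVal.continuous_iff]
  have : (Subtype.val ∘ ({0}ᶜ : Set Space3).domRestrict sphNormalize) =
      fun w : ({0}ᶜ : Set Space3) => ‖(w : Space3)‖⁻¹ • (w : Space3) := by
    funext w
    exact coe_sphNormalize w.2
  rw [this]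
  have h0 : ∀ w : ({0}ᶜ : Set Space3), ‖(w : Space3)‖ ≠ 0 := fun w => norm_ne_zero_iff.2 w.2
  fun_prop (disch := exact h0 _)

theorem sphInner_sphNormalize (n : UnitSphere) {w : Space3} (h : w ≠ 0) :
    sphInner n (sphNormalize w) = ‖w‖⁻¹ * inner ℝ (n : Space3) w := by
  simp [sphInner, coe_sphNormalize h, real_inner_smul_right]

/-- Two points of the sphere which are not antipodal lie on a common geodesic arc. -/
theorem exists_sphArc {u v : UnitSphere} (h : sphInner u v ≠ -1) :
    ∃ (m : UnitSphere) (hum : sphInner u m = 0), sphArc u m hum (sphDist u v) = v := by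
  by_cases huv : u = v
  · subst huv
    -- Any direction will do here; one exists because `u` spans only a line.
    obtain ⟨w, hw, hw0⟩ : ∃ w : Space3, inner ℝ (u : Space3) w = 0 ∧ w ≠ 0 := by
      have : (ℝ ∙ (u : Space3))ᗮ ≠ ⊥ := by
        rw [Ne, Submodule.orthogonal_eq_bot_iff]
        intro h
        have h1 := finrank_span_le_card (R := ℝ) ({(u : Space3)} : Set Space3)
        rw [h] at h1
        simp at h1
      obtain ⟨w, hw, hw0⟩ := Submodule.exists_mem_ne_zero_of_ne_bot this
      exact ⟨w, Submodule.mem_orthogonal_singleton_iff_inner_right.1 hw, hw0⟩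
    refine ⟨sphNormalize w, ?_, ?_⟩
    · rw [sphInner_sphNormalize u hw0, hw, mul_zero]
    · rw [sphDist_self, sphArc_zero]
  · set c := sphInner u v with hc
    have hs : Real.sin (sphDist u v) ≠ 0 := by
      intro h0
      have := Real.sin_sq_add_cos_sq (sphDist u v)
      rw [h0, cos_sphDist, ← hc] at this
      have : (c - 1) * (c + 1) = 0 := by nlinarith
      rcases mul_eq_zero.1 this with h1 | h1
      · exact huv (eq_of_sphInner_eq_one (by linarith))
      · exact h (by linarith)
    have hss := Real.sin_sq_add_cos_sq (sphDist u v)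
    set s := Real.sin (sphDist u v) with hs'
    have hcd : Real.cos (sphDist u v) = c := cos_sphDist u v
    -- Gram–Schmidt: the part of `v` orthogonal to `u` has length `s`.
    let m : Space3 := s⁻¹ • ((v : Space3) - c • (u : Space3))
    have hc' : inner ℝ (u : Space3) (v : Space3) = c := rfl
    have hc'' : inner ℝ (v : Space3) (u : Space3) = c := sphInner_comm v u
    have hmm : inner ℝ m m = (1 : ℝ) := by
      simp only [m, real_inner_smul_left, real_inner_smul_right, inner_sub_left, inner_sub_right,
        u.inner_self, v.inner_self, hc', hc'']
      field_simp
      rw [hcd] at hss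
      linarith
    have hmn : ‖m‖ = 1 := by
      rw [real_inner_self_eq_norm_sq] at hmm
      have := norm_nonneg m
      nlinarith
    refine ⟨⟨m, by simpa using hmn⟩, ?_, ?_⟩
    · simp only [sphInner, m, real_inner_smul_right, inner_sub_right, u.inner_self, hc']
      ring
    · apply Subtype.ext
      simp only [sphArc, arcVec, m, hcd]
      rw [← hs', smul_smul, mul_inv_cancel₀ hs, one_smul]
      abel

/-- The trace on the sphere of a convex cone is preconnected. -/
theorem isPreconnected_sphere_of_convex {C : Set Space3} (hC : Convex ℝ C) (h0 : (0 : Space3) ∉ C)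
    (hcone : ∀ w ∈ C, ∀ t : ℝ, 0 < t → t • w ∈ C) :
    IsPreconnected {v : UnitSphere | (v : Space3) ∈ C} := by
  have : {v : UnitSphere | (v : Space3) ∈ C} = sphNormalize '' C := by
    ext v
    constructor
    · intro hv
      exact ⟨v, hv, sphNormalize_coe v⟩
    · rintro ⟨w, hw, rfl⟩
      have hw0 : w ≠ 0 := fun h => h0 (h ▸ hw)
      simp only [mem_ofPred_eq, coe_sphNormalize hw0]
      exact hcone w hw _ (inv_pos.2 (norm_pos_iff.2 hw0))
  rw [this]
  apply hC.isPreconnected.image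
  apply continuousOn_sphNormalize.mono
  intro w hw h
  exact h0 (by rw [← (mem_singleton_iff.1 h)]; exact hw)

/-! ### The unit circle of the complex plane -/

/-- The point of the unit circle with a given argument. -/
def circlePt (a : ℝ) : ℂ := Complex.exp (a * Complex.I)

theorem norm_circlePt (a : ℝ) : ‖circlePt a‖ = 1 := Complex.norm_exp_ofReal_mul_I a

theorem continuous_circlePt : Continuous circlePt := by unfold circlePt; fun_prop

theorem circlePt_re (a : ℝ) : (circlePt a).re = Real.cos a := Complex.exp_ofReal_mul_I_re a

theorem circlePt_im (a : ℝ) : (circlePt a).im = Real.sin a := Complex.exp_ofReal_mul_I_im a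

theorem circlePt_add_two_pi (a : ℝ) : circlePt (a + 2 * Real.pi) = circlePt a := by
  apply Complex.ext <;> simp [circlePt_re, circlePt_im]

theorem exists_circlePt {z : ℂ} (hz : ‖z‖ = 1) (a : ℝ) :
    ∃ b ∈ Ico a (a + 2 * Real.pi), z = circlePt b := by
  obtain ⟨b, hb, -⟩ := existsUnique_add_zsmul_mem_Ico Real.two_pi_pos (Complex.arg z) a
  refine ⟨_, hb, ?_⟩
  have h1 : z = circlePt (Complex.arg z) := by
    have := Complex.norm_mul_exp_arg_mul_I z
    rw [hz] at this
    simpa [circlePt] using this.symm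
  conv_lhs => rw [h1]
  apply Complex.ext
  · simp [circlePt_re, Real.cos_add_int_mul_two_pi]
  · simp [circlePt_im, Real.sin_add_int_mul_two_pi]

theorem ccw_det (x y z : ℂ) : ((starRingEnd ℂ) (y - x) * (z - x)).im =
    (y.re - x.re) * (z.im - x.im) - (y.im - x.im) * (z.re - x.re) := by
  simp [Complex.mul_im]; ring

/-- The determinant that defines `Ccw` factors as four times this product of sines of
half-differences of arguments. -/
theorem ccw_circlePt (a b c : ℝ) : Ccw (circlePt a) (circlePt b) (circlePt c) ↔
    0 < Real.sin ((b - a) / 2) * Real.sin ((c - b) / 2) * Real.sin ((c - a) / 2) := by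
  have key : ((starRingEnd ℂ) (circlePt b - circlePt a) * (circlePt c - circlePt a)).im =
      4 * (Real.sin ((b - a) / 2) * Real.sin ((c - b) / 2) * Real.sin ((c - a) / 2)) := by
    rw [ccw_det]
    simp only [circlePt_re, circlePt_im]
    obtain ⟨p, rfl⟩ : ∃ p, a = 2 * p := ⟨a / 2, by ring⟩
    obtain ⟨q, rfl⟩ : ∃ q, b = 2 * q := ⟨b / 2, by ring⟩
    obtain ⟨r, rfl⟩ : ∃ r, c = 2 * r := ⟨c / 2, by ring⟩
    rw [show (2 * q - 2 * p) / 2 = q - p by ring, show (2 * r - 2 * q) / 2 = r - q by ring,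
      show (2 * r - 2 * p) / 2 = r - p by ring]
    simp only [Real.cos_two_mul', Real.sin_two_mul, Real.sin_sub]
    have hp := Real.sin_sq_add_cos_sq p
    have hq := Real.sin_sq_add_cos_sq q
    have hr := Real.sin_sq_add_cos_sq r
    generalize Real.sin p = sp at *
    generalize Real.cos p = cp at *
    generalize Real.sin q = sq at *
    generalize Real.cos q = cq at *
    generalize Real.sin r = sr at *
    generalize Real.cos r = cr at *
    have e : ∀ s c s' c' : ℝ, s ^ 2 + c ^ 2 = 1 → s' ^ 2 + c' ^ 2 = 1 →
      c ^ 2 - s ^ 2 - (c' ^ 2 - s' ^ 2) = 2 * (s' * c - c' * s) * (s' * c + c' * s) := by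
      intro s c s' c' h h'
      linear_combination (1 - 2 * s' ^ 2) * h + (2 * s ^ 2 - 1) * h'
    have e' : ∀ s c s' c' : ℝ, s ^ 2 + c ^ 2 = 1 → s' ^ 2 + c' ^ 2 = 1 →
      2 * s' * c' - 2 * s * c = 2 * (s' * c - c' * s) * (c' * c - s' * s) := by
      intro s c s' c' h h'
      linear_combination (-2 * s' * c') * h + (2 * s * c) * h'
    have e1 := e _ _ _ _ hp hq
    have e2 := e _ _ _ _ hp hr
    have e3 := e' _ _ _ _ hp hq
    have e4 := e' _ _ _ _ hp hr
    rw [show cq ^ 2 - sq ^ 2 - (cp ^ 2 - sp ^ 2) = -(2 * (sq * cp - cq * sp) * (sq * cp + cq * sp))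
      by linarith, show cr ^ 2 - sr ^ 2 - (cp ^ 2 - sp ^ 2) =
      -(2 * (sr * cp - cr * sp) * (sr * cp + cr * sp)) by linarith, e3, e4]
    linear_combination (4 * (sq * cp - cq * sp) * (sr * cp - cr * sp)) *
      (sr * cq - cr * sq) * hp
  unfold Ccw
  rw [key]
  constructor <;> intro h <;> linarith

/-- Over one turn starting at `a`, the halves of `b - a` and `c - a` lie in `[0, π)` and have
nonnegative sines, so the orientation is decided by the sign of `c - b`. -/
theorem ccw_circlePt_iff {a b c : ℝ} (hb : b ∈ Ico a (a + 2 * Real.pi))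
    (hc : c ∈ Ico a (a + 2 * Real.pi)) :
    Ccw (circlePt a) (circlePt b) (circlePt c) ↔ a < b ∧ b < c := by
  have hpi := Real.pi_pos
  obtain ⟨hb1, hb2⟩ := hb
  obtain ⟨hc1, hc2⟩ := hc
  rw [ccw_circlePt]
  have h1 : 0 ≤ Real.sin ((b - a) / 2) :=
    Real.sin_nonneg_of_nonneg_of_le_pi (by linarith) (by linarith)
  have h2 : 0 ≤ Real.sin ((c - a) / 2) :=
    Real.sin_nonneg_of_nonneg_of_le_pi (by linarith) (by linarith)
  constructor
  · intro h
    have hba : a < b := by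
      rcases hb1.lt_or_eq with h' | h'
      · exact h'
      · rw [← h'] at h; simp at h
    refine ⟨hba, ?_⟩
    by_contra! hcb
    have h3 : Real.sin ((c - b) / 2) ≤ 0 :=
      Real.sin_nonpos_of_nonpos_of_neg_pi_le (by linarith) (by linarith)
    have := mul_nonneg (mul_nonneg h1 (neg_nonneg.2 h3)) h2
    nlinarith
  · rintro ⟨h3, h4⟩
    refine mul_pos (mul_pos ?_ ?_) ?_ <;>
      exact Real.sin_pos_of_pos_of_lt_pi (by linarith) (by linarith)

theorem Ccw.rotate {x y z : ℂ} (h : Ccw x y z) : Ccw y z x := by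
  unfold Ccw at *
  rw [ccw_det] at *
  linarith

theorem Ccw.not_swap {x y z : ℂ} (h : Ccw x y z) : ¬ Ccw x z y := by
  unfold Ccw at *
  rw [ccw_det] at *
  linarith

theorem Ccw.ne {x y z : ℂ} (h : Ccw x y z) : x ≠ y := by
  rintro rfl
  unfold Ccw at h
  simp at h

theorem ccw_or_ccw {x y z : ℂ} (hx : ‖x‖ = 1) (hy : ‖y‖ = 1) (hz : ‖z‖ = 1) (hxy : x ≠ y)
    (hxz : x ≠ z) (hyz : y ≠ z) : Ccw x y z ∨ Ccw x z y := by
  obtain ⟨a, -, rfl⟩ := exists_circlePt hx 0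
  obtain ⟨b, hb, rfl⟩ := exists_circlePt hy a
  obtain ⟨c, hc, rfl⟩ := exists_circlePt hz a
  rw [ccw_circlePt_iff hb hc, ccw_circlePt_iff hc hb]
  have h1 : a < b := lt_of_le_of_ne hb.1 fun h => hxy (by rw [h])
  have h2 : a < c := lt_of_le_of_ne hc.1 fun h => hxz (by rw [h])
  have h3 : b ≠ c := fun h => hyz (by rw [h])
  rcases lt_or_gt_of_ne h3 with h | h
  · exact .inl ⟨h1, h⟩
  · exact .inr ⟨h2, h⟩

/-- The open arc of the circle between two of its points is the image of an interval. -/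
theorem exists_arc_eq {x y : ℂ} (hx : ‖x‖ = 1) (hy : ‖y‖ = 1) (hxy : x ≠ y) :
    ∃ a b : ℝ, a < b ∧ b < a + 2 * Real.pi ∧ x = circlePt a ∧ y = circlePt b ∧
      {z : ℂ | ‖z‖ = 1 ∧ Ccw x z y} = circlePt '' Ioo a b := by
  obtain ⟨a, -, rfl⟩ := exists_circlePt hx 0
  obtain ⟨b, hb, rfl⟩ := exists_circlePt hy a
  have hab : a < b := lt_of_le_of_ne hb.1 fun h => hxy (by rw [h])
  refine ⟨a, b, hab, hb.2, rfl, rfl, ?_⟩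
  ext z
  constructor
  · rintro ⟨hz, h⟩
    obtain ⟨c, hc, rfl⟩ := exists_circlePt hz a
    exact ⟨c, (ccw_circlePt_iff hc hb).1 h, rfl⟩
  · rintro ⟨c, hc, rfl⟩
    exact ⟨norm_circlePt c, (ccw_circlePt_iff ⟨hc.1.le, hc.2.trans hb.2⟩ hb).2 hc⟩

/-- Four points in cyclic order cut the circle into four arcs. -/
theorem exists_ccw_of_four {c : Fin 4 → ℂ} (hc : ∀ j, ‖c j‖ = 1)
    (hord : ∀ i j k : Fin 4, i < j → j < k → Ccw (c i) (c j) (c k)) {z : ℂ} (hz : ‖z‖ = 1)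
    (hne : z ∉ range c) : ∃ j, Ccw (c j) z (c (j + 1)) := by
  by_contra! hcon
  have hzc : ∀ j, z ≠ c j := fun j h => hne ⟨j, h.symm⟩
  have hinj : ∀ i j k : Fin 4, i < j → j < k → c i ≠ c j ∧ c j ≠ c k ∧ c i ≠ c k :=
    fun i j k h1 h2 => ⟨(hord i j k h1 h2).ne, (hord i j k h1 h2).rotate.ne,
      (hord i j k h1 h2).rotate.rotate.ne.symm⟩
  have h012 := hinj 0 1 2 (by decide) (by decide)
  have h023 := hinj 0 2 3 (by decide) (by decide)
  obtain ⟨a, -, h0⟩ := exists_circlePt (hc 0) 0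
  obtain ⟨a1, ha1, h1⟩ := exists_circlePt (hc 1) a
  obtain ⟨a2, ha2, h2⟩ := exists_circlePt (hc 2) a
  obtain ⟨a3, ha3, h3⟩ := exists_circlePt (hc 3) a
  obtain ⟨t, ht, rfl⟩ := exists_circlePt hz a
  have o1 := hord 0 1 2 (by decide) (by decide)
  have o2 := hord 0 2 3 (by decide) (by decide)
  rw [h0, h1, h2, ccw_circlePt_iff ha1 ha2] at o1
  rw [h0, h2, h3, ccw_circlePt_iff ha2 ha3] at o2
  have q0 := hcon 0
  have q1 := hcon 1
  have q2 := hcon 2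
  have q3 := hcon 3
  rw [show (0 : Fin 4) + 1 = 1 from rfl, h0, h1, ccw_circlePt_iff ht ha1] at q0
  rw [show (1 : Fin 4) + 1 = 2 from rfl, h1, h2] at q1
  rw [show (2 : Fin 4) + 1 = 3 from rfl, h2, h3] at q2
  have q3' : ¬ Ccw (circlePt a) (circlePt a3) (circlePt t) := by
    intro h
    apply q3
    rw [show (3 : Fin 4) + 1 = 0 from rfl, h0, h3]
    exact h.rotate
  rw [ccw_circlePt_iff ha3 ht] at q3'
  have n0 : t ≠ a := fun h => hzc 0 (by rw [h0, h])
  have n1 : t ≠ a1 := fun h => hzc 1 (by rw [h1, h])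
  have n2 : t ≠ a2 := fun h => hzc 2 (by rw [h2, h])
  have n3 : t ≠ a3 := fun h => hzc 3 (by rw [h3, h])
  have p0 : a < t := lt_of_le_of_ne ht.1 n0.symm
  have p1 : a1 < t := lt_of_le_of_ne (not_lt.1 fun h => q0 ⟨p0, h⟩) n1.symm
  have p2 : a2 < t := by
    refine lt_of_le_of_ne (not_lt.1 fun h => q1 ?_) n2.symm
    exact (ccw_circlePt_iff ⟨p1.le, ht.2.trans (by linarith)⟩
      ⟨o1.2.le, ha2.2.trans (by linarith)⟩).2 ⟨p1, h⟩
  have p3 : a3 < t := by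
    refine lt_of_le_of_ne (not_lt.1 fun h => q2 ?_) n3.symm
    exact (ccw_circlePt_iff ⟨p2.le, ht.2.trans (by linarith)⟩
      ⟨o2.2.le, ha3.2.trans (by linarith)⟩).2 ⟨p2, h⟩
  exact q3' ⟨o2.1.trans o2.2, p3⟩

/-! ### Disjoint paths in the disk -/

/-- `l - log H` is continuous and takes values in the logarithms of the constant `u`, a discrete
set, so it is constant. The right half-plane keeps the principal logarithm continuous. -/
theorem im_sub_eq_arg_sub {l H : ℝ → ℂ} (hl : Continuous l) (hH : Continuous H) {u : ℂ}
    (hre : ∀ t, 0 < (H t).re) (h : ∀ t, Complex.exp (l t) = u * H t) :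
    (l 1).im - (l 0).im = Complex.arg (H 1) - Complex.arg (H 0) := by
  have hlog : Continuous fun t => l t - Complex.log (H t) := by
    refine hl.sub (continuous_iff_continuousAt.2 fun t => ?_)
    exact hH.continuousAt.clog (.inl (hre t))
  have hc : ∀ t, Complex.exp (l t - Complex.log (H t)) = u := by
    intro t
    have h0 : H t ≠ 0 := fun h0 => by have := hre t; rw [h0] at this; simp at this
    rw [Complex.exp_sub, Complex.exp_log h0, h, mul_div_cancel_right₀ _ h0]
  have := Complex.isCoveringMap_exp.const_of_comp hlog
    (fun a a' => Subtype.ext ((hc a).trans (hc a').symm)) 1 0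
  have h2 := congrArg Complex.im this
  simp only [Complex.sub_im, Complex.log_im] at h2
  linarith

/-- `1 - exp(it)` equals `2 sin(t/2) exp(i(t - π)/2)`, with positive modulus on this range. -/
theorem arg_one_sub_circlePt {t : ℝ} (h0 : 0 < t) (h1 : t < 2 * Real.pi) :
    Complex.arg (1 - circlePt t) = (t - Real.pi) / 2 := by
  have hs : 0 < Real.sin (t / 2) := Real.sin_pos_of_pos_of_lt_pi (by linarith) (by linarith)
  have : 1 - circlePt t = ((2 * Real.sin (t / 2) : ℝ) : ℂ) *
      (Real.cos ((t - Real.pi) / 2) + Real.sin ((t - Real.pi) / 2) * Complex.I) := by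
    have e1 : Real.cos ((t - Real.pi) / 2) = Real.sin (t / 2) := by
      rw [sub_div, Real.cos_sub_pi_div_two]
    have e2 : Real.sin ((t - Real.pi) / 2) = - Real.cos (t / 2) := by
      rw [sub_div, Real.sin_sub_pi_div_two]
    rw [e1, e2]
    have h3 : Real.cos t = 1 - 2 * Real.sin (t / 2) ^ 2 := by
      have := Real.cos_two_mul (t / 2)
      rw [show 2 * (t / 2) = t by ring] at this
      have := Real.sin_sq_add_cos_sq (t / 2)
      linarith
    have h4 : Real.sin t = 2 * Real.sin (t / 2) * Real.cos (t / 2) := by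
      rw [← Real.sin_two_mul]; congr 1; ring
    apply Complex.ext
    · simp only [Complex.sub_re, circlePt_re, h3]
      simp [Complex.add_re, Complex.mul_re, -Complex.ofReal_sin, -Complex.ofReal_cos]
      ring
    · simp only [Complex.sub_im, circlePt_im, h4]
      simp [Complex.add_im, Complex.mul_im, -Complex.ofReal_sin, -Complex.ofReal_cos]
  rw [this, Complex.ofReal_cos, Complex.ofReal_sin,
    Complex.arg_mul_cos_add_sin_mul_I (by linarith)]
  constructor <;> linarith [Real.pi_pos]

/-- The closed unit disk meets the half-plane `Re ≥ 1` only at `1`. -/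
theorem re_one_sub_div_pos {u z : ℂ} (hu : ‖u‖ = 1) (hz : ‖z‖ ≤ 1) (h : z ≠ u) :
    0 < (1 - z / u).re := by
  have hu0 : u ≠ 0 := fun h => by rw [h] at hu; simp at hu
  have h1 : ‖z / u‖ ≤ 1 := by rw [norm_div, hu, div_one]; exact hz
  have h2 : z / u ≠ 1 := fun h' => h ((div_eq_one_iff_eq hu0).1 h')
  by_contra! hcon
  simp only [Complex.sub_re, Complex.one_re, sub_nonpos] at hcon
  apply h2
  have h3 : (z / u).re ^ 2 + (z / u).im ^ 2 ≤ 1 := by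
    have := Complex.sq_norm (z / u)
    rw [Complex.normSq_apply] at this
    nlinarith [norm_nonneg (z / u)]
  have h4 : (z / u).im = 0 := by nlinarith
  apply Complex.ext
  · simp; nlinarith
  · simpa using h4

theorem circlePt_div (a b : ℝ) : circlePt a / circlePt b = circlePt (a - b) := by
  unfold circlePt
  rw [← Complex.exp_sub]
  congr 1
  push_cast
  ring

/-- Two paths in the disk whose endpoints on the circle are interleaved have a common point. -/
theorem exists_eq_of_interleaved {α β : ℝ → ℂ} (hα : Continuous α) (hβ : Continuous β)
    (hα1 : ∀ s, ‖α s‖ ≤ 1) (hβ1 : ∀ s, ‖β s‖ ≤ 1) (hα0 : ‖α 0‖ = 1) (hα1' : ‖α 1‖ = 1)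
    (hβ0 : ‖β 0‖ = 1) (hβ1' : ‖β 1‖ = 1) (h1 : Ccw (α 0) (β 0) (α 1))
    (h2 : Ccw (α 1) (β 1) (α 0)) : ∃ s t, α s = β t := by
  by_contra! hne
  -- For disjoint paths `α s - β t` never vanishes on the plane, so it has a continuous logarithm
  -- `l`. The increments of its imaginary part along the sides of the unit square should cancel, but
  -- they differ by `2π`.
  let G : C(ℝ × ℝ, ℂ) := ⟨fun p => α p.1 - β p.2, by fun_prop⟩
  obtain ⟨l0, hl0⟩ : ∃ l, Complex.exp l = G (0, 0) := by
    have : G (0, 0) ∈ range Complex.exp := by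
      rw [Complex.range_exp]; exact sub_ne_zero.2 (hne 0 0)
    exact this
  obtain ⟨l, ⟨-, hl⟩, -⟩ := Complex.isCoveringMapOn_exp.existsUnique_continuousMap_lifts G hl0
    (fun a => sub_ne_zero.2 (hne a.1 a.2))
  have hl' : ∀ s t, Complex.exp (l (s, t)) = α s - β t := fun s t => congrFun hl (s, t)
  obtain ⟨a, -, ha⟩ := exists_circlePt hα0 0
  obtain ⟨b, hb, hb'⟩ := exists_circlePt hβ0 a
  obtain ⟨c, hc, hc'⟩ := exists_circlePt hα1' a
  obtain ⟨d, hd, hd'⟩ := exists_circlePt hβ1' a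
  have h2 := h2.rotate.rotate
  rw [ha, hb', hc', ccw_circlePt_iff hb hc] at h1
  rw [ha, hc', hd', ccw_circlePt_iff hc hd] at h2
  have n0 : ∀ {z : ℂ}, ‖z‖ = 1 → z ≠ 0 := fun hz h => by rw [h] at hz; simp at hz
  -- On each side of the square one of the two points is fixed on the circle while the other stays
  -- in the disk; dividing by the fixed point puts the difference in a half-plane.
  have e1 := im_sub_eq_arg_sub (l := fun t => l (0, t)) (H := fun t => 1 - β t / α 0) (u := α 0)
    (by fun_prop) (by fun_prop) (fun t => re_one_sub_div_pos hα0 (hβ1 t) (hne 0 t).symm)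
    (fun t => by rw [hl', mul_sub, mul_div_cancel₀ _ (n0 hα0), mul_one])
  have e2 := im_sub_eq_arg_sub (l := fun t => l (1, t)) (H := fun t => 1 - β t / α 1) (u := α 1)
    (by fun_prop) (by fun_prop) (fun t => re_one_sub_div_pos hα1' (hβ1 t) (hne 1 t).symm)
    (fun t => by rw [hl', mul_sub, mul_div_cancel₀ _ (n0 hα1'), mul_one])
  have e3 := im_sub_eq_arg_sub (l := fun t => l (t, 0)) (H := fun t => 1 - α t / β 0) (u := -β 0)
    (by fun_prop) (by fun_prop) (fun t => re_one_sub_div_pos hβ0 (hα1 t) (hne t 0))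
    (fun t => by rw [hl', neg_mul, mul_sub, mul_div_cancel₀ _ (n0 hβ0), mul_one, neg_sub])
  have e4 := im_sub_eq_arg_sub (l := fun t => l (t, 1)) (H := fun t => 1 - α t / β 1) (u := -β 1)
    (by fun_prop) (by fun_prop) (fun t => re_one_sub_div_pos hβ1' (hα1 t) (hne t 1))
    (fun t => by rw [hl', neg_mul, mul_sub, mul_div_cancel₀ _ (n0 hβ1'), mul_one, neg_sub])
  simp only [ha, hb', hc', hd', circlePt_div] at e1 e2 e3 e4
  -- The argument formula needs angles in `(0, 2π)`. Negative differences are raised by a full turn,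
  -- which is what keeps the increments from cancelling.
  have w : ∀ x y : ℝ, circlePt (x - y) = circlePt (x - y + 2 * Real.pi) :=
    fun x y => (circlePt_add_two_pi _).symm
  rw [w b c] at e2
  rw [w a b] at e3
  rw [w c d, w a d] at e4
  have hpi := Real.pi_pos
  have hd2 := hd.2
  obtain ⟨h1, h1'⟩ := h1
  obtain ⟨h2, h2'⟩ := h2
  rw [arg_one_sub_circlePt (by linarith) (by linarith),
    arg_one_sub_circlePt (by linarith) (by linarith)] at e1 e2 e3 e4
  linarith

/-! ### Lengths of curves -/

/-- A local bound of distances by lengths is a global one. -/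
theorem edist_le_eVariationOn_of_local {X Y : Type*} [PseudoEMetricSpace X] [PseudoEMetricSpace Y]
    {u : ℝ → Y} {w : ℝ → X} {a b : ℝ} (hab : a ≤ b)
    (h : ∀ t ∈ Icc a b, ∃ U ∈ 𝓝 t, ∀ s ∈ U ∩ Icc a b, ∀ s' ∈ U ∩ Icc a b, s ≤ s' →
      edist (u s) (u s') ≤ eVariationOn w (Icc s s')) :
    edist (u a) (u b) ≤ eVariationOn w (Icc a b) := by
  choose! U hU h using h
  -- A subdivision each of whose pieces lies in one of the neighbourhoods; the bounds on the pieces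
  -- are then added.
  obtain ⟨t, ht0, htm, ⟨m, hm⟩, ht⟩ := exists_monotone_Icc_subset_open_cover_Icc hab
    (c := fun i : Icc a b => Subtype.val ⁻¹' interior (U i))
    (fun i => isOpen_interior.preimage continuous_subtype_val)
    (fun x _ => mem_iUnion.2 ⟨x, mem_interior_iff_mem_nhds.2 (hU x x.2)⟩)
  have key : ∀ n, edist (u (t 0)) (u (t n)) ≤ eVariationOn w (Icc (t 0 : ℝ) (t n)) := by
    intro n
    induction n with
    | zero => simp
    | succ n ih =>
      obtain ⟨i, hi⟩ := ht n
      have h01 : (t 0 : ℝ) ≤ t n := htm (Nat.zero_le n)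
      have h12 : (t n : ℝ) ≤ t (n + 1) := htm (Nat.le_succ n)
      have hstep := h i i.2 (t n) ⟨interior_subset (hi (left_mem_Icc.2 h12)), (t n).2⟩
        (t (n + 1)) ⟨interior_subset (hi (right_mem_Icc.2 h12)), (t (n + 1)).2⟩ h12
      calc edist (u (t 0)) (u (t (n + 1)))
          ≤ edist (u (t 0)) (u (t n)) + edist (u (t n)) (u (t (n + 1))) := edist_triangle _ _ _
        _ ≤ eVariationOn w (Icc (t 0 : ℝ) (t n)) + eVariationOn w (Icc (t n : ℝ) (t (n + 1))) :=
          add_le_add ih hstep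
        _ = _ := by
          simpa using eVariationOn.Icc_add_Icc w (s := univ) h01 h12 (mem_univ _)
  have := key m
  rwa [ht0, hm m le_rfl] at this

/-- A continuous locally injective function on an interval is injective. -/
theorem injOn_Ioo_of_locally_injective {θ : ℝ → ℝ} (hθ : Continuous θ) {a b : ℝ}
    (h : ∀ t ∈ Ioo a b, ∃ U ∈ 𝓝 t, InjOn θ U) : InjOn θ (Ioo a b) := by
  have main : ∀ s ∈ Ioo a b, ∀ t ∈ Ioo a b, s < t → θ s ≠ θ t := by
    intro s hs t ht hst heq
    -- Equal values force an interior local extremum, where local injectivity makes `θ` strictly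
    -- monotone.
    obtain ⟨c, hc, hext⟩ := exists_isLocalExtr_Ioo hst hθ.continuousOn heq
    obtain ⟨U, hU, hinj⟩ := h c ⟨hs.1.trans hc.1, hc.2.trans ht.2⟩
    obtain ⟨ε, hε, hεU⟩ := Metric.mem_nhds_iff.1 hU
    have hsub : Icc (c - ε / 2) (c + ε / 2) ⊆ U := by
      intro x hx
      apply hεU
      rw [Metric.mem_ball, Real.dist_eq, abs_lt]
      constructor <;> linarith [hx.1, hx.2]
    have hmono := hθ.continuousOn.strictMonoOn_of_injOn_Icc'
      (a := c - ε / 2) (b := c + ε / 2) (by linarith) (hinj.mono hsub)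
    -- A local minimum is already contradictory, so only a local maximum remains.
    have hev : ∃ δ > 0, ∀ x, |x - c| < δ → θ x ≤ θ c := by
      by_contra hcon
      rcases hext with hmin | hmax
      · obtain ⟨δ, hδ, hball⟩ := Metric.eventually_nhds_iff.1 hmin
        have hd : 0 < min (δ / 2) (ε / 2) := by positivity
        set d := min (δ / 2) (ε / 2)
        have hd1 : d ≤ δ / 2 := min_le_left _ _
        have hd2 : d ≤ ε / 2 := min_le_right _ _
        have h1 := @hball (c - d) (by
          rw [Real.dist_eq, show c - d - c = -d by ring, abs_neg, abs_of_pos hd]; linarith)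
        have h2 := @hball (c + d) (by
          rw [Real.dist_eq, show c + d - c = d by ring, abs_of_pos hd]; linarith)
        rcases hmono with hm | hm
        · have := hm (a := c - d) ⟨by linarith, by linarith⟩ (b := c) ⟨by linarith, by linarith⟩
            (by linarith)
          linarith
        · have := hm (a := c) ⟨by linarith, by linarith⟩ (b := c + d) ⟨by linarith, by linarith⟩
            (by linarith)
          linarith
      · obtain ⟨δ, hδ, hball⟩ := Metric.eventually_nhds_iff.1 hmax
        exact hcon ⟨δ, hδ, fun x hx => hball (by rwa [Real.dist_eq])⟩
    obtain ⟨δ, hδ, hball⟩ := hev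
    have hd : 0 < min (δ / 2) (ε / 2) := by positivity
    set d := min (δ / 2) (ε / 2)
    have hd1 : d ≤ δ / 2 := min_le_left _ _
    have hd2 : d ≤ ε / 2 := min_le_right _ _
    have h1 := hball (c - d) (by
      rw [show c - d - c = -d by ring, abs_neg, abs_of_pos hd]; linarith)
    have h2 := hball (c + d) (by
      rw [show c + d - c = d by ring, abs_of_pos hd]; linarith)
    rcases hmono with hm | hm
    · have := hm (a := c) ⟨by linarith, by linarith⟩ (b := c + d) ⟨by linarith, by linarith⟩
        (by linarith)
      linarith
    · have := hm (a := c - d) ⟨by linarith, by linarith⟩ (b := c) ⟨by linarith, by linarith⟩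
        (by linarith)
      linarith
  intro s hs t ht heq
  rcases lt_trichotomy s t with h1 | h1 | h1
  · exact absurd heq (main s hs t ht h1)
  · exact h1
  · exact absurd heq.symm (main t ht s hs h1)

theorem eVariationOn_le_of_edist_le {X Y : Type*} [PseudoEMetricSpace X] [PseudoEMetricSpace Y]
    {u : ℝ → Y} {w : ℝ → X} {S : Set ℝ}
    (h : ∀ s ∈ S, ∀ t ∈ S, edist (u s) (u t) ≤ edist (w s) (w t)) :
    eVariationOn u S ≤ eVariationOn w S := by
  apply iSup_le
  rintro ⟨n, p, hp, hpS⟩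
  exact (Finset.sum_le_sum fun i _ => h _ (hpS _) _ (hpS _)).trans (eVariationOn.sum_le hp hpS)

theorem MonotoneOn.Icc_of_Ioo {θ : ℝ → ℝ} (hθ : Continuous θ) {a b : ℝ}
    (h : MonotoneOn θ (Ioo a b)) : MonotoneOn θ (Icc a b) := by
  have h1 : ∀ s ∈ Ioo a b, ∀ t ∈ Icc a b, s ≤ t → θ s ≤ θ t := by
    intro s hs t ht hst
    rcases hst.lt_or_eq with hst | rfl
    · have : t ∈ closure (Ioo s t) := by rw [closure_Ioo hst.ne]; exact right_mem_Icc.2 hst.le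
      have hsub : closure (Ioo s t) ⊆ {x | θ s ≤ θ x} := by
        apply closure_minimal _ (isClosed_le continuous_const hθ)
        intro x hx
        exact h hs ⟨hs.1.trans hx.1, hx.2.trans_le ht.2⟩ hx.1.le
      exact hsub this
    · rfl
  intro s hs t ht hst
  rcases hst.lt_or_eq with hst | rfl
  · have : s ∈ closure (Ioo s t) := by rw [closure_Ioo hst.ne]; exact left_mem_Icc.2 hst.le
    have hsub : closure (Ioo s t) ⊆ {x | θ x ≤ θ t} := by
      apply closure_minimal _ (isClosed_le hθ continuous_const)
      intro x hx
      exact h1 x ⟨hs.1.trans_lt hx.1, hx.2.trans_le ht.2⟩ t ht hx.2.le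
    exact hsub this
  · rfl

/-- The length of a curve which is locally isometrically parametrized by an injective function. -/
theorem eVariationOn_eq_edist_of_local {X : Type*} [PseudoEMetricSpace X] {c : ℝ → X}
    (hc : Continuous c) {θ : ℝ → ℝ} (hθ : Continuous θ) {a b : ℝ} (hab : a < b)
    (hinj : ∀ t ∈ Ioo a b, ∃ U ∈ 𝓝 t, InjOn θ U)
    (hloc : ∀ t ∈ Ioo a b, ∃ U ∈ 𝓝 t, ∀ s ∈ U, ∀ s' ∈ U, edist (c s) (c s') = edist (θ s) (θ s')) :
    eVariationOn c (Icc a b) = edist (θ a) (θ b) := by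
  -- Being injective and continuous, `θ` is strictly monotone; if it decreases, `-θ` replaces it.
  wlog hmono : StrictMonoOn θ (Ioo a b) generalizing θ
  · have h := hθ.continuousOn.strictMonoOn_of_injOn_Ioo hab
      (injOn_Ioo_of_locally_injective hθ hinj)
    have hanti := h.resolve_left hmono
    have := this (θ := fun t => -θ t) (by fun_prop)
      (fun t ht => (hinj t ht).imp fun U hU => ⟨hU.1, fun x hx y hy hxy =>
        hU.2 hx hy (neg_injective hxy)⟩)
      (fun t ht => (hloc t ht).imp fun U hU => ⟨hU.1, fun x hx y hy => by
        rw [hU.2 x hx y hy, edist_neg_neg]⟩)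
      (fun x hx y hy hxy => neg_lt_neg (hanti hx hy hxy))
    rw [this, edist_neg_neg]
  have hmon : MonotoneOn θ (Icc a b) := hmono.monotoneOn.Icc_of_Ioo hθ
  have hvar : ∀ s ∈ Icc a b, ∀ t ∈ Icc a b, s ≤ t →
      eVariationOn θ (Icc s t) ≤ edist (θ s) (θ t) := by
    intro s hs t ht hst
    have h1 : Icc a b ∩ Icc s t = Icc s t :=
      inter_eq_right.2 (Icc_subset_Icc hs.1 ht.2)
    have := hmon.eVariationOn_eq hs ht
    rw [h1] at this
    rw [this, edist_comm, edist_dist, Real.dist_eq, abs_of_nonneg (sub_nonneg.2 (hmon hs ht hst))]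
  have hloc1 : ∀ s ∈ Ioo a b, ∀ t ∈ Ioo a b, s ≤ t → edist (c s) (c t) ≤ edist (θ s) (θ t) := by
    intro s hs t ht hst
    refine (edist_le_eVariationOn_of_local hst ?_).trans
      (hvar s (Ioo_subset_Icc_self hs) t (Ioo_subset_Icc_self ht) hst)
    intro x hx
    obtain ⟨U, hU, h⟩ := hloc x ⟨hs.1.trans_le hx.1, hx.2.trans_lt ht.2⟩
    exact ⟨U, hU, fun y hy z hz hyz => (h y hy.1 z hz.1).le.trans
      (eVariationOn.edist_le _ (left_mem_Icc.2 hyz) (right_mem_Icc.2 hyz))⟩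
  -- The local isometry is known on the open interval only, since the ends will be corners; bounds
  -- extend to the ends by continuity.
  have hclos : closure (Ioo a b ×ˢ Ioo a b) = Icc a b ×ˢ Icc a b := by
    rw [closure_prod_eq, closure_Ioo hab.ne]
  have hloc2 : ∀ s ∈ Icc a b, ∀ t ∈ Icc a b, edist (c s) (c t) ≤ edist (θ s) (θ t) := by
    have hsub : closure (Ioo a b ×ˢ Ioo a b) ⊆
        {p : ℝ × ℝ | edist (c p.1) (c p.2) ≤ edist (θ p.1) (θ p.2)} := by
      apply closure_minimal _ (isClosed_le (by fun_prop) (by fun_prop))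
      rintro ⟨s, t⟩ ⟨hs, ht⟩
      rcases le_total s t with h | h
      · exact hloc1 s hs t ht h
      · change edist (c s) (c t) ≤ edist (θ s) (θ t)
        rw [edist_comm, edist_comm (θ s)]
        exact hloc1 t ht s hs h
    intro s hs t ht
    exact hsub (hclos ▸ ⟨hs, ht⟩ : (s, t) ∈ closure (Ioo a b ×ˢ Ioo a b))
  apply le_antisymm
  · exact (eVariationOn_le_of_edist_le hloc2).trans
      (hvar a (left_mem_Icc.2 hab.le) b (right_mem_Icc.2 hab.le) hab.le)
  · have hloc3 : ∀ s ∈ Ioo a b, ∀ t ∈ Ioo a b, s ≤ t →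
        edist (θ s) (θ t) ≤ eVariationOn c (Icc a b) := by
      intro s hs t ht hst
      refine (edist_le_eVariationOn_of_local hst ?_).trans
        (eVariationOn.mono c (Icc_subset_Icc hs.1.le ht.2.le))
      intro x hx
      obtain ⟨U, hU, h⟩ := hloc x ⟨hs.1.trans_le hx.1, hx.2.trans_lt ht.2⟩
      exact ⟨U, hU, fun y hy z hz hyz => (h y hy.1 z hz.1).ge.trans
        (eVariationOn.edist_le _ (left_mem_Icc.2 hyz) (right_mem_Icc.2 hyz))⟩
    have hsub : closure (Ioo a b ×ˢ Ioo a b) ⊆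
        {p : ℝ × ℝ | edist (θ p.1) (θ p.2) ≤ eVariationOn c (Icc a b)} := by
      apply closure_minimal _ (isClosed_le (by fun_prop) continuous_const)
      rintro ⟨s, t⟩ ⟨hs, ht⟩
      rcases le_total s t with h | h
      · exact hloc3 s hs t ht h
      · change edist (θ s) (θ t) ≤ _
        rw [edist_comm]
        exact hloc3 t ht s hs h
    exact hsub (hclos ▸ ⟨left_mem_Icc.2 hab.le, right_mem_Icc.2 hab.le⟩ :
      (a, b) ∈ closure (Ioo a b ×ˢ Ioo a b))

/-! ### Curves in great circles -/

/-- Two orthogonal unit vectors can be completed to an orthonormal frame. -/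
theorem exists_frame {m u : UnitSphere} (hmu : sphInner m u = 0) :
    ∃ w : UnitSphere, sphInner m w = 0 ∧ sphInner u w = 0 ∧
      ∀ v : Space3, v = inner ℝ (m : Space3) v • (m : Space3) + inner ℝ (u : Space3) v • (u : Space3)
        + inner ℝ (w : Space3) v • (w : Space3) := by
  have ho : Orthonormal ℝ (({0, 1} : Set (Fin 3)).domRestrict ![(m : Space3), u, 0]) := by
    rw [orthonormal_iff_ite]
    have h2 : inner ℝ (u : Space3) (m : Space3) = (0 : ℝ) := by rw [real_inner_comm]; exact hmu
    have h3 : inner ℝ (m : Space3) (u : Space3) = (0 : ℝ) := hmu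
    rintro ⟨i, hi⟩ ⟨j, hj⟩
    simp only [mem_insert_iff, mem_singleton_iff] at hi hj
    rcases hi with rfl | rfl <;> rcases hj with rfl | rfl <;>
      simp [Set.domRestrict, h2, h3]
  obtain ⟨b, hb⟩ := ho.exists_orthonormalBasis_extension_of_card_eq (by simp)
  have hb0 : b 0 = m := hb 0 (by simp)
  have hb1 : b 1 = u := hb 1 (by simp)
  refine ⟨⟨b 2, by simp⟩, ?_, ?_, ?_⟩
  · change inner ℝ (m : Space3) (b 2) = 0
    rw [← hb0]; exact b.orthonormal.2 (by decide)
  · change inner ℝ (u : Space3) (b 2) = 0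
    rw [← hb1]; exact b.orthonormal.2 (by decide)
  · intro v
    have := b.sum_repr' v
    rw [Fin.sum_univ_three, hb0, hb1] at this
    exact this.symm

/-- A curve in a great circle has a continuous angle function. -/
theorem exists_continuous_angle {m : UnitSphere} {g : ℝ → UnitSphere} (hg : Continuous g)
    (hm : ∀ t, sphInner m (g t) = 0) :
    ∃ (u w : UnitSphere) (huw : sphInner u w = 0) (θ : ℝ → ℝ), Continuous θ ∧
      ∀ t, g t = sphArc u w huw (θ t) := by
  obtain ⟨w, hmw, huw, hrep⟩ := exists_frame (hm 0)
  set u := g 0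
  -- Coordinates of `g t` in the plane orthogonal to `m`, a point of the unit circle. Its continuous
  -- logarithm is purely imaginary and gives the angle.
  let z : C(ℝ, ℂ) := ⟨fun t => (sphInner u (g t) : ℂ) + (sphInner w (g t) : ℂ) * Complex.I, by
    have h1 : Continuous fun t => sphInner u (g t) :=
      continuous_sphInner.comp (continuous_const.prodMk hg)
    have h2 : Continuous fun t => sphInner w (g t) :=
      continuous_sphInner.comp (continuous_const.prodMk hg)
    fun_prop⟩
  have hsq : ∀ t, sphInner u (g t) ^ 2 + sphInner w (g t) ^ 2 = 1 := by
    intro t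
    have h1 := (g t).inner_self
    have h2 : inner ℝ (m : Space3) (g t : Space3) = 0 := hm t
    have h3 := hrep (g t)
    rw [h2, zero_smul, zero_add] at h3
    nth_rewrite 2 [h3] at h1
    rw [inner_add_right, real_inner_smul_right, real_inner_smul_right,
      real_inner_comm (u : Space3), real_inner_comm (w : Space3)] at h1
    simp only [sphInner]
    nlinarith
  have hz : ∀ t, ‖z t‖ = 1 := by
    intro t
    have : ‖z t‖ ^ 2 = 1 := by
      rw [Complex.sq_norm, Complex.normSq_apply]
      simp only [z, ContinuousMap.coe_mk, Complex.add_re, Complex.ofReal_re, Complex.mul_re,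
        Complex.I_re, Complex.ofReal_im, Complex.I_im, Complex.add_im, Complex.mul_im]
      have := hsq t
      nlinarith
    nlinarith [norm_nonneg (z t)]
  have hz0 : ∀ t, z t ≠ 0 := fun t h => by have := hz t; rw [h] at this; simp at this
  obtain ⟨l0, hl0⟩ : ∃ l, Complex.exp l = z 0 := by
    have : z 0 ∈ range Complex.exp := by rw [Complex.range_exp]; exact hz0 0
    exact this
  obtain ⟨l, ⟨-, hl⟩, -⟩ := Complex.isCoveringMapOn_exp.existsUnique_continuousMap_lifts z hl0 hz0
  have hre : ∀ t, (l t).re = 0 := by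
    intro t
    have h1 : Complex.exp (l t) = z t := congrFun hl t
    have h2 := Complex.norm_exp (l t)
    rw [h1, hz t] at h2
    exact (Real.exp_eq_one_iff _).1 h2.symm
  refine ⟨u, w, huw, fun t => (l t).im, Complex.continuous_im.comp l.continuous, fun t => ?_⟩
  have h1 : Complex.exp (l t) = z t := congrFun hl t
  have h2 : Real.cos (l t).im = sphInner u (g t) := by
    have := congrArg Complex.re h1
    rw [Complex.exp_re, hre t, Real.exp_zero, one_mul] at this
    simpa [z] using this
  have h3 : Real.sin (l t).im = sphInner w (g t) := by
    have := congrArg Complex.im h1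
    rw [Complex.exp_im, hre t, Real.exp_zero, one_mul] at this
    simpa [z] using this
  apply Subtype.ext
  simp only [sphArc, arcVec, h2, h3]
  have h4 := hrep (g t)
  have h5 : inner ℝ (m : Space3) (g t : Space3) = 0 := hm t
  rw [h5, zero_smul, zero_add] at h4
  exact h4

/-- A curve that is mapped locally isometrically and locally injectively to a great circle, and
whose length is less than `π`, has the same length as the geodesic arc between the images of its
endpoints. -/
theorem sphDist_eq_of_eVariationOn {X : Type*} [PseudoMetricSpace X] {c : ℝ → X}
    (hc : Continuous c) {m : UnitSphere} {g : ℝ → UnitSphere} (hg : Continuous g)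
    (hm : ∀ t, sphInner m (g t) = 0)
    (hinj : ∀ t ∈ Ioo (0 : ℝ) 1, ∃ U ∈ 𝓝 t, InjOn g U)
    (hloc : ∀ t ∈ Ioo (0 : ℝ) 1, ∃ U ∈ 𝓝 t, ∀ s ∈ U, ∀ s' ∈ U,
      dist (c s) (c s') = sphDist (g s) (g s'))
    {ℓ : ℝ} (h0 : 0 ≤ ℓ) (hpi : ℓ ≤ Real.pi) (hlen : eVariationOn c (Icc 0 1) = ENNReal.ofReal ℓ) :
    sphDist (g 0) (g 1) = ℓ := by
  obtain ⟨u, w, huw, θ, hθ, hgθ⟩ := exists_continuous_angle hg hm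
  have key := eVariationOn_eq_edist_of_local hc hθ zero_lt_one (a := 0) (b := 1)
    (fun t ht => (hinj t ht).imp fun U hU => ⟨hU.1, fun x hx y hy hxy =>
      hU.2 hx hy (by rw [hgθ, hgθ, hxy])⟩)
    (fun t ht => by
      obtain ⟨U, hU, h⟩ := hloc t ht
      -- The distance on the circle is the difference of the angles only while this is at most `π`.
      obtain ⟨V, hV, hVs⟩ : ∃ V ∈ 𝓝 t, ∀ s ∈ V, ∀ s' ∈ V, |θ s - θ s'| ≤ Real.pi := by
        refine ⟨θ ⁻¹' Metric.ball (θ t) (Real.pi / 2), hθ.continuousAt.preimage_mem_nhds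
          (Metric.ball_mem_nhds _ (by positivity)), fun s hs s' hs' => ?_⟩
        have h1 : dist (θ s) (θ t) < Real.pi / 2 := hs
        have h2 : dist (θ s') (θ t) < Real.pi / 2 := hs'
        have := dist_triangle_right (θ s) (θ s') (θ t)
        rw [Real.dist_eq (θ s) (θ s')] at this
        linarith
      refine ⟨U ∩ V, Filter.inter_mem hU hV, fun s hs s' hs' => ?_⟩
      rw [edist_dist, edist_dist, h s hs.1 s' hs'.1, hgθ, hgθ,
        sphDist_sphArc u w huw (hVs s hs.2 s' hs'.2), Real.dist_eq])
  rw [key, edist_dist, ENNReal.ofReal_eq_ofReal_iff dist_nonneg h0] at hlen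
  rw [Real.dist_eq] at hlen
  rw [hgθ, hgθ, sphDist_sphArc u w huw (by rw [hlen]; exact hpi), hlen]

/-! ### Orthogonal transformations from Gram matrices; caps and their normals -/

/-- Families of vectors with the same Gram matrix differ by an orthogonal transformation. -/
theorem exists_isometry_of_gram_eq {ι : Type*} {a b : ι → Space3} (hS : Spanning (range a))
    (h : ∀ i j, inner ℝ (b i) (b j) = inner ℝ (a i) (a j)) :
    ∃ A : Space3 ≃ₗᵢ[ℝ] Space3, ∀ i, b i = A (a i) := by
  classical
  -- This makes `g` below well defined: the Gram matrix determines which vectors coincide.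
  have heq : ∀ i j, a i = a j → b i = b j := by
    intro i j hij
    have : inner ℝ (b i - b j) (b i - b j) = 0 := by
      simp only [inner_sub_left, inner_sub_right, h, hij]
      ring
    rwa [inner_self_eq_zero, sub_eq_zero] at this
  let g : Space3 → Space3 := fun v => if hv : ∃ i, a i = v then b hv.choose else 0
  have hg : ∀ i, g (a i) = b i := by
    intro i
    have hv : ∃ j, a j = a i := ⟨i, rfl⟩
    simp only [g, dif_pos hv]
    exact heq _ _ hv.choose_spec
  obtain ⟨A, hA⟩ := exists_isometry_of_inner_eq hS g (by
    rintro _ ⟨i, rfl⟩ _ ⟨j, rfl⟩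
    rw [hg, hg, h])
  exact ⟨A, fun i => by rw [← hA _ ⟨i, rfl⟩, hg]⟩

theorem exists_orthogonal (u : UnitSphere) : ∃ m : UnitSphere, sphInner u m = 0 := by
  obtain ⟨m, hm, -⟩ := exists_sphArc (u := u) (v := u) (by
    have : sphInner u u = 1 := u.inner_self
    rw [this]; norm_num)
  exact ⟨m, hm⟩

/-- Half-caps span the space. -/
theorem spanning_halfCap {u n : UnitSphere} (hn : sphInner n u = 0) {r : ℝ} (hr : 0 < r) :
    Spanning (Subtype.val '' {v : UnitSphere | sphDist u v < r ∧ 0 ≤ sphInner n v}) := by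
  intro x hx
  obtain ⟨w, hnw, huw, hrep⟩ := exists_frame hn
  have hun : sphInner u n = 0 := by rw [sphInner_comm, hn]
  -- The half-cap contains `u` and the points at distance `s` from it towards `n` and towards `w`;
  -- as `sin s ≠ 0`, these three span.
  set s := min (r / 2) (Real.pi / 2) with hs
  have hpi := Real.pi_pos
  have hs0 : 0 < s := by positivity
  have hsr : s < r := lt_of_le_of_lt (min_le_left _ _) (by linarith)
  have hspi : s < Real.pi := lt_of_le_of_lt (min_le_right _ _) (by linarith)
  have hsin : 0 < Real.sin s := Real.sin_pos_of_pos_of_lt_pi hs0 hspi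
  have hdist : ∀ (m : UnitSphere) (hum : sphInner u m = 0), sphDist u (sphArc u m hum s) < r := by
    intro m hum
    have := sphDist_sphArc u m hum (a := 0) (b := s) (by
      rw [zero_sub, abs_neg, abs_of_pos hs0]; exact hspi.le)
    rw [sphArc_zero, zero_sub, abs_neg, abs_of_pos hs0] at this
    rwa [this]
  have hxu : inner ℝ x (u : Space3) = 0 :=
    hx _ ⟨u, ⟨by rw [sphDist_self]; exact hr, by rw [hn]⟩, rfl⟩
  have hx2 : ∀ (m : UnitSphere) (hum : sphInner u m = 0), 0 ≤ sphInner n (sphArc u m hum s) →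
      inner ℝ (m : Space3) x = 0 := by
    intro m hum h
    have := hx _ ⟨_, ⟨hdist m hum, h⟩, rfl⟩
    simp only [sphArc, arcVec, inner_add_right, real_inner_smul_right, hxu, mul_zero,
      zero_add] at this
    rw [real_inner_comm]
    exact (mul_eq_zero.1 this).resolve_left hsin.ne'
  have h1 := hx2 n hun (by
    rw [sphInner_sphArc_right, hn, show sphInner n n = 1 from n.inner_self]; linarith)
  have h2 := hx2 w huw (by rw [sphInner_sphArc_right, hn, hnw]; simp)
  rw [hrep x, h1, h2, real_inner_comm, hxu]
  simp

theorem spanning_cap (u : UnitSphere) {r : ℝ} (hr : 0 < r) :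
    Spanning (Subtype.val '' {v : UnitSphere | sphDist u v < r}) := by
  obtain ⟨n, hn⟩ := exists_orthogonal u
  exact (spanning_halfCap (n := n) (by rw [sphInner_comm, hn]) hr).mono
    (image_mono fun v hv => hv.1)

theorem sphInner_neg_left (u v : UnitSphere) : sphInner (-u) v = - sphInner u v := by
  simp [sphInner]

theorem eq_or_eq_neg_of_smul {n n' : UnitSphere} {a : ℝ} (h : (n : Space3) = a • (n' : Space3)) :
    n = n' ∨ n = -n' := by
  have h1 : |a| = 1 := by
    have := n.norm_eq
    rwa [h, norm_smul, n'.norm_eq, mul_one, Real.norm_eq_abs] at this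
  rcases eq_or_eq_neg_of_abs_eq h1 with rfl | rfl
  · left; apply Subtype.ext; simpa using h
  · right; apply Subtype.ext; simpa using h

theorem eq_or_eq_neg_trans {a b c : UnitSphere} (h1 : a = b ∨ a = -b) (h2 : b = c ∨ b = -c) :
    a = c ∨ a = -c := by
  rcases h1 with rfl | rfl <;> rcases h2 with rfl | rfl <;> simp

/-- A great circle is determined by any of its arcs. -/
theorem eq_or_eq_neg_of_arc {u n n' : UnitSphere} {r : ℝ} (hr : 0 < r) (hu : sphInner n' u = 0)
    (h : ∀ v, sphDist u v < r → sphInner n' v = 0 → sphInner n v = 0) : n = n' ∨ n = -n' := by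
  obtain ⟨w, hnw, huw, hrep⟩ := exists_frame hu
  set s := min (r / 2) (Real.pi / 2) with hs
  have hpi := Real.pi_pos
  have hs0 : 0 < s := by positivity
  have hsr : s < r := lt_of_le_of_lt (min_le_left _ _) (by linarith)
  have hspi : s < Real.pi := lt_of_le_of_lt (min_le_right _ _) (by linarith)
  have hsin : 0 < Real.sin s := Real.sin_pos_of_pos_of_lt_pi hs0 hspi
  have h1 := h u (by rw [sphDist_self]; exact hr) hu
  have h2 := h (sphArc u w huw s) (by
    have := sphDist_sphArc u w huw (a := 0) (b := s) (by
      rw [zero_sub, abs_neg, abs_of_pos hs0]; exact hspi.le)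
    rw [sphArc_zero, zero_sub, abs_neg, abs_of_pos hs0] at this
    rwa [this]) (by rw [sphInner_sphArc_right, hu, hnw]; simp)
  rw [sphInner_sphArc_right, h1, mul_zero, zero_add] at h2
  have h3 := (mul_eq_zero.1 h2).resolve_left hsin.ne'
  have h4 := hrep n
  rw [real_inner_comm (n : Space3) u, real_inner_comm (n : Space3) w] at h4
  have h5 : inner ℝ (n : Space3) (u : Space3) = 0 := h1
  have h6 : inner ℝ (n : Space3) (w : Space3) = 0 := h3
  rw [h5, h6, zero_smul, zero_smul, add_zero, add_zero] at h4
  exact eq_or_eq_neg_of_smul h4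

/-- The map `f` maps the ball of radius `r` around `x` isometrically onto the part in `H` of a cap
of the sphere. -/
structure IsCapChart {Q : Type*} [MetricSpace Q] (f : Q → UnitSphere) (x : Q) (r : ℝ)
    (H : Set UnitSphere) : Prop where
  pos : 0 < r
  le : r ≤ Real.pi / 2
  isom : ∀ y ∈ Metric.ball x r, ∀ z ∈ Metric.ball x r, dist y z = sphDist (f y) (f z)
  image : f '' Metric.ball x r = {v | sphDist (f x) v < r ∧ v ∈ H}

namespace IsCapChart

variable {Q : Type*} [MetricSpace Q] {f : Q → UnitSphere} {x : Q} {r : ℝ} {H : Set UnitSphere}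

theorem mem_self (h : IsCapChart f x r H) : x ∈ Metric.ball x r := Metric.mem_ball_self h.pos

theorem injOn (h : IsCapChart f x r H) : InjOn f (Metric.ball x r) := by
  intro y hy z hz hyz
  rw [← dist_eq_zero, h.isom y hy z hz, hyz, sphDist_self]

theorem shrink (h : IsCapChart f x r H) {r' : ℝ} (h0 : 0 < r') (hr : r' ≤ r) :
    IsCapChart f x r' H where
  pos := h0
  le := hr.trans h.le
  isom y hy z hz := h.isom y (Metric.ball_subset_ball hr hy) z (Metric.ball_subset_ball hr hz)
  image := by
    ext v
    constructor
    · rintro ⟨y, hy, rfl⟩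
      have hy' := Metric.ball_subset_ball hr hy
      refine ⟨?_, (h.image.subset ⟨y, hy', rfl⟩).2⟩
      rw [← h.isom x h.mem_self y hy', dist_comm]
      exact hy
    · rintro ⟨hv, hvH⟩
      obtain ⟨y, hy, rfl⟩ := h.image.superset ⟨hv.trans_le hr, hvH⟩
      refine ⟨y, ?_, rfl⟩
      rw [← h.isom x h.mem_self y hy, dist_comm] at hv
      exact hv

end IsCapChart

/-! ### Corners and sides of a rectangle -/

theorem fin4_add_three : ∀ j : Fin 4, j + 3 + 1 = j := by decide

theorem fin4_add_three' : ∀ j : Fin 4, j + 3 + 2 = j + 1 := by decide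

theorem fin4_add_one_add_one : ∀ j : Fin 4, j + 1 + 1 = j + 2 := by decide

theorem fin4_cases : ∀ j k : Fin 4, k ≠ j → k ≠ j + 1 → k = j + 2 ∨ k = j + 3 := by decide

namespace MarkedSphericalRectangle

variable {Q : Type*} [MetricSpace Q] (R : MarkedSphericalRectangle Q) {f : Q → UnitSphere}

theorem norm_chart_le (x : Q) : ‖(R.chart x : ℂ)‖ ≤ 1 := by
  exact mem_closedBall_zero_iff.1 (R.chart x).2

theorem mem_boundary {x : Q} : x ∈ R.boundary ↔ ‖(R.chart x : ℂ)‖ = 1 := Iff.rfl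

theorem notMem_boundary {x : Q} : x ∉ R.boundary ↔ ‖(R.chart x : ℂ)‖ < 1 := by
  rw [R.mem_boundary]
  exact ⟨fun h => lt_of_le_of_ne (R.norm_chart_le x) h, fun h => h.ne⟩

theorem continuous_chart : Continuous fun x => (R.chart x : ℂ) :=
  continuous_subtype_val.comp R.chart.continuous

theorem corner_mem_boundary (j : Fin 4) : R.corner j ∈ R.boundary := R.corner_mem j

include R in
theorem compactSpace : CompactSpace Q := R.chart.symm.compactSpace

theorem chart_injective {x y : Q} (h : (R.chart x : ℂ) = R.chart y) : x = y :=
  R.chart.injective (Subtype.ext h)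

/-- The boundary point with a given argument in the standard disk. -/
def boundaryPt (t : ℝ) : Q :=
  R.chart.symm ⟨circlePt t, by simp [norm_circlePt]⟩

@[simp] theorem chart_boundaryPt (t : ℝ) : (R.chart (R.boundaryPt t) : ℂ) = circlePt t := by
  simp [boundaryPt]

theorem continuous_boundaryPt : Continuous R.boundaryPt :=
  R.chart.symm.continuous.comp (continuous_circlePt.subtype_mk _)

theorem boundaryPt_mem (t : ℝ) : R.boundaryPt t ∈ R.boundary := by
  rw [R.mem_boundary, chart_boundaryPt, norm_circlePt]

theorem ccw_corner_succ (j : Fin 4) : Ccw (R.chart (R.corner j)) (R.chart (R.corner (j + 1)))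
    (R.chart (R.corner (j + 2))) := by
  fin_cases j
  · exact R.corner_order 0 1 2 (by decide) (by decide)
  · exact R.corner_order 1 2 3 (by decide) (by decide)
  · exact (R.corner_order 0 2 3 (by decide) (by decide)).rotate
  · exact (R.corner_order 0 1 3 (by decide) (by decide)).rotate.rotate

theorem corner_injective : Function.Injective R.corner := by
  have h : ∀ i j : Fin 4, i < j → R.corner i ≠ R.corner j := by
    intro i j hij heq
    have hc : ∀ k, (i < k ∧ j < k) ∨ (k < i ∧ k < j) ∨ (i < k ∧ k < j) → False := by
      rintro k (⟨h1, h2⟩ | ⟨h1, h2⟩ | ⟨h1, h2⟩)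
      · exact (R.corner_order i j k hij h2).ne (by rw [heq])
      · exact (R.corner_order k i j h1 hij).rotate.ne (by rw [heq])
      · exact (R.corner_order i k j h1 h2).rotate.rotate.ne (by rw [heq])
    revert hc
    fin_cases i <;> fin_cases j <;> simp_all <;> decide
  intro i j hij
  rcases lt_trichotomy i j with h1 | h1 | h1
  · exact absurd hij (h i j h1)
  · exact h1
  · exact absurd hij.symm (h j i h1)

theorem exists_side_eq (j : Fin 4) : ∃ a b : ℝ, a < b ∧ b < a + 2 * Real.pi ∧
    R.corner j = R.boundaryPt a ∧ R.corner (j + 1) = R.boundaryPt b ∧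
      R.side j = R.boundaryPt '' Ioo a b := by
  obtain ⟨a, b, hab, hb, ha', hb', h⟩ := exists_arc_eq (R.corner_mem j) (R.corner_mem (j + 1))
    (R.ccw_corner_succ j).ne
  refine ⟨a, b, hab, hb, R.chart_injective (by rw [ha', chart_boundaryPt]),
    R.chart_injective (by rw [hb', chart_boundaryPt]), ?_⟩
  ext x
  constructor
  · intro hx
    obtain ⟨t, ht, htx⟩ := (Set.ext_iff.1 h (R.chart x : ℂ)).1 hx
    exact ⟨t, ht, R.chart_injective (by rw [chart_boundaryPt, htx])⟩
  · rintro ⟨t, ht, rfl⟩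
    have := h.superset ⟨t, ht, rfl⟩
    rw [← R.chart_boundaryPt] at this
    exact this

theorem isPreconnected_side (j : Fin 4) : IsPreconnected (R.side j) := by
  obtain ⟨a, b, -, -, -, -, h⟩ := R.exists_side_eq j
  rw [h]
  exact isPreconnected_Ioo.image _ R.continuous_boundaryPt.continuousOn

theorem side_nonempty (j : Fin 4) : (R.side j).Nonempty := by
  obtain ⟨a, b, hab, -, -, -, h⟩ := R.exists_side_eq j
  rw [h]
  exact (nonempty_Ioo.2 hab).image _

theorem corner_mem_closure_side (j : Fin 4) : R.corner j ∈ closure (R.side j) := by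
  obtain ⟨a, b, hab, -, ha, -, h⟩ := R.exists_side_eq j
  rw [h, ha]
  exact image_closure_subset_closure_image R.continuous_boundaryPt
    ⟨a, by rw [closure_Ioo hab.ne]; exact left_mem_Icc.2 hab.le, rfl⟩

theorem corner_succ_mem_closure_side (j : Fin 4) : R.corner (j + 1) ∈ closure (R.side j) := by
  obtain ⟨a, b, hab, -, -, hb, h⟩ := R.exists_side_eq j
  rw [h, hb]
  exact image_closure_subset_closure_image R.continuous_boundaryPt
    ⟨b, by rw [closure_Ioo hab.ne]; exact right_mem_Icc.2 hab.le, rfl⟩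

theorem exists_mem_side {x : Q} (hx : x ∈ R.boundary) (hc : x ∉ range R.corner) :
    ∃ j, x ∈ R.side j := by
  obtain ⟨j, hj⟩ := exists_ccw_of_four (c := fun j => (R.chart (R.corner j) : ℂ))
    (fun j => R.corner_mem j) R.corner_order hx
    (fun ⟨j, hj⟩ => hc ⟨j, R.chart_injective hj⟩)
  exact ⟨j, hx, hj⟩

theorem isOpen_setOf_ccw (a b : ℂ) : IsOpen {x : Q | Ccw a (R.chart x) b} := by
  have := R.continuous_chart
  unfold Ccw
  exact isOpen_lt continuous_const (by fun_prop)

/-- A connected part of the boundary without corners is contained in a side. -/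
theorem subset_side_of_isPreconnected {S : Set Q} (hS : IsPreconnected S)
    (hSb : S ⊆ R.boundary \ range R.corner) {j : Fin 4} (h : (S ∩ R.side j).Nonempty) :
    S ⊆ R.side j := by
  intro x hx
  by_contra hxj
  have hcov : S ⊆ {x : Q | Ccw (R.chart (R.corner j)) (R.chart x) (R.chart (R.corner (j + 1)))} ∪
      {x : Q | Ccw (R.chart (R.corner (j + 1))) (R.chart x) (R.chart (R.corner j))} := by
    intro y hy
    have hy' := hSb hy
    have hne : ∀ k, (R.chart (R.corner k) : ℂ) ≠ R.chart y := fun k hk =>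
      hy'.2 ⟨k, R.chart_injective hk⟩
    rcases ccw_or_ccw (R.corner_mem j) hy'.1 (R.corner_mem (j + 1)) (hne j)
      (R.ccw_corner_succ j).ne (hne (j + 1)).symm with h1 | h1
    · exact .inl h1
    · exact .inr h1.rotate
  obtain ⟨y, hy, hyj⟩ := h
  obtain ⟨z, hz, hz1, hz2⟩ := hS _ _ (R.isOpen_setOf_ccw _ _) (R.isOpen_setOf_ccw _ _) hcov
    ⟨y, hy, hyj.2⟩ ⟨x, hx, (hcov hx).resolve_left fun h => hxj ⟨(hSb hx).1, h⟩⟩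
  exact Ccw.not_swap hz1 (Ccw.rotate hz2).rotate

theorem side_subset_compl_corner (j : Fin 4) : R.side j ⊆ (range R.corner)ᶜ := by
  rintro _ hx ⟨k, rfl⟩
  obtain ⟨-, h⟩ := hx
  have h1 : k ≠ j := by rintro rfl; exact h.ne rfl
  have h2 : k ≠ j + 1 := by rintro rfl; exact h.rotate.ne rfl
  have h3 : k = j + 2 ∨ k = j + 3 := fin4_cases j k h1 h2
  rcases h3 with rfl | rfl
  · exact (R.ccw_corner_succ j).not_swap h
  · have := R.ccw_corner_succ (j + 3)
    rw [fin4_add_three j, fin4_add_three' j] at this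
    exact this.not_swap h.rotate

theorem disjoint_side_succ (j : Fin 4) : Disjoint (R.side j) (R.side (j + 1)) := by
  rw [Set.disjoint_left]
  rintro x ⟨hx, h1⟩ ⟨-, h2⟩
  have h3 := R.ccw_corner_succ j
  rw [fin4_add_one_add_one j] at h2
  obtain ⟨a, -, ha⟩ := exists_circlePt (R.corner_mem j) 0
  obtain ⟨b, hb, hb'⟩ := exists_circlePt (R.corner_mem (j + 1)) a
  obtain ⟨c, hc, hc'⟩ := exists_circlePt (R.corner_mem (j + 2)) a
  obtain ⟨t, ht, ht'⟩ := exists_circlePt hx a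
  rw [ha, ht', hb', ccw_circlePt_iff ht hb] at h1
  rw [ha, hb', hc', ccw_circlePt_iff hb hc] at h3
  rw [hb', ht', hc'] at h2
  obtain ⟨h1, h1'⟩ := h1
  obtain ⟨h3, h3'⟩ := h3
  have hc2 := hc.2
  have : Ccw (circlePt t) (circlePt b) (circlePt c) :=
    (ccw_circlePt_iff ⟨by linarith, by linarith⟩ ⟨by linarith, by linarith⟩).2 ⟨h1', h3'⟩
  exact this.not_swap h2.rotate

/-! ### Local form of the developing map -/

/-- Curvature 1 provides some isometry `e` of a ball onto a cap. On a smaller ball `f` has the same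
Gram matrix as `e`, and caps span, so `f = A ∘ e` with `A` orthogonal, and `f` itself is onto a cap.
-/
theorem exists_capChart_of_interior (hf : R.IsDevelopingMap f) {x : Q} (hx : x ∉ R.boundary) :
    ∃ r, IsCapChart f x r univ := by
  obtain ⟨r, hr0, hr, e, hiso, himg⟩ := R.spherical_interior x (R.notMem_boundary.1 hx)
  obtain ⟨U, hU, hUf⟩ := hf.2 x fun ⟨j, hj⟩ => hx (hj ▸ R.corner_mem_boundary j)
  obtain ⟨ρ, hρ, hρU⟩ := Metric.mem_nhds_iff.1 hU
  have he : IsCapChart e x r univ := ⟨hr0, hr, hiso, by simpa using himg⟩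
  set s := min r ρ
  have hes := he.shrink (r' := s) (lt_min hr0 hρ) (min_le_left _ _)
  have hfs : ∀ y ∈ Metric.ball x s, ∀ z ∈ Metric.ball x s, dist y z = sphDist (f y) (f z) :=
    fun y hy z hz => hUf y (hρU (Metric.ball_subset_ball (min_le_right _ _) hy))
      z (hρU (Metric.ball_subset_ball (min_le_right _ _) hz))
  obtain ⟨A, hA⟩ := exists_isometry_of_gram_eq
    (a := fun y : Metric.ball x s => (e y : Space3)) (b := fun y => (f y : Space3))
    ((spanning_cap (e x) hes.pos).mono (by
      rintro _ ⟨v, hv, rfl⟩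
      obtain ⟨y, hy, rfl⟩ := hes.image.superset ⟨hv, mem_univ _⟩
      exact ⟨⟨y, hy⟩, rfl⟩))
    (fun y z => sphInner_eq_of_sphDist_eq
      ((hfs y y.2 z z.2).symm.trans (hes.isom y y.2 z z.2)))
  have hA' : ∀ y ∈ Metric.ball x s, f y = sphMap A (e y) := fun y hy => Subtype.ext (hA ⟨y, hy⟩)
  refine ⟨s, hes.pos, hes.le, hfs, ?_⟩
  ext v
  constructor
  · rintro ⟨y, hy, rfl⟩
    refine ⟨?_, mem_univ _⟩
    rw [← hfs x hes.mem_self y hy, dist_comm]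
    exact hy
  · rintro ⟨hv, -⟩
    obtain ⟨y, hy, hyv⟩ := (Set.ext_iff.1 hes.image (sphMap A.symm v)).2 ⟨by
      rwa [← sphDist_sphMap A, sphMap_sphMap_symm, ← hA' x hes.mem_self], mem_univ _⟩
    exact ⟨y, hy, by rw [hA' y hy, hyv, sphMap_sphMap_symm]⟩

/-- `n` is the inner normal at `x` of the great circle to which `f` maps the boundary near `x`. -/
def IsInnerNormal (f : Q → UnitSphere) (x : Q) (n : UnitSphere) : Prop :=
  sphInner n (f x) = 0 ∧ ∃ r, IsCapChart f x r {v | 0 ≤ sphInner n v} ∧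
    ∀ y ∈ Metric.ball x r, y ∈ R.boundary ↔ sphInner n (f y) = 0

/-- The argument for interior points, with half-caps, which still span; `A` carries the normal
along. -/
theorem exists_isInnerNormal (hf : R.IsDevelopingMap f) {x : Q} (hx : x ∈ R.boundary)
    (hc : x ∉ range R.corner) : ∃ n, R.IsInnerNormal f x n := by
  obtain ⟨r, hr0, hr, e, n, hn, hiso, himg, hb⟩ := R.geodesic_sides x hx hc
  obtain ⟨U, hU, hUf⟩ := hf.2 x hc
  obtain ⟨ρ, hρ, hρU⟩ := Metric.mem_nhds_iff.1 hU
  have he : IsCapChart e x r {v | 0 ≤ sphInner n v} := ⟨hr0, hr, hiso, himg⟩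
  set s := min r ρ
  have hes := he.shrink (r' := s) (lt_min hr0 hρ) (min_le_left _ _)
  have hfs : ∀ y ∈ Metric.ball x s, ∀ z ∈ Metric.ball x s, dist y z = sphDist (f y) (f z) :=
    fun y hy z hz => hUf y (hρU (Metric.ball_subset_ball (min_le_right _ _) hy))
      z (hρU (Metric.ball_subset_ball (min_le_right _ _) hz))
  obtain ⟨A, hA⟩ := exists_isometry_of_gram_eq
    (a := fun y : Metric.ball x s => (e y : Space3)) (b := fun y => (f y : Space3))
    ((spanning_halfCap hn hes.pos).mono (by
      rintro _ ⟨v, hv, rfl⟩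
      obtain ⟨y, hy, rfl⟩ := hes.image.superset hv
      exact ⟨⟨y, hy⟩, rfl⟩))
    (fun y z => sphInner_eq_of_sphDist_eq
      ((hfs y y.2 z z.2).symm.trans (hes.isom y y.2 z z.2)))
  have hA' : ∀ y ∈ Metric.ball x s, f y = sphMap A (e y) := fun y hy => Subtype.ext (hA ⟨y, hy⟩)
  have hAn : ∀ y ∈ Metric.ball x s, sphInner (sphMap A n) (f y) = sphInner n (e y) := by
    intro y hy
    rw [hA' y hy, sphInner_sphMap]
  refine ⟨sphMap A n, by rw [hAn x hes.mem_self, hn], s, ⟨hes.pos, hes.le, hfs, ?_⟩, ?_⟩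
  · ext v
    constructor
    · rintro ⟨y, hy, rfl⟩
      refine ⟨?_, ?_⟩
      · rw [← hfs x hes.mem_self y hy, dist_comm]
        exact hy
      · change 0 ≤ sphInner (sphMap A n) (f y)
        rw [hAn y hy]
        exact (hes.image.subset ⟨y, hy, rfl⟩).2
    · rintro ⟨hv, hv'⟩
      obtain ⟨y, hy, hyv⟩ := (Set.ext_iff.1 hes.image (sphMap A.symm v)).2 ⟨by
        rwa [← sphDist_sphMap A, sphMap_sphMap_symm, ← hA' x hes.mem_self], by
        change 0 ≤ sphInner n _
        rw [← sphInner_sphMap A, sphMap_sphMap_symm]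
        exact hv'⟩
      exact ⟨y, hy, by rw [hA' y hy, hyv, sphMap_sphMap_symm]⟩
  · intro y hy
    rw [hAn y hy]
    exact hb y (Metric.ball_subset_ball (min_le_left _ _) hy)

/-- If all boundary points near `x` are mapped to the great circle of normal `n'`, then `n'` is a
normal at `x`. -/
theorem IsInnerNormal.eq_or_eq_neg {x : Q} {n n' : UnitSphere} (h : R.IsInnerNormal f x n)
    {U : Set Q} (hU : U ∈ 𝓝 x) (hn' : ∀ y ∈ U ∩ R.boundary, sphInner n' (f y) = 0) :
    n' = n ∨ n' = -n := by
  obtain ⟨hnx, r, hr, hb⟩ := h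
  obtain ⟨ρ, hρ, hρU⟩ := Metric.mem_nhds_iff.1 hU
  have hrs := hr.shrink (r' := min r ρ) (lt_min hr.pos hρ) (min_le_left _ _)
  refine eq_or_eq_neg_of_arc hrs.pos hnx fun v hv hv0 => ?_
  obtain ⟨y, hy, rfl⟩ := hrs.image.superset ⟨hv, hv0.ge⟩
  exact hn' y ⟨hρU (Metric.ball_subset_ball (min_le_right _ _) hy),
    (hb y (Metric.ball_subset_ball (min_le_left _ _) hy)).2 hv0⟩

/-- Every side is mapped to a great circle. -/
theorem exists_side_normal (hf : R.IsDevelopingMap f) (j : Fin 4) :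
    ∃ n : UnitSphere, ∀ x ∈ R.side j, sphInner n (f x) = 0 ∧
      (R.IsInnerNormal f x n ∨ R.IsInnerNormal f x (-n)) := by
  have hex : ∀ x ∈ R.side j, ∃ n, R.IsInnerNormal f x n := fun x hx =>
    R.exists_isInnerNormal hf hx.1 (R.side_subset_compl_corner j hx)
  obtain ⟨x₀, hx₀⟩ := R.side_nonempty j
  obtain ⟨n₀, hn₀⟩ := hex x₀ hx₀
  -- Up to sign the normal is locally constant, because a chart at `x` describes the boundary at all
  -- points of its ball; the side is connected.
  have key : ∀ x ∈ R.side j, ∀ n n', R.IsInnerNormal f x₀ n → R.IsInnerNormal f x n' →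
      n = n' ∨ n = -n' := by
    intro x hx
    refine (R.isPreconnected_side j).induction₂ (fun x y => ∀ n n', R.IsInnerNormal f x n →
      R.IsInnerNormal f y n' → n = n' ∨ n = -n') ?_ ?_ ?_ hx₀ hx
    · intro x hx
      obtain ⟨n, hn⟩ := hex x hx
      obtain ⟨-, r, hr, hb⟩ := hn
      filter_upwards [mem_nhdsWithin_of_mem_nhds (Metric.ball_mem_nhds x hr.pos)] with y hy
      intro n₁ n₂ h₁ h₂
      have hball : Metric.ball x r ∈ 𝓝 y := Metric.isOpen_ball.mem_nhds hy
      have e1 := h₁.eq_or_eq_neg R (Metric.ball_mem_nhds x hr.pos)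
        (fun y hy => (hb y hy.1).1 hy.2)
      have e2 := h₂.eq_or_eq_neg R hball (fun y hy => (hb y hy.1).1 hy.2)
      exact eq_or_eq_neg_trans (e1.imp Eq.symm fun h => by rw [h, neg_neg]) e2
    · intro x y z _ hy _ h1 h2 n n' hn hn'
      obtain ⟨m, hm⟩ := hex y hy
      exact eq_or_eq_neg_trans (h1 n m hn hm) (h2 m n' hm hn')
    · intro x y _ _ h n n' hn hn'
      rcases h n' n hn' hn with rfl | rfl <;> simp
  refine ⟨n₀, fun x hx => ?_⟩
  obtain ⟨n, hn⟩ := hex x hx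
  rcases key x hx n₀ n hn₀ hn with rfl | rfl
  · exact ⟨hn.1, .inl hn⟩
  · refine ⟨by rw [sphInner_neg_left, hn.1, neg_zero], .inr ?_⟩
    rwa [neg_neg]

end MarkedSphericalRectangle

/-! ### Polar coordinates -/

/-- The vector of the unit sphere with polar coordinates `s, t`. -/
def polarVec (s t : ℝ) : Space3 :=
  !₂[Real.cos s, Real.sin s * Real.cos t, Real.sin s * Real.sin t]

theorem inner_space3 (v w : Space3) : inner ℝ v w = v 0 * w 0 + v 1 * w 1 + v 2 * w 2 := by
  rw [PiLp.inner_apply, Fin.sum_univ_three]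
  simp [mul_comm]

theorem inner_polarVec_right (w : Space3) (s t : ℝ) : inner ℝ w (polarVec s t) =
    Real.cos s * w 0 + Real.sin s * (Real.cos t * w 1 + Real.sin t * w 2) := by
  rw [inner_space3]
  simp [polarVec]
  ring

theorem inner_polarVec (s t s' t' : ℝ) : inner ℝ (polarVec s t) (polarVec s' t') =
    Real.cos s * Real.cos s' + Real.sin s * Real.sin s' * Real.cos (t - t') := by
  rw [inner_polarVec_right, Real.cos_sub]
  simp [polarVec]
  ring

/-- Two radii on one ray make `w` orthogonal to the apex direction and to the ray; two nonparallel
rays then leave only `w = 0`. -/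
theorem spanning_polar {S : Set Space3} {s₁ s₂ t₁ t₂ : ℝ} (hs : Real.sin (s₂ - s₁) ≠ 0)
    (ht : Real.sin (t₂ - t₁) ≠ 0)
    (h : ∀ s ∈ ({s₁, s₂} : Set ℝ), ∀ t ∈ ({t₁, t₂} : Set ℝ), polarVec s t ∈ S) : Spanning S := by
  intro w hw
  have key : ∀ t ∈ ({t₁, t₂} : Set ℝ), w 0 = 0 ∧ Real.cos t * w 1 + Real.sin t * w 2 = 0 := by
    intro t ht
    have h1 := hw _ (h s₁ (by simp) t ht)
    have h2 := hw _ (h s₂ (by simp) t ht)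
    rw [inner_polarVec_right] at h1 h2
    generalize Real.cos t * w 1 + Real.sin t * w 2 = g at *
    rw [Real.sin_sub] at hs
    constructor
    · apply (mul_eq_zero.1 _).resolve_left hs
      linear_combination Real.sin s₂ * h1 - Real.sin s₁ * h2
    · apply (mul_eq_zero.1 _).resolve_left hs
      linear_combination Real.cos s₁ * h2 - Real.cos s₂ * h1
  have h0 := (key t₁ (by simp)).1
  have h1 := (key t₁ (by simp)).2
  have h2 := (key t₂ (by simp)).2
  rw [Real.sin_sub] at ht
  have h3 : w 1 = 0 := by
    apply (mul_eq_zero.1 _).resolve_left ht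
    linear_combination Real.sin t₂ * h1 - Real.sin t₁ * h2
  have h4 : w 2 = 0 := by
    apply (mul_eq_zero.1 _).resolve_left ht
    linear_combination Real.cos t₁ * h2 - Real.cos t₂ * h1
  ext i
  fin_cases i
  · exact h0
  · exact h3
  · exact h4

/-- Supplies the second radius and the second angle for `spanning_polar`; distance below `π` keeps
the sine of the difference nonzero, and `t₀` may be an end of the interval. -/
theorem exists_near_ne {a b t₀ ε : ℝ} (hab : a < b) (ht : t₀ ∈ Icc a b) (hε : 0 < ε) :
    ∃ t ∈ Ioo a b, |t - t₀| < ε ∧ |t - t₀| < Real.pi ∧ t ≠ t₀ := by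
  have hmem : t₀ ∈ closure (Ioo a b \ {t₀}) := by
    have h1 : closure (Ioo a b) = Icc a b := closure_Ioo hab.ne
    have h2 : Ioo a b ⊆ closure (Ioo a b \ {t₀}) := by
      intro x hx
      by_cases hxt : x = t₀
      · subst hxt
        have : x ∈ closure (Ioo x b) := by
          rw [closure_Ioo hx.2.ne]; exact left_mem_Icc.2 hx.2.le
        exact closure_mono (show Ioo x b ⊆ Ioo a b \ {x} from
          fun y hy => ⟨⟨hx.1.trans hy.1, hy.2⟩, hy.1.ne'⟩) this
      · exact subset_closure ⟨hx, hxt⟩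
    exact closure_minimal h2 isClosed_closure (h1 ▸ ht)
  obtain ⟨t, ⟨ht1, ht2⟩, ht3⟩ := Metric.mem_closure_iff.1 hmem (min ε Real.pi)
    (lt_min hε Real.pi_pos)
  rw [dist_comm, Real.dist_eq] at ht3
  exact ⟨t, ht1, ht3.trans_le (min_le_left _ _), ht3.trans_le (min_le_right _ _), ht2⟩

theorem sin_ne_zero_of_abs_lt {x : ℝ} (h : |x| < Real.pi) (h0 : x ≠ 0) : Real.sin x ≠ 0 := by
  rw [abs_lt] at h
  intro hs
  rcases lt_or_gt_of_ne h0 with h1 | h1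
  · exact (Real.sin_neg_of_neg_of_neg_pi_lt h1 h.1).ne hs
  · exact (Real.sin_pos_of_pos_of_lt_pi h1 h.2).ne' hs

/-- Hence an orthogonal transformation is determined by its germ in polar coordinates, also along
the bounding rays. -/
theorem spanning_polar_of_mem_nhdsWithin {r β : ℝ} (hβ : 0 < β) {q : ℝ × ℝ}
    (hq : q ∈ Ioo 0 r ×ˢ Icc 0 β) {N : Set (ℝ × ℝ)} (hN : N ∈ 𝓝[Ioo 0 r ×ˢ Icc 0 β] q) :
    Spanning ((fun p : ℝ × ℝ => polarVec p.1 p.2) '' (N ∩ Ioo 0 r ×ˢ Icc 0 β)) := by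
  obtain ⟨ε, hε, hεN⟩ := Metric.mem_nhdsWithin_iff.1 hN
  obtain ⟨q1, q2⟩ := q
  have hr : 0 < r := hq.1.1.trans hq.1.2
  obtain ⟨s, hs, hs1, hs2, hs3⟩ := exists_near_ne hr (Ioo_subset_Icc_self hq.1) hε
  obtain ⟨t, ht, ht1, ht2, ht3⟩ := exists_near_ne hβ hq.2 hε
  refine spanning_polar (s₁ := q1) (s₂ := s) (t₁ := q2) (t₂ := t)
    (sin_ne_zero_of_abs_lt hs2 (sub_ne_zero.2 hs3)) (sin_ne_zero_of_abs_lt ht2 (sub_ne_zero.2 ht3))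
    ?_
  intro a ha b hb
  have ha' : a ∈ Ioo 0 r ∧ |a - q1| < ε := by
    rcases ha with rfl | rfl
    · exact ⟨hq.1, by simpa using hε⟩
    · exact ⟨hs, hs1⟩
  have hb' : b ∈ Icc 0 β ∧ |b - q2| < ε := by
    rcases hb with rfl | rfl
    · exact ⟨hq.2, by simpa using hε⟩
    · exact ⟨Ioo_subset_Icc_self ht, ht1⟩
  have hT : (a, b) ∈ Ioo 0 r ×ˢ Icc 0 β := ⟨ha'.1, hb'.1⟩
  refine ⟨(a, b), ⟨hεN ⟨?_, hT⟩, hT⟩, rfl⟩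
  rw [Metric.mem_ball, Prod.dist_eq, max_lt_iff, Real.dist_eq, Real.dist_eq]
  exact ⟨ha'.2, hb'.2⟩

theorem coneDist_eq {s t s' t' : ℝ} (h : |t - t'| ≤ Real.pi) :
    coneDist s t s' t' = Real.arccos (inner ℝ (polarVec s t) (polarVec s' t')) := by
  rw [coneDist, min_eq_left h, Real.cos_abs, inner_polarVec]

theorem coneDist_apex {s t t' : ℝ} (h0 : 0 ≤ s) (h : s ≤ Real.pi) : coneDist 0 t' s t = s := by
  simp [coneDist, Real.arccos_cos h0 h]

namespace MarkedSphericalRectangle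

variable {Q : Type*} [MetricSpace Q] (R : MarkedSphericalRectangle Q) {f : Q → UnitSphere}

/-- In polar coordinates around a corner, the developing map is an isometry followed by the
standard wrapping of the cone around the sphere. -/
theorem exists_polar_at_corner (hf : R.IsDevelopingMap f) (j : Fin 4) :
    ∃ (A : ℕ) (r : ℝ) (p : ℝ → ℝ → Q) (T : Space3 ≃ₗᵢ[ℝ] Space3), 0 < r ∧ r ≤ Real.pi / 2 ∧
      (∀ s ∈ Ico 0 r, ∀ t ∈ Icc 0 (Real.pi * (A + 1 / 2)), dist (R.corner j) (p s t) = s) ∧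
      {y | ∃ s ∈ Ico 0 r, ∃ t ∈ Icc 0 (Real.pi * (A + 1 / 2)), p s t = y} =
        Metric.ball (R.corner j) r ∧
      (∀ s ∈ Ioo 0 r, ∀ t ∈ Icc 0 (Real.pi * (A + 1 / 2)), p s t ∉ range R.corner) ∧
      (∀ s ∈ Ioo 0 r, ∀ t ∈ Icc 0 (Real.pi * (A + 1 / 2)),
        p s t ∈ R.boundary ↔ (t = 0 ∨ t = Real.pi * (A + 1 / 2))) ∧
      (∀ t ∈ Icc 0 (Real.pi * (A + 1 / 2)), ContinuousOn (fun s => p s t) (Ioo 0 r)) ∧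
      ∀ s ∈ Ico 0 r, ∀ t ∈ Icc 0 (Real.pi * (A + 1 / 2)), (f (p s t) : Space3) = T (polarVec s t)
      := by
  obtain ⟨A, r₀, hr₀, hr₀pi, p, hp0, hpd, hpb, hpB⟩ := R.conic_corners j
  set β := Real.pi * (A + 1 / 2) with hβdef
  have hβ : 0 < β := by positivity
  have hpi := Real.pi_pos
  -- The ball is shrunk until it contains no other corner.
  obtain ⟨r, hr, hrr, hrc⟩ : ∃ r, 0 < r ∧ r ≤ r₀ ∧
      ∀ k, R.corner k ∈ Metric.ball (R.corner j) r → k = j := by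
    have : (range R.corner \ {R.corner j})ᶜ ∈ 𝓝 (R.corner j) :=
      (((Set.finite_range R.corner).sdiff).isClosed.isOpen_compl).mem_nhds (by simp)
    obtain ⟨ε, hε, hεs⟩ := Metric.mem_nhds_iff.1 this
    refine ⟨min ε r₀, lt_min hε hr₀, min_le_right _ _, fun k hk => ?_⟩
    by_contra hne
    exact hεs (Metric.ball_subset_ball (min_le_left _ _) hk)
      ⟨⟨k, rfl⟩, fun h => hne (R.corner_injective h)⟩
  have hrpi : r ≤ Real.pi / 2 := hrr.trans hr₀pi
  have hIco : ∀ s ∈ Ico 0 r, s ∈ Ico 0 r₀ := fun s hs => ⟨hs.1, hs.2.trans_le hrr⟩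
  have hapex : ∀ s ∈ Ico 0 r₀, ∀ t ∈ Icc 0 β, dist (R.corner j) (p s t) = s := by
    intro s hs t ht
    rw [← hp0 t ht, hpd 0 ⟨le_rfl, hr₀⟩ t ht s hs t ht]
    exact coneDist_apex hs.1 (by linarith [hs.2])
  have hball : {y | ∃ s ∈ Ico 0 r, ∃ t ∈ Icc 0 β, p s t = y} = Metric.ball (R.corner j) r := by
    ext y
    constructor
    · rintro ⟨s, hs, t, ht, rfl⟩
      rw [Metric.mem_ball, dist_comm, hapex s (hIco s hs) t ht]
      exact hs.2
    · intro hy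
      obtain ⟨s, hs, t, ht, rfl⟩ := (Set.ext_iff.1 hpb y).2 (Metric.ball_subset_ball hrr hy)
      rw [Metric.mem_ball, dist_comm, hapex s hs t ht] at hy
      exact ⟨s, ⟨hs.1, hy⟩, t, ht, rfl⟩
  have hnc : ∀ s ∈ Ioo 0 r, ∀ t ∈ Icc 0 β, p s t ∉ range R.corner := by
    rintro s hs t ht ⟨k, hk⟩
    have hs' : s ∈ Ico 0 r := Ioo_subset_Ico_self hs
    have := hrc k (by rw [hk, ← hball]; exact ⟨s, hs', t, ht, rfl⟩)
    subst this
    have h2 := hapex s (hIco s hs') t ht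
    rw [← hk, dist_self] at h2
    exact hs.1.ne h2
  -- The apex is left out, since `f` need not be a local isometry there.
  set D := Ioo 0 r ×ˢ Icc 0 β with hD
  have hcont : ContinuousOn (fun q : ℝ × ℝ => p q.1 q.2) D := by
    intro q hq
    rw [ContinuousWithinAt, tendsto_iff_dist_tendsto_zero]
    have hcd : Filter.Tendsto (fun x : ℝ × ℝ => coneDist x.1 x.2 q.1 q.2) (𝓝[D] q) (𝓝 0) := by
      have hc : Continuous fun x : ℝ × ℝ => coneDist x.1 x.2 q.1 q.2 := by
        unfold coneDist
        exact Real.continuous_arccos.comp (by fun_prop)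
      have h0 : coneDist q.1 q.2 q.1 q.2 = 0 := by
        have h1 : Real.cos q.1 * Real.cos q.1 + Real.sin q.1 * Real.sin q.1 = 1 := by
          have := Real.sin_sq_add_cos_sq q.1; linarith
        simp [coneDist, hpi.le, h1]
      have := hc.tendsto q
      rw [h0] at this
      exact this.mono_left nhdsWithin_le_nhds
    refine hcd.congr' ?_
    filter_upwards [self_mem_nhdsWithin] with x hx
    exact (hpd _ (hIco _ (Ioo_subset_Ico_self hx.1)) _ hx.2 _
      (hIco _ (Ioo_subset_Ico_self hq.1)) _ hq.2).symm
  -- The isometry that represents `f` near `q`. It exists, is unique because germs span, and is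
  -- locally constant on the connected set `D`, so a single `T` serves for the whole sector.
  let Loc : ℝ × ℝ → (Space3 ≃ₗᵢ[ℝ] Space3) → Prop := fun q T =>
    ∀ᶠ x in 𝓝[D] q, (f (p x.1 x.2) : Space3) = T (polarVec x.1 x.2)
  have hLoc : ∀ q ∈ D, ∃ T, Loc q T := by
    intro q hq
    obtain ⟨U, hU, hUf⟩ := hf.2 _ (hnc _ hq.1 _ hq.2)
    have h1 := (hcont q hq).preimage_mem_nhdsWithin hU
    -- Among such points polar angles differ by less than `π`, so the cone distance is the spherical
    -- one.
    have h2 : {x : ℝ × ℝ | |x.2 - q.2| < Real.pi / 2} ∈ 𝓝[D] q := by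
      apply mem_nhdsWithin_of_mem_nhds
      apply (isOpen_lt (by fun_prop) continuous_const).mem_nhds
      simp only [mem_ofPred_eq, sub_self, abs_zero]
      positivity
    have hN := Filter.inter_mem h1 h2
    set N := ((fun q : ℝ × ℝ => p q.1 q.2) ⁻¹' U) ∩ {x : ℝ × ℝ | |x.2 - q.2| < Real.pi / 2}
    obtain ⟨T, hT⟩ := exists_isometry_of_gram_eq
      (a := fun x : ↥(N ∩ D) => polarVec x.1.1 x.1.2)
      (b := fun x : ↥(N ∩ D) => (f (p x.1.1 x.1.2) : Space3))
      ((spanning_polar_of_mem_nhdsWithin hβ hq hN).mono (by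
        rintro _ ⟨x, hx, rfl⟩
        exact ⟨⟨x, hx⟩, rfl⟩))
      (by
        rintro ⟨x, ⟨hxU, hx⟩, hxD⟩ ⟨y, ⟨hyU, hy⟩, hyD⟩
        have e1 := hUf _ hxU _ hyU
        change |x.2 - q.2| < Real.pi / 2 at hx
        change |y.2 - q.2| < Real.pi / 2 at hy
        have e2 : |x.2 - y.2| ≤ Real.pi := by
          rw [abs_lt] at hx hy
          rw [abs_le]
          constructor <;> linarith
        simp only at e1
        rw [hpd _ (hIco _ (Ioo_subset_Ico_self hxD.1)) _ hxD.2 _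
          (hIco _ (Ioo_subset_Ico_self hyD.1)) _ hyD.2, coneDist_eq e2] at e1
        change sphInner (f (p x.1 x.2)) (f (p y.1 y.2)) = _
        rw [← cos_sphDist, ← e1]
        have hn : ∀ s t, ‖polarVec s t‖ = 1 := by
          intro s t
          have h := inner_polarVec s t s t
          rw [real_inner_self_eq_norm_sq, sub_self, Real.cos_zero, mul_one] at h
          have := Real.sin_sq_add_cos_sq s
          nlinarith [norm_nonneg (polarVec s t)]
        have hb := abs_real_inner_le_norm (polarVec x.1 x.2) (polarVec y.1 y.2)
        rw [hn, hn, one_mul, abs_le] at hb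
        exact Real.cos_arccos hb.1 hb.2)
    refine ⟨T, ?_⟩
    filter_upwards [hN, self_mem_nhdsWithin] with x hx hxD
    exact hT ⟨x, hx, hxD⟩
  have hLocUniq : ∀ q ∈ D, ∀ T T', Loc q T → Loc q T' → T = T' := by
    intro q hq T T' h h'
    apply (spanning_polar_of_mem_nhdsWithin hβ hq (h.and h')).isometry_ext
    rintro _ ⟨x, ⟨⟨h1, h2⟩, -⟩, rfl⟩
    exact h1.symm.trans h2
  have hDc : IsPreconnected D := isPreconnected_Ioo.prod isPreconnected_Icc
  have key : ∀ q ∈ D, ∀ q' ∈ D, ∀ T T', Loc q T → Loc q' T' → T = T' := by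
    intro q hq q' hq'
    refine hDc.induction₂ (fun q q' => ∀ T T', Loc q T → Loc q' T' → T = T') ?_ ?_ ?_ hq hq'
    · intro q hq
      obtain ⟨T, hT⟩ := hLoc q hq
      filter_upwards [eventually_eventually_nhdsWithin.2 hT, self_mem_nhdsWithin] with y hy hyD
      intro T₁ T₂ h₁ h₂
      rw [hLocUniq q hq T₁ T h₁ hT, hLocUniq y hyD T₂ T h₂ hy]
    · intro x y z _ hy _ h1 h2 T T' h h'
      obtain ⟨S, hS⟩ := hLoc y hy
      rw [h1 T S h hS, h2 S T' hS h']
    · intro x y _ _ h T T' h1 h2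
      exact (h T' T h2 h1).symm
  have hq₀ : (r / 2, (0 : ℝ)) ∈ D := ⟨⟨by positivity, by linarith⟩, ⟨le_rfl, hβ.le⟩⟩
  obtain ⟨T, hT⟩ := hLoc _ hq₀
  have hfp : ∀ s ∈ Ioo 0 r, ∀ t ∈ Icc 0 β, (f (p s t) : Space3) = T (polarVec s t) := by
    intro s hs t ht
    have hq : (s, t) ∈ D := ⟨hs, ht⟩
    obtain ⟨T', hT'⟩ := hLoc _ hq
    rw [key _ hq₀ _ hq T T' hT hT']
    exact hT'.self_of_nhdsWithin hq
  -- The value at the apex is a limit along the ray `t = 0`.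
  have hfc : (f (R.corner j) : Space3) = T (polarVec 0 0) := by
    have hβ0 : (0 : ℝ) ∈ Icc 0 β := ⟨le_rfl, hβ.le⟩
    have hlim : Filter.Tendsto (fun s => p s 0) (𝓝[>] 0) (𝓝 (R.corner j)) := by
      rw [tendsto_iff_dist_tendsto_zero]
      have : Filter.Tendsto (fun s : ℝ => s) (𝓝[>] 0) (𝓝 0) := nhdsWithin_le_nhds
      refine this.congr' ?_
      filter_upwards [Ioo_mem_nhdsGT hr] with s hs
      rw [dist_comm, hapex s (hIco s (Ioo_subset_Ico_self hs)) 0 hβ0]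
    have h1 : Filter.Tendsto (fun s => (f (p s 0) : Space3)) (𝓝[>] 0)
        (𝓝 (f (R.corner j) : Space3)) :=
      (continuous_subtype_val.tendsto _).comp ((hf.1.tendsto _).comp hlim)
    have h2 : Filter.Tendsto (fun s => T (polarVec s 0)) (𝓝[>] 0) (𝓝 (T (polarVec 0 0))) := by
      have hc : Continuous fun s => T (polarVec s 0) := by
        unfold polarVec
        fun_prop
      exact (hc.tendsto 0).mono_left nhdsWithin_le_nhds
    refine tendsto_nhds_unique h1 (h2.congr' ?_)
    filter_upwards [Ioo_mem_nhdsGT hr] with s hs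
    exact (hfp s hs 0 hβ0).symm
  refine ⟨A, r, p, T, hr, hrpi, fun s hs t ht => hapex s (hIco s hs) t ht, hball, hnc, ?_, ?_, ?_⟩
  · intro s hs t ht
    have := hpB s (hIco s (Ioo_subset_Ico_self hs)) t ht
    exact ⟨fun h => (this.1 h).resolve_left hs.1.ne', fun h => this.2 (.inr h)⟩
  · intro t ht
    exact hcont.comp (f := fun s => (s, t)) (by fun_prop) fun s hs => ⟨hs, ht⟩
  · intro s hs t ht
    rcases hs.1.eq_or_lt with h0 | h0
    · rw [← h0, hp0 t ht, hfc]
      congr 1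
      simp [polarVec]
    · exact hfp s ⟨h0, hs.2⟩ t ht

/-- Near a corner, the developing map preserves the distance to the corner. -/
theorem exists_dist_corner_eq (hf : R.IsDevelopingMap f) (j : Fin 4) :
    ∃ U ∈ 𝓝 (R.corner j), ∀ y ∈ U, dist (R.corner j) y = sphDist (f (R.corner j)) (f y) := by
  obtain ⟨A, r, p, T, hr, hrpi, hd, hball, -, -, -, hT⟩ := R.exists_polar_at_corner hf j
  have h0 : (0 : ℝ) ∈ Icc 0 (Real.pi * (A + 1 / 2)) := ⟨le_rfl, by positivity⟩
  have hp0 : p 0 0 = R.corner j := by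
    have := hd 0 ⟨le_rfl, hr⟩ 0 h0
    exact (dist_eq_zero.1 this).symm
  refine ⟨Metric.ball (R.corner j) r, Metric.ball_mem_nhds _ hr, fun y hy => ?_⟩
  obtain ⟨s, hs, t, ht, rfl⟩ := (Set.ext_iff.1 hball y).2 hy
  rw [hd s hs t ht, sphDist_eq_arccos, sphInner, ← hp0, hT 0 ⟨le_rfl, hr⟩ 0 h0, hT s hs t ht,
    LinearIsometryEquiv.inner_map_map, inner_polarVec]
  simp [Real.arccos_cos hs.1 (by linarith [hs.2, Real.pi_pos])]

/-- The great circles of adjacent sides are perpendicular. -/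
theorem sphInner_side_normal_eq_zero (hf : R.IsDevelopingMap f) {n : Fin 4 → UnitSphere}
    (hn : ∀ j, ∀ x ∈ R.side j, sphInner (n j) (f x) = 0) (j : Fin 4) :
    sphInner (n j) (n (j + 1)) = 0 := by
  obtain ⟨A, r, p, T, hr, hrpi, hd, hball, hnc, hB, hpc, hT⟩ := R.exists_polar_at_corner hf (j + 1)
  set β := Real.pi * (A + 1 / 2) with hβdef
  have hβ : 0 < β := by positivity
  have hray : ∀ t, (t = 0 ∨ t = β) → ∀ k, ((fun s => p s t) '' Ioo 0 r ∩ R.side k).Nonempty →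
      (fun s => p s t) '' Ioo 0 r ⊆ R.side k := by
    intro t ht k hk
    have ht' : t ∈ Icc 0 β := by rcases ht with rfl | rfl <;> constructor <;> linarith
    refine R.subset_side_of_isPreconnected (isPreconnected_Ioo.image _ (hpc t ht')) ?_ hk
    rintro _ ⟨s, hs, rfl⟩
    exact ⟨(hB s hs t ht').2 ht, hnc s hs t ht'⟩
  -- A side ending at the corner runs along one of the two bounding rays.
  have hside : ∀ k, R.corner (j + 1) ∈ closure (R.side k) →
      ∃ t, (t = 0 ∨ t = β) ∧ (fun s => p s t) '' Ioo 0 r ⊆ R.side k := by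
    intro k hk
    obtain ⟨y, hy, hyd⟩ := Metric.mem_closure_iff.1 hk r hr
    rw [dist_comm] at hyd
    obtain ⟨s, hs, t, ht, rfl⟩ := (Set.ext_iff.1 hball y).2 hyd
    have hs0 : s ≠ 0 := by
      rintro rfl
      have := hd 0 hs t ht
      exact R.side_subset_compl_corner k hy ⟨_, dist_eq_zero.1 this⟩
    have hs' : s ∈ Ioo 0 r := ⟨lt_of_le_of_ne hs.1 hs0.symm, hs.2⟩
    have ht' := (hB s hs' t ht).1 hy.1
    exact ⟨t, ht', hray t ht' k ⟨_, ⟨s, hs', rfl⟩, hy⟩⟩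
  obtain ⟨t₁, ht₁, hsub₁⟩ := hside j (R.corner_succ_mem_closure_side j)
  obtain ⟨t₂, ht₂, hsub₂⟩ := hside (j + 1) (R.corner_mem_closure_side (j + 1))
  have hne : t₁ ≠ t₂ := by
    rintro rfl
    have hmem : p (r / 2) t₁ ∈ (fun s => p s t₁) '' Ioo 0 r :=
      ⟨r / 2, ⟨by positivity, by linarith⟩, rfl⟩
    exact Set.disjoint_left.1 (R.disjoint_side_succ j) (hsub₁ hmem) (hsub₂ hmem)
  -- `β` is an odd multiple of `π / 2`, so the two rays start in perpendicular directions on the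
  -- sphere.
  have hcosβ : Real.cos β = 0 := by
    rw [Real.cos_eq_zero_iff]
    exact ⟨A, by rw [hβdef]; push_cast; ring⟩
  have hsinβ : Real.sin β ≠ 0 := by
    intro h
    have := Real.sin_sq_add_cos_sq β
    rw [h, hcosβ] at this
    norm_num at this
  have hval : ∀ k t, (t = 0 ∨ t = β) → (fun s => p s t) '' Ioo 0 r ⊆ R.side k →
      (T.symm (n k)) 0 = 0 ∧
        Real.cos t * (T.symm (n k)) 1 + Real.sin t * (T.symm (n k)) 2 = 0 := by
    intro k t ht hsub
    have ht' : t ∈ Icc 0 β := by rcases ht with rfl | rfl <;> constructor <;> linarith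
    have h1 : ∀ s ∈ Ioo 0 r, Real.cos s * (T.symm (n k)) 0 + Real.sin s *
        (Real.cos t * (T.symm (n k)) 1 + Real.sin t * (T.symm (n k)) 2) = 0 := by
      intro s hs
      have := hn k _ (hsub ⟨s, hs, rfl⟩)
      rw [sphInner, hT s (Ioo_subset_Ico_self hs) t ht'] at this
      rw [← inner_polarVec_right, ← this, ← T.inner_map_map, T.apply_symm_apply]
    have e1 := h1 (r / 2) ⟨by positivity, by linarith⟩
    have e2 := h1 (r / 3) ⟨by positivity, by linarith⟩
    generalize Real.cos t * (T.symm (n k)) 1 + Real.sin t * (T.symm (n k)) 2 = g at *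
    have hs : Real.sin (r / 2 - r / 3) ≠ 0 :=
      (Real.sin_pos_of_pos_of_lt_pi (by linarith) (by linarith [Real.pi_pos])).ne'
    rw [Real.sin_sub] at hs
    constructor
    · apply (mul_eq_zero.1 _).resolve_left hs
      linear_combination Real.sin (r / 2) * e2 - Real.sin (r / 3) * e1
    · apply (mul_eq_zero.1 _).resolve_left hs
      linear_combination Real.cos (r / 3) * e1 - Real.cos (r / 2) * e2
  obtain ⟨a0, a1⟩ := hval j t₁ ht₁ hsub₁
  obtain ⟨b0, b1⟩ := hval (j + 1) t₂ ht₂ hsub₂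
  rw [sphInner, ← T.symm.inner_map_map, inner_space3, a0, b0]
  rcases ht₁ with rfl | rfl <;> rcases ht₂ with rfl | rfl
  · exact absurd rfl hne
  · rw [Real.cos_zero, Real.sin_zero] at a1
    rw [hcosβ] at b1
    have h1 : (T.symm (n j)) 1 = 0 := by linarith
    have h2 : (T.symm (n (j + 1))) 2 = 0 :=
      (mul_eq_zero.1 (by linarith : Real.sin β * _ = 0)).resolve_left hsinβ
    rw [h1, h2]; ring
  · rw [Real.cos_zero, Real.sin_zero] at b1
    rw [hcosβ] at a1
    have h1 : (T.symm (n (j + 1))) 1 = 0 := by linarith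
    have h2 : (T.symm (n j)) 2 = 0 :=
      (mul_eq_zero.1 (by linarith : Real.sin β * _ = 0)).resolve_left hsinβ
    rw [h1, h2]; ring
  · exact absurd rfl hne

end MarkedSphericalRectangle

/-- Two unit vectors orthogonal to the same plane are equal up to sign. -/
theorem eq_or_eq_neg_of_orthogonal {u v w w' : UnitSphere} (h1 : u ≠ v) (h2 : u ≠ -v)
    (hwu : sphInner w u = 0) (hwv : sphInner w v = 0) (hwu' : sphInner w' u = 0)
    (hwv' : sphInner w' v = 0) : w = w' ∨ w = -w' := by
  have hne : sphInner u v ≠ -1 := by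
    intro h
    apply h2
    apply eq_of_sphInner_eq_one
    rw [sphInner_comm, sphInner_neg_left, sphInner_comm, h, neg_neg]
  obtain ⟨m, hum, hv⟩ := exists_sphArc hne
  have hsin : Real.sin (sphDist u v) ≠ 0 := by
    intro h0
    have hc : Real.cos (sphDist u v) = sphInner u v := cos_sphDist u v
    have h3 := Real.sin_sq_add_cos_sq (sphDist u v)
    rw [h0, hc] at h3
    have : (sphInner u v - 1) * (sphInner u v + 1) = 0 := by nlinarith
    rcases mul_eq_zero.1 this with h | h
    · exact h1 (eq_of_sphInner_eq_one (by linarith))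
    · exact hne (by linarith)
  obtain ⟨z, huz, hmz, hrep⟩ := exists_frame hum
  have key : ∀ w : UnitSphere, sphInner w u = 0 → sphInner w v = 0 → w = z ∨ w = -z := by
    intro w hwu hwv
    rw [← hv, sphInner_sphArc_right, hwu, mul_zero, zero_add] at hwv
    have hwm := (mul_eq_zero.1 hwv).resolve_left hsin
    have h := hrep w
    have e1 : inner ℝ (u : Space3) (w : Space3) = 0 := by rw [real_inner_comm]; exact hwu
    have e2 : inner ℝ (m : Space3) (w : Space3) = 0 := by rw [real_inner_comm]; exact hwm
    rw [e1, e2, zero_smul, zero_smul, zero_add, zero_add] at h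
    exact eq_or_eq_neg_of_smul h
  exact eq_or_eq_neg_trans (key w hwu hwv)
    ((key w' hwu' hwv').imp Eq.symm fun h => by rw [h, neg_neg])

theorem sphInner_self (u : UnitSphere) : sphInner u u = 1 := u.inner_self

theorem continuous_sphInner_right (n : UnitSphere) : Continuous (sphInner n) :=
  continuous_sphInner.comp (continuous_const.prodMk continuous_id)

theorem eVariationOn_path {X : Type*} [PseudoEMetricSpace X] {x y : X} (c : Path x y) :
    eVariationOn c univ = eVariationOn c.extend (Icc 0 1) := by
  have h := eVariationOn.comp_eq_of_monotoneOn c.extend (t := univ)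
    (Subtype.val : unitInterval → ℝ) (fun a _ b _ hab => hab)
  rw [image_univ, Subtype.range_coe] at h
  rw [← h]
  congr 1
  funext t
  simp

/-! ### The angle and the three circles of the net -/

theorem fin4_add_two_add_one : ∀ j : Fin 4, j + 2 + 1 = j + 3 := by decide

theorem fin4_add_one_add_two : ∀ j : Fin 4, j + 1 + 2 = j + 3 := by decide

theorem fin4_add_one_add_three : ∀ j : Fin 4, j + 1 + 3 = j := by decide

theorem fin4_exhaust : ∀ k i : Fin 4, i = k ∨ i = k + 2 ∨ i = k + 1 ∨ i = k + 3 := by decide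

/-- The labels of the circles of the sides, when the sides `k` and `k + 2` lie on one circle. -/
def circleLabel (k i : Fin 4) : Fin 3 := if i = k ∨ i = k + 2 then 0 else if i = k + 1 then 1 else 2

theorem circleLabel_eq : ∀ k : Fin 4, circleLabel k k = 0 ∧ circleLabel k (k + 2) = 0 ∧
    circleLabel k (k + 1) = 1 ∧ circleLabel k (k + 3) = 2 := by decide

namespace MarkedSphericalRectangle

variable {Q : Type*} [MetricSpace Q] (R : MarkedSphericalRectangle Q) {f : Q → UnitSphere}

theorem exists_capChart (hf : R.IsDevelopingMap f) {x : Q} (hx : x ∉ range R.corner) :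
    ∃ r H, IsCapChart f x r H := by
  by_cases hb : x ∈ R.boundary
  · obtain ⟨n, -, r, h, -⟩ := R.exists_isInnerNormal hf hb hx
    exact ⟨r, _, h⟩
  · obtain ⟨r, h⟩ := R.exists_capChart_of_interior hf hb
    exact ⟨r, _, h⟩

/-- What the angle of a rectangle says about the images of two opposite corners. -/
theorem HasAngle.exists_path (hf : R.IsDevelopingMap f) {θ : ℝ} (hθ : θ ∈ Ioo (0 : ℝ) 1)
    (h : R.HasAngle f θ) : ∃ (j : Fin 4) (c : Path (R.corner j) (R.corner (j + 2)))
      (m : UnitSphere) (x : Q), R.IsNetCircle f {v | sphInner m v = 0} ∧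
      sphInner (f (R.corner j)) (f (R.corner (j + 2))) = Real.cos (Real.pi * (1 - θ)) ∧
      (∀ t, sphInner m (f (c t)) = 0) ∧
      x ∈ f ⁻¹' {v | sphInner m v = 0} \ R.boundary ∧
      c '' Ioo 0 1 = connectedComponentIn (f ⁻¹' {v | sphInner m v = 0} \ R.boundary) x := by
  obtain ⟨γ, j, c, ⟨⟨C, hC, x, hx, hγ⟩, -⟩, hinj, himg, hlen⟩ := h
  obtain ⟨m, rfl⟩ := hC.1
  have hpi := Real.pi_pos
  have hin : ∀ t ∈ Ioo (0 : ℝ) 1, c.extend t ∈ f ⁻¹' {v | sphInner m v = 0} \ R.boundary := by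
    intro t ht
    have h1 : c ⟨t, Ioo_subset_Icc_self ht⟩ ∈ γ := by
      rw [← himg]
      exact ⟨_, ht, rfl⟩
    rw [c.extend_apply (Ioo_subset_Icc_self ht)]
    rw [hγ] at h1
    exact connectedComponentIn_subset _ _ h1
  have hcl : ∀ t, sphInner m (f (c t)) = 0 := by
    have hcont : Continuous fun t : ℝ => sphInner m (f (c.extend t)) :=
      (continuous_sphInner_right m).comp (hf.1.comp c.continuous_extend)
    have hsub : closure (Ioo (0 : ℝ) 1) ⊆ {t | sphInner m (f (c.extend t)) = 0} :=
      closure_minimal (fun t ht => (hin t ht).1) (isClosed_eq hcont continuous_const)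
    rw [closure_Ioo zero_ne_one] at hsub
    intro t
    have := hsub t.2
    simpa using this
  have hg : ∀ t, sphInner m (f (c.extend t)) = 0 := by
    intro t
    obtain ⟨s, hs⟩ : c.extend t ∈ range c := by rw [← c.extend_range]; exact ⟨t, rfl⟩
    rw [← hs]
    exact hcl s
  have hchart : ∀ t ∈ Ioo (0 : ℝ) 1, ∃ U ∈ 𝓝 t, U ⊆ Ioo 0 1 ∧ InjOn f (c.extend '' U) ∧
      ∀ s ∈ U, ∀ s' ∈ U, dist (c.extend s) (c.extend s') =
        sphDist (f (c.extend s)) (f (c.extend s')) := by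
    intro t ht
    obtain ⟨r, hr⟩ := R.exists_capChart_of_interior hf (hin t ht).2
    have hU := c.continuous_extend.continuousAt.preimage_mem_nhds
      (Metric.ball_mem_nhds (c.extend t) hr.pos)
    refine ⟨_, Filter.inter_mem hU (isOpen_Ioo.mem_nhds ht), inter_subset_right, ?_, ?_⟩
    · apply hr.injOn.mono
      rintro _ ⟨s, hs, rfl⟩
      exact hs.1
    · intro s hs s' hs'
      exact hr.isom _ hs.1 _ hs'.1
  -- The open arc is interior, so `f` is a local isometry along it; as its length is below `π`, that
  -- length is the distance of the images of its ends.
  have hdist := sphDist_eq_of_eVariationOn (c := c.extend) (g := fun t => f (c.extend t)) (m := m)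
    c.continuous_extend (hf.1.comp c.continuous_extend) hg
    (fun t ht => by
      obtain ⟨U, hU, hU1, hU2, -⟩ := hchart t ht
      refine ⟨U, hU, fun s hs s' hs' heq => ?_⟩
      have h1 := hU2 ⟨s, hs, rfl⟩ ⟨s', hs', rfl⟩ heq
      rw [c.extend_apply (Ioo_subset_Icc_self (hU1 hs)),
        c.extend_apply (Ioo_subset_Icc_self (hU1 hs'))] at h1
      exact congrArg Subtype.val (hinj h1))
    (fun t ht => by
      obtain ⟨U, hU, -, -, hU3⟩ := hchart t ht
      exact ⟨U, hU, hU3⟩)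
    (ℓ := Real.pi * (1 - θ)) (mul_nonneg hpi.le (by linarith [hθ.2]))
    (by nlinarith [hθ.1]) (by rw [← eVariationOn_path, hlen])
  simp only [c.extend_zero, c.extend_one] at hdist
  exact ⟨j, c, m, x, hC, by rw [← hdist, cos_sphDist], hcl, hx, by rw [himg, hγ]⟩

/-- The data of three great circles in general position, with normals `n i`, such that the side
`j` is mapped to the circle `c j`. -/
structure IsNetFrame (f : Q → UnitSphere) (n : Fin 3 → UnitSphere) (c : Fin 4 → Fin 3) :
    Prop where
  dev : R.IsDevelopingMap f
  span : Spanning (range fun i => (n i : Space3))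
  surj : Function.Surjective c
  zero : ∀ j, ∀ x ∈ R.side j, sphInner (n (c j)) (f x) = 0
  normal : ∀ j, ∀ x ∈ R.side j, R.IsInnerNormal f x (n (c j)) ∨ R.IsInnerNormal f x (-(n (c j)))

/-- A side is relatively open in the boundary, so its image contains an arc, which determines the
great circle. -/
theorem eq_or_eq_neg_of_side_zero {j : Fin 4} {n m : UnitSphere}
    (hn : ∀ x ∈ R.side j, R.IsInnerNormal f x n ∨ R.IsInnerNormal f x (-n))
    (hm : ∀ x ∈ R.side j, sphInner m (f x) = 0) : m = n ∨ m = -n := by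
  obtain ⟨x, hx⟩ := R.side_nonempty j
  have hU := (R.isOpen_setOf_ccw (R.chart (R.corner j)) (R.chart (R.corner (j + 1)))).mem_nhds hx.2
  rcases hn x hx with h | h
  · exact h.eq_or_eq_neg R hU fun y hy => hm y ⟨hy.2, hy.1⟩
  · have := h.eq_or_eq_neg R hU fun y hy => hm y ⟨hy.2, hy.1⟩
    rw [neg_neg] at this
    exact this.symm

theorem corner_zero (hf : Continuous f) {j : Fin 4} {n : UnitSphere}
    (hn : ∀ x ∈ R.side j, sphInner n (f x) = 0) :
    sphInner n (f (R.corner j)) = 0 ∧ sphInner n (f (R.corner (j + 1))) = 0 := by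
  have hsub : closure (R.side j) ⊆ {x | sphInner n (f x) = 0} :=
    closure_minimal hn (isClosed_eq ((continuous_sphInner_right n).comp hf) continuous_const)
  exact ⟨hsub (R.corner_mem_closure_side j), hsub (R.corner_succ_mem_closure_side j)⟩

/-- A rectangle with an angle has a frame. -/
theorem HasAngle.exists_isNetFrame (hf : R.IsDevelopingMap f) {θ : ℝ} (hθ : θ ∈ Ioo (0 : ℝ) 1)
    (h : R.HasAngle f θ) : ∃ n c, R.IsNetFrame f n c := by
  obtain ⟨j, -, -, -, -, hcos, -⟩ := h.exists_path R hf hθ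
  choose N hN using R.exists_side_normal hf
  have hN0 : ∀ j, ∀ x ∈ R.side j, sphInner (N j) (f x) = 0 := fun j x hx => (hN j x hx).1
  have hperp := R.sphInner_side_normal_eq_zero hf hN0
  have hpi := Real.pi_pos
  have hne : f (R.corner j) ≠ f (R.corner (j + 2)) ∧ f (R.corner j) ≠ -f (R.corner (j + 2)) := by
    constructor
    · intro heq
      rw [heq, sphInner_self] at hcos
      replace hcos := Real.cos_zero.trans hcos
      have := Real.injOn_cos ⟨le_rfl, hpi.le⟩ ⟨by nlinarith [hθ.2], by nlinarith [hθ.1]⟩ hcos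
      nlinarith [hθ.2]
    · intro heq
      rw [heq, sphInner_neg_left, sphInner_self, ← Real.cos_pi] at hcos
      have := Real.injOn_cos ⟨hpi.le, le_rfl⟩ ⟨by nlinarith [hθ.2], by nlinarith [hθ.1]⟩ hcos
      nlinarith [hθ.1]
  have hz := fun k => R.corner_zero hf.1 (hN0 k)
  -- `N (k + 1)` and `N (k + 3)` are both orthogonal to `N k` and `N (k + 2)`; if the latter are
  -- independent, the former are parallel.
  have hpar : ∀ k, (N k = N (k + 2) ∨ N k = -N (k + 2)) ∨
      (N (k + 1) = N (k + 3) ∨ N (k + 1) = -N (k + 3)) := by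
    intro k
    by_contra! hcon
    obtain ⟨⟨h1, h2⟩, h3, h4⟩ := hcon
    have e1 := hperp k
    have e2 := hperp (k + 1)
    have e3 := hperp (k + 2)
    have e4 := hperp (k + 3)
    rw [fin4_add_one_add_one] at e2
    rw [fin4_add_two_add_one] at e3
    rw [fin4_add_three] at e4
    rcases eq_or_eq_neg_of_orthogonal h1 h2 (by rw [sphInner_comm]; exact e1) e2
      e4 (by rw [sphInner_comm]; exact e3) with h | h
    · exact h3 h
    · exact h4 h
  have hneg : ∀ {a b v : UnitSphere}, (a = b ∨ a = -b) → sphInner b v = 0 → sphInner a v = 0 := by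
    rintro a b v (rfl | rfl) h
    · exact h
    · rw [sphInner_neg_left, h, neg_zero]
  -- Otherwise there are only two circles, and the corners `j` and `j + 2` are mapped to their
  -- intersection, that is, to equal or antipodal points.
  have hnot : ¬ ((N j = N (j + 2) ∨ N j = -N (j + 2)) ∧
      (N (j + 1) = N (j + 3) ∨ N (j + 1) = -N (j + 3))) := by
    rintro ⟨h1, h2⟩
    have a1 := (hz j).1
    have a2 := (hz (j + 3)).2
    rw [fin4_add_three] at a2
    have a3 := (hz (j + 2)).1
    have a4 := (hz (j + 1)).2
    rw [fin4_add_one_add_one] at a4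
    have hp := hperp j
    have n1 : N j ≠ N (j + 1) := by
      intro heq; rw [heq, sphInner_self] at hp; norm_num at hp
    have n2 : N j ≠ -N (j + 1) := by
      intro heq; rw [heq, sphInner_neg_left, sphInner_self] at hp; norm_num at hp
    rcases eq_or_eq_neg_of_orthogonal n1 n2 (by rw [sphInner_comm]; exact a1)
      (by rw [sphInner_comm]; exact hneg h2 a2) (by rw [sphInner_comm]; exact hneg h1 a3)
      (by rw [sphInner_comm]; exact a4) with h | h
    · exact hne.1 h
    · exact hne.2 h
  obtain ⟨k, hk1, hk2⟩ : ∃ k, (N k = N (k + 2) ∨ N k = -N (k + 2)) ∧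
      ¬ (N (k + 1) = N (k + 3) ∨ N (k + 1) = -N (k + 3)) := by
    rcases hpar j with h1 | h1
    · exact ⟨j, h1, fun h2 => hnot ⟨h1, h2⟩⟩
    · refine ⟨j + 1, ?_, fun h2 => hnot ⟨?_, h1⟩⟩
      · rwa [fin4_add_one_add_two]
      · rw [fin4_add_one_add_one, fin4_add_one_add_three] at h2
        exact h2.imp Eq.symm fun h => by rw [h, neg_neg]
  let n : Fin 3 → UnitSphere := ![N k, N (k + 1), N (k + 3)]
  have hlab := circleLabel_eq k
  let c : Fin 4 → Fin 3 := circleLabel k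
  have hcN : ∀ i, n (c i) = N i ∨ n (c i) = -N i := by
    intro i
    rcases fin4_exhaust k i with rfl | rfl | rfl | rfl
    · left; simp only [c, hlab.1]; rfl
    · simp only [c, hlab.2.1]; exact hk1
    · left; simp only [c, hlab.2.2.1]; rfl
    · left; simp only [c, hlab.2.2.2]; rfl
  refine ⟨n, c, hf, ?_, ?_, ?_, ?_⟩
  -- A unit vector orthogonal to `N (k + 1)` and `N (k + 3)` is `± N k`, hence not orthogonal to `N
  -- k`.
  · intro x hx
    by_contra hx0
    have hx' : ∀ i, sphInner (n i) (sphNormalize x) = 0 := by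
      intro i
      rw [sphInner_sphNormalize _ hx0, real_inner_comm, hx _ ⟨i, rfl⟩, mul_zero]
    have b0 : sphInner (N k) (sphNormalize x) = 0 := hx' 0
    have b1 : sphInner (N (k + 1)) (sphNormalize x) = 0 := hx' 1
    have b2 : sphInner (N (k + 3)) (sphNormalize x) = 0 := hx' 2
    push Not at hk2
    have e4 := hperp (k + 3)
    rw [fin4_add_three] at e4
    rcases eq_or_eq_neg_of_orthogonal hk2.1 hk2.2 (by rw [sphInner_comm]; exact b1)
      (by rw [sphInner_comm]; exact b2) (hperp k) (by rw [sphInner_comm]; exact e4) with h | h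
    · rw [h, sphInner_self] at b0; norm_num at b0
    · rw [h, sphInner_comm, sphInner_neg_left, sphInner_self] at b0; norm_num at b0
  · intro i
    fin_cases i
    · exact ⟨k, hlab.1⟩
    · exact ⟨k + 1, hlab.2.2.1⟩
    · exact ⟨k + 3, hlab.2.2.2⟩
  · intro i x hx
    exact hneg (hcN i) (hN0 i x hx)
  · intro i x hx
    rcases hcN i with h | h
    · rw [h]; exact (hN i x hx).2
    · rw [h, neg_neg]; exact (hN i x hx).2.symm

namespace IsNetFrame

variable {R} {n : Fin 3 → UnitSphere} {c : Fin 4 → Fin 3} (h : R.IsNetFrame f n c)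
include h

theorem perp (j : Fin 4) : sphInner (n (c j)) (n (c (j + 1))) = 0 :=
  R.sphInner_side_normal_eq_zero h.dev (n := fun j => n (c j)) h.zero j

theorem adj (j : Fin 4) : c j ≠ c (j + 1) := by
  intro heq
  have := h.perp j
  rw [heq, sphInner_self] at this
  norm_num at this

theorem corner_left (j : Fin 4) : sphInner (n (c j)) (f (R.corner j)) = 0 :=
  (R.corner_zero h.dev.1 (h.zero j)).1

theorem corner_right (j : Fin 4) : sphInner (n (c j)) (f (R.corner (j + 1))) = 0 :=
  (R.corner_zero h.dev.1 (h.zero j)).2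

theorem eq_or_eq_neg_of_isNetCircle {m : UnitSphere}
    (hm : R.IsNetCircle f {v | sphInner m v = 0}) : ∃ i, m = n i ∨ m = -n i := by
  obtain ⟨-, j, hj⟩ := hm
  exact ⟨c j, R.eq_or_eq_neg_of_side_zero (h.normal j) fun x hx => hj ⟨x, hx, rfl⟩⟩

theorem net_eq : R.net f = {x | ∃ i, sphInner (n i) (f x) = 0} := by
  ext x
  constructor
  · rintro ⟨C, hC, hx⟩
    obtain ⟨m, rfl⟩ := hC.1
    obtain ⟨i, hi⟩ := h.eq_or_eq_neg_of_isNetCircle hC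
    refine ⟨i, ?_⟩
    have hx' : sphInner m (f x) = 0 := hx
    rcases hi with rfl | rfl
    · exact hx'
    · rw [sphInner_neg_left, neg_eq_zero] at hx'
      exact hx'
  · rintro ⟨i, hi⟩
    obtain ⟨j, rfl⟩ := h.surj i
    refine ⟨{v | sphInner (n (c j)) v = 0}, ⟨⟨_, rfl⟩, j, ?_⟩, hi⟩
    rintro _ ⟨y, hy, rfl⟩
    exact h.zero j y hy

end IsNetFrame

end MarkedSphericalRectangle

/-! ### The cells cut out by three great circles -/

/-- The signs of a point with respect to three great circles. -/
def pat (n : Fin 3 → UnitSphere) (v : UnitSphere) (i : Fin 3) : SignType :=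
  SignType.sign (sphInner (n i) v)

/-- The convex cone of vectors with given signs. -/
def patCone (n : Fin 3 → UnitSphere) (s : Fin 3 → SignType) : Set Space3 :=
  {w | ∀ i, SignType.sign (inner ℝ (n i : Space3) w) = s i}

theorem pat_eq_zero_iff {n : Fin 3 → UnitSphere} {v : UnitSphere} {i : Fin 3} :
    pat n v i = 0 ↔ sphInner (n i) v = 0 := sign_eq_zero_iff

theorem coe_mem_patCone {n : Fin 3 → UnitSphere} {s : Fin 3 → SignType} {v : UnitSphere} :
    (v : Space3) ∈ patCone n s ↔ pat n v = s := funext_iff.symm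

theorem convex_setOf_sign_inner_eq (u : Space3) (σ : SignType) :
    Convex ℝ {w : Space3 | SignType.sign (inner ℝ u w) = σ} := by
  have hlin : IsLinearMap ℝ fun w : Space3 => inner ℝ u w :=
    ⟨fun x y => inner_add_right _ _ _, fun a x => by simp [real_inner_smul_right]⟩
  rcases σ.trichotomy with rfl | rfl | rfl
  · simp_rw [sign_eq_neg_one_iff]
    exact convex_halfSpace_lt hlin 0
  · simp_rw [sign_eq_zero_iff]
    exact convex_hyperplane hlin 0
  · simp_rw [sign_eq_one_iff]
    exact convex_halfSpace_gt hlin 0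

theorem convex_patCone (n : Fin 3 → UnitSphere) (s : Fin 3 → SignType) : Convex ℝ (patCone n s) := by
  have : patCone n s = ⋂ i, {w | SignType.sign (inner ℝ (n i : Space3) w) = s i} := by
    ext w; simp [patCone]
  rw [this]
  exact convex_iInter fun i => convex_setOf_sign_inner_eq _ _

theorem smul_mem_patCone {n : Fin 3 → UnitSphere} {s : Fin 3 → SignType} {w : Space3}
    (hw : w ∈ patCone n s) {t : ℝ} (ht : 0 < t) : t • w ∈ patCone n s := by
  intro i
  rw [real_inner_smul_right, sign_mul, sign_pos ht, one_mul]
  exact hw i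

theorem zero_notMem_patCone {n : Fin 3 → UnitSphere} {s : Fin 3 → SignType} (hs : s ≠ 0) :
    (0 : Space3) ∉ patCone n s := by
  intro h
  apply hs
  funext i
  have := h i
  simpa using this.symm

theorem pat_sphNormalize {n : Fin 3 → UnitSphere} {s : Fin 3 → SignType} {w : Space3}
    (hw : w ∈ patCone n s) (h0 : w ≠ 0) : pat n (sphNormalize w) = s := by
  funext i
  rw [pat, sphInner_sphNormalize _ h0, sign_mul, sign_pos (inv_pos.2 (norm_pos_iff.2 h0)), one_mul]
  exact hw i

theorem isOpen_patCone {n : Fin 3 → UnitSphere} {s : Fin 3 → SignType} (hs : ∀ i, s i ≠ 0) :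
    IsOpen (patCone n s) := by
  have : patCone n s = ⋂ i, {w | SignType.sign (inner ℝ (n i : Space3) w) = s i} := by
    ext w; simp [patCone]
  rw [this]
  refine isOpen_iInter_of_finite fun i => ?_
  rcases (s i).trichotomy with h | h | h
  · simp_rw [h, sign_eq_neg_one_iff]
    exact isOpen_lt (by fun_prop) continuous_const
  · exact absurd h (hs i)
  · simp_rw [h, sign_eq_one_iff]
    exact isOpen_lt continuous_const (by fun_prop)

theorem isPreconnected_setOf_pat_eq (n : Fin 3 → UnitSphere) {s : Fin 3 → SignType} (hs : s ≠ 0) :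
    IsPreconnected {v | pat n v = s} := by
  have := isPreconnected_sphere_of_convex (convex_patCone n s) (zero_notMem_patCone hs)
    fun w hw t ht => smul_mem_patCone hw ht
  simp_rw [coe_mem_patCone] at this
  exact this

/-- Near `u` there are points of every cell whose signs are compatible with those of `u`, in a
prescribed direction. -/
theorem tendsto_cell {n : Fin 3 → UnitSphere} {u : UnitSphere} {s : Fin 3 → SignType}
    (hs : ∀ i, pat n u i ≠ 0 → s i = pat n u i) {w : Space3}
    (hw : ∀ i, inner ℝ (n i : Space3) w = (s i : ℝ)) :
    Filter.Tendsto (fun t : ℝ => sphNormalize ((u : Space3) + t • w)) (𝓝[>] 0) (𝓝 u) ∧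
      (∀ᶠ t in 𝓝[>] (0 : ℝ), (u : Space3) + t • w ≠ 0) ∧
      ∀ᶠ t in 𝓝[>] (0 : ℝ), pat n (sphNormalize ((u : Space3) + t • w)) = s := by
  have hc : Continuous fun t : ℝ => (u : Space3) + t • w := by fun_prop
  have ht0 : Filter.Tendsto (fun t : ℝ => (u : Space3) + t • w) (𝓝[>] 0) (𝓝 (u : Space3)) := by
    have := hc.tendsto 0
    simp only [zero_smul, add_zero] at this
    exact this.mono_left nhdsWithin_le_nhds
  have hne : ∀ᶠ t in 𝓝[>] (0 : ℝ), (u : Space3) + t • w ≠ 0 :=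
    ht0.eventually (isOpen_ne.mem_nhds u.ne_zero)
  refine ⟨?_, hne, ?_⟩
  · have h1 : ContinuousAt sphNormalize (u : Space3) :=
      continuousOn_sphNormalize.continuousAt (isOpen_compl_singleton.mem_nhds u.ne_zero)
    have := h1.tendsto.comp ht0
    rwa [sphNormalize_coe] at this
  · have hev : ∀ i, ∀ᶠ t in 𝓝[>] (0 : ℝ),
        SignType.sign (inner ℝ (n i : Space3) ((u : Space3) + t • w)) = s i := by
      intro i
      have hin : ∀ t : ℝ, inner ℝ (n i : Space3) ((u : Space3) + t • w) =
          sphInner (n i) u + t * (s i : ℝ) := by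
        intro t
        rw [inner_add_right, real_inner_smul_right, hw]; rfl
      simp_rw [hin]
      have hlim : Filter.Tendsto (fun t : ℝ => sphInner (n i) u + t * (s i : ℝ)) (𝓝[>] 0)
          (𝓝 (sphInner (n i) u)) := by
        have : Continuous fun t : ℝ => sphInner (n i) u + t * (s i : ℝ) := by fun_prop
        have := this.tendsto 0
        simp only [zero_mul, add_zero] at this
        exact this.mono_left nhdsWithin_le_nhds
      rcases lt_trichotomy (sphInner (n i) u) 0 with h | h | h
      · have hp : pat n u i = -1 := sign_neg h
        filter_upwards [hlim.eventually (gt_mem_nhds h)] with t ht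
        rw [sign_neg ht, hs i (by rw [hp]; decide), hp]
      · filter_upwards [self_mem_nhdsWithin] with t ht
        have ht' : (0 : ℝ) < t := ht
        rw [h, zero_add, sign_mul, sign_pos ht', one_mul]
        rcases (s i).trichotomy with h' | h' | h' <;> rw [h'] <;> simp
      · have hp : pat n u i = 1 := sign_pos h
        filter_upwards [hlim.eventually (lt_mem_nhds h)] with t ht
        rw [sign_pos ht, hs i (by rw [hp]; decide), hp]
    filter_upwards [hne, Filter.eventually_all.2 hev] with t h0 ht
    exact pat_sphNormalize ht h0

section Spanning

variable {n : Fin 3 → UnitSphere} (hn : Spanning (range fun i => (n i : Space3)))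
include hn

/-- Three independent linear forms take arbitrary values; this produces points and directions with
any prescribed signs. -/
theorem Spanning.exists_inner_eq (a : Fin 3 → ℝ) : ∃ w : Space3, ∀ i, inner ℝ (n i : Space3) w = a i := by
  let L : Space3 →ₗ[ℝ] (Fin 3 → ℝ) := LinearMap.pi fun i => innerₛₗ ℝ (n i : Space3)
  have hinj : Function.Injective L := by
    rw [← LinearMap.ker_eq_bot, LinearMap.ker_eq_bot']
    intro w hw
    apply hn
    rintro _ ⟨i, rfl⟩
    rw [real_inner_comm]
    exact congrFun hw i
  have hsurj := (LinearMap.injective_iff_surjective_of_finrank_eq_finrank (by simp)).1 hinj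
  obtain ⟨w, hw⟩ := hsurj a
  exact ⟨w, fun i => congrFun hw i⟩

theorem Spanning.pat_ne_zero (v : UnitSphere) : pat n v ≠ 0 := by
  intro h
  apply v.ne_zero
  apply hn
  rintro _ ⟨i, rfl⟩
  have := congrFun h i
  rw [Pi.zero_apply, pat_eq_zero_iff] at this
  rw [real_inner_comm]
  exact this

/-- A vertex is determined by its signs. -/
theorem Spanning.eq_of_pat_eq {v w : UnitSphere} (hvw : pat n v = pat n w) {i j : Fin 3}
    (hij : i ≠ j) (hi : pat n v i = 0) (hj : pat n v j = 0) : v = w := by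
  obtain ⟨k, hk⟩ : ∃ k, ∀ l, l = i ∨ l = j ∨ l = k := by
    revert hij; clear hi hj; revert i j; decide
  have hk0 : pat n v k ≠ 0 := by
    intro h
    apply hn.pat_ne_zero v
    funext l
    rcases hk l with rfl | rfl | rfl <;> assumption
  have hwi : sphInner (n i) w = 0 := pat_eq_zero_iff.1 (by rw [← hvw]; exact hi)
  have hwj : sphInner (n j) w = 0 := pat_eq_zero_iff.1 (by rw [← hvw]; exact hj)
  have hvi : sphInner (n i) v = 0 := pat_eq_zero_iff.1 hi
  have hvj : sphInner (n j) v = 0 := pat_eq_zero_iff.1 hj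
  set a := sphInner (n k) v with ha
  set b := sphInner (n k) w with hb
  have hab : SignType.sign a = SignType.sign b := congrFun hvw k
  have ha0 : a ≠ 0 := fun h => hk0 (sign_eq_zero_iff.2 h)
  -- The combination is chosen to be orthogonal to the third normal too, so `v` and `w` are
  -- proportional; the signs then exclude antipodes.
  have h1 : b • (v : Space3) - a • (w : Space3) = 0 := by
    apply hn
    rintro _ ⟨l, rfl⟩
    rw [real_inner_comm, inner_sub_right, real_inner_smul_right, real_inner_smul_right]
    change b * sphInner (n l) v - a * sphInner (n l) w = 0
    rcases hk l with rfl | rfl | rfl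
    · rw [hvi, hwi]; ring
    · rw [hvj, hwj]; ring
    · rw [← ha, ← hb]; ring
  have hbv : (w : Space3) = (b / a) • (v : Space3) := by
    rw [sub_eq_zero] at h1
    rw [div_eq_inv_mul, ← smul_smul, h1, smul_smul, inv_mul_cancel₀ ha0, one_smul]
  rcases eq_or_eq_neg_of_smul hbv with h | h
  · exact h.symm
  · exfalso
    have : b = -a := by
      rw [ha, hb, h, sphInner_comm, sphInner_neg_left, sphInner_comm]
    rw [this] at hab
    rcases lt_or_gt_of_ne ha0 with h' | h'
    · rw [sign_neg h', sign_pos (neg_pos.2 h')] at hab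
      exact absurd hab (by decide)
    · rw [sign_pos h', sign_neg (neg_lt_zero.2 h')] at hab
      exact absurd hab (by decide)

theorem Spanning.mem_closure_cell {u : UnitSphere} {s : Fin 3 → SignType}
    (hs : ∀ i, pat n u i ≠ 0 → s i = pat n u i) : u ∈ closure {v | pat n v = s} := by
  obtain ⟨w, hw⟩ := hn.exists_inner_eq fun i => (s i : ℝ)
  obtain ⟨h1, -, h3⟩ := tendsto_cell hs hw
  exact mem_closure_of_tendsto h1 h3

theorem Spanning.cell_nonempty {s : Fin 3 → SignType} (hs : s ≠ 0) : ∃ v, pat n v = s := by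
  obtain ⟨w, hw⟩ := hn.exists_inner_eq fun i => (s i : ℝ)
  have hmem : w ∈ patCone n s := by
    intro i
    rw [hw]
    rcases (s i).trichotomy with h' | h' | h' <;> rw [h'] <;> simp
  refine ⟨sphNormalize w, pat_sphNormalize hmem fun h0 => zero_notMem_patCone hs (h0 ▸ hmem)⟩

end Spanning

theorem isClosed_setOf_pat (n : Fin 3 → UnitSphere) (i : Fin 3) (σ : SignType) :
    IsClosed {v | pat n v i = 0 ∨ pat n v i = σ} := by
  have hc := continuous_sphInner_right (n i)
  have hz : IsClosed {v | pat n v i = 0} := by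
    simp_rw [pat_eq_zero_iff]
    exact isClosed_eq hc continuous_const
  rcases σ.trichotomy with rfl | rfl | rfl
  · have : {v | pat n v i = 0 ∨ pat n v i = -1} = {v | sphInner (n i) v ≤ 0} := by
      ext v
      change SignType.sign (sphInner (n i) v) = 0 ∨ SignType.sign (sphInner (n i) v) = -1 ↔
        sphInner (n i) v ≤ 0
      rw [sign_eq_zero_iff, sign_eq_neg_one_iff, le_iff_eq_or_lt]
    rw [this]
    exact isClosed_le hc continuous_const
  · simpa using hz
  · have : {v | pat n v i = 0 ∨ pat n v i = 1} = {v | 0 ≤ sphInner (n i) v} := by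
      ext v
      change SignType.sign (sphInner (n i) v) = 0 ∨ SignType.sign (sphInner (n i) v) = 1 ↔
        0 ≤ sphInner (n i) v
      rw [sign_eq_zero_iff, sign_eq_one_iff, le_iff_eq_or_lt, eq_comm]
    rw [this]
    exact isClosed_le continuous_const hc

/-- The closure of an open cell. -/
def closedCell (n : Fin 3 → UnitSphere) (s : Fin 3 → SignType) : Set UnitSphere :=
  {v | ∀ i, pat n v i = 0 ∨ pat n v i = s i}

theorem isClosed_closedCell (n : Fin 3 → UnitSphere) (s : Fin 3 → SignType) :
    IsClosed (closedCell n s) := by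
  have : closedCell n s = ⋂ i, {v | pat n v i = 0 ∨ pat n v i = s i} := by
    ext v; simp [closedCell]
  rw [this]
  exact isClosed_iInter fun i => isClosed_setOf_pat n i (s i)

theorem Spanning.closure_cell {n : Fin 3 → UnitSphere}
    (hn : Spanning (range fun i => (n i : Space3))) (s : Fin 3 → SignType) :
    closure {v | pat n v = s} = closedCell n s := by
  apply subset_antisymm
  · exact closure_minimal (fun v hv i => .inr (congrFun hv i)) (isClosed_closedCell n s)
  · intro v hv
    exact hn.mem_closure_cell fun i hi => ((hv i).resolve_left hi).symm

/-- Two lifts through a map which is injective near the values of one of them coincide if they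
coincide at a point. -/
theorem eqOn_of_lift {A X Y : Type*} [TopologicalSpace A] [TopologicalSpace X] [T2Space X]
    {S : Set A} (hS : IsPreconnected S) {p : X → Y} {g₁ g₂ : A → X} (h₁ : ContinuousOn g₁ S)
    (h₂ : ContinuousOn g₂ S) (hp : ∀ a ∈ S, p (g₁ a) = p (g₂ a))
    (hinj : ∀ a ∈ S, ∃ U ∈ 𝓝 (g₁ a), InjOn p U) {a₀ : A} (ha₀ : a₀ ∈ S) (h0 : g₁ a₀ = g₂ a₀) :
    EqOn g₁ g₂ S := by
  intro a ha
  refine (hS.induction₂ (fun a b => g₁ a = g₂ a ↔ g₁ b = g₂ b) ?_ (fun _ _ _ _ _ _ => Iff.trans)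
    (fun _ _ _ _ => Iff.symm) ha₀ ha).1 h0
  intro x hx
  by_cases hxe : g₁ x = g₂ x
  · obtain ⟨U, hU, hUi⟩ := hinj x hx
    filter_upwards [(h₁ x hx).preimage_mem_nhdsWithin hU,
      (h₂ x hx).preimage_mem_nhdsWithin (hxe ▸ hU), self_mem_nhdsWithin] with y hy1 hy2 hyS
    exact iff_of_true hxe (hUi hy1 hy2 (hp y hyS))
  · obtain ⟨U, V, hU, hV, hxU, hxV, hUV⟩ := t2_separation hxe
    filter_upwards [(h₁ x hx).preimage_mem_nhdsWithin (hU.mem_nhds hxU),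
      (h₂ x hx).preimage_mem_nhdsWithin (hV.mem_nhds hxV)] with y hy1 hy2
    refine iff_of_false hxe fun h => ?_
    exact Set.disjoint_left.1 hUV hy1 (by rw [h]; exact hy2)

/-! ### Faces of the net -/

theorem Continuous.sphDist {X : Type*} [TopologicalSpace X] {f g : X → UnitSphere}
    (hf : Continuous f) (hg : Continuous g) : Continuous fun x => sphDist (f x) (g x) := by
  simp_rw [sphDist_eq_arccos]
  exact Real.continuous_arccos.comp ((continuous_subtype_val.comp hf).inner
    (continuous_subtype_val.comp hg))

theorem continuousOn_of_dist_le_sphDist {Q : Type*} [PseudoMetricSpace Q] {g : UnitSphere → Q}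
    {S : Set UnitSphere} (h : ∀ u ∈ S, ∀ v ∈ S, dist (g u) (g v) ≤ sphDist u v) :
    ContinuousOn g S := by
  intro u hu
  have hlim : Filter.Tendsto (fun v => sphDist v u) (𝓝[S] u) (𝓝 0) := by
    have : Continuous fun v => sphDist v u :=
      continuous_id.sphDist continuous_const
    have := this.tendsto u
    rw [sphDist_self] at this
    exact this.mono_left nhdsWithin_le_nhds
  refine tendsto_iff_dist_tendsto_zero.2 (squeeze_zero' (.of_forall fun _ => dist_nonneg) ?_ hlim)
  filter_upwards [self_mem_nhdsWithin] with v hv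
  exact h v hv u hu

theorem isOpen_setOf_sphDist_lt (u : UnitSphere) (r : ℝ) : IsOpen {v | sphDist u v < r} :=
  isOpen_lt (continuous_const.sphDist continuous_id) continuous_const

namespace IsCapChart

variable {Q : Type*} [MetricSpace Q] {f : Q → UnitSphere} {x : Q} {r : ℝ} {H : Set UnitSphere}

/-- The inverse of a chart. -/
theorem exists_inverse (h : IsCapChart f x r H) : ∃ g : UnitSphere → Q,
    (∀ v, sphDist (f x) v < r → v ∈ H → g v ∈ Metric.ball x r ∧ f (g v) = v) ∧
    (∀ y ∈ Metric.ball x r, g (f y) = y) ∧ ContinuousOn g {v | sphDist (f x) v < r ∧ v ∈ H} := by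
  have : Nonempty Q := ⟨x⟩
  have hg : ∀ v, sphDist (f x) v < r → v ∈ H →
      Function.invFunOn f (Metric.ball x r) v ∈ Metric.ball x r ∧
        f (Function.invFunOn f (Metric.ball x r) v) = v := fun v hv hH =>
    Function.invFunOn_pos (h.image.superset ⟨hv, hH⟩)
  refine ⟨_, hg, fun y hy => h.injOn.leftInvOn_invFunOn hy,
    continuousOn_of_dist_le_sphDist fun u hu v hv => ?_⟩
  obtain ⟨h1, h2⟩ := hg u hu.1 hu.2
  obtain ⟨h3, h4⟩ := hg v hv.1 hv.2
  rw [h.isom _ h1 _ h3, h2, h4]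

theorem exists_openPartialHomeomorph (hf : Continuous f) (h : IsCapChart f x r univ) :
    ∃ e : OpenPartialHomeomorph Q UnitSphere, x ∈ e.source ∧ f = e := by
  obtain ⟨g, h1, h2, h3⟩ := h.exists_inverse
  have himg := h.image
  simp only [mem_univ, and_true] at himg h3
  exact ⟨{ toFun := f
           invFun := g
           source := Metric.ball x r
           target := {v | sphDist (f x) v < r}
           map_source' := fun y hy => himg.subset ⟨y, hy, rfl⟩
           map_target' := fun v hv => (h1 v hv trivial).1
           left_inv' := fun y hy => h2 y hy
           right_inv' := fun v hv => (h1 v hv trivial).2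
           open_source := Metric.isOpen_ball
           open_target := isOpen_setOf_sphDist_lt _ _
           continuousOn_toFun := hf.continuousOn
           continuousOn_invFun := h3 }, h.mem_self, rfl⟩

end IsCapChart

/-- The geodesic arc between two points of a cell stays in the cell. -/
theorem pat_sphArc {n : Fin 3 → UnitSphere} {u v m : UnitSphere} {hum : sphInner u m = 0}
    {s : Fin 3 → SignType} (hs : s ≠ 0) (hu : pat n u = s) (hv : pat n v = s)
    (hm : sphArc u m hum (sphDist u v) = v) {t : ℝ} (ht : t ∈ Icc 0 (sphDist u v)) :
    pat n (sphArc u m hum t) = s := by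
  rcases eq_or_lt_of_le (sphDist_nonneg u v) with h0 | h0
  · rw [← h0, Icc_self, mem_singleton_iff] at ht
    rw [ht, sphArc_zero, hu]
  -- Antipodal points have opposite signs, so they cannot share a nonzero pattern.
  have hpi : sphDist u v < Real.pi := by
    refine lt_of_le_of_ne (sphDist_le_pi u v) fun hpi => ?_
    have hvu : v = -u := by
      rw [hpi] at hm
      rw [← hm]
      apply Subtype.ext
      simp [sphArc, arcVec]
    apply hs
    funext i
    have h1 := congrFun hu i
    have h2 := congrFun hv i
    rw [hvu, pat, sphInner_comm, sphInner_neg_left, sphInner_comm, Left.sign_neg] at h2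
    rw [pat] at h1
    rw [h1] at h2
    change s i = 0
    revert h2
    cases s i <;> decide
  set d := sphDist u v with hd
  have hsd : 0 < Real.sin d := Real.sin_pos_of_pos_of_lt_pi h0 hpi
  -- A multiple of the point of the arc is a nonnegative combination of the ends, so convexity of
  -- the cone applies.
  have key : Real.sin d • (sphArc u m hum t : Space3) =
      Real.sin (d - t) • (u : Space3) + Real.sin t • (v : Space3) := by
    rw [← hm]
    simp only [sphArc, arcVec, Real.sin_sub]
    module
  have h1 : 0 ≤ Real.sin (d - t) :=
    Real.sin_nonneg_of_nonneg_of_le_pi (by linarith [ht.2]) (by linarith [ht.1])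
  have h2 : 0 ≤ Real.sin t := Real.sin_nonneg_of_nonneg_of_le_pi ht.1 (by linarith [ht.2])
  have hpos : 0 < Real.sin (d - t) + Real.sin t := by
    rcases eq_or_lt_of_le ht.1 with h | h
    · rw [← h]; simpa using hsd
    · linarith [Real.sin_pos_of_pos_of_lt_pi h (by linarith [ht.2])]
  rw [← coe_mem_patCone] at hu hv ⊢
  have hmem : Real.sin d • (sphArc u m hum t : Space3) ∈ patCone n s := by
    have hc := convex_patCone n s hu hv (a := Real.sin (d - t) / (Real.sin (d - t) + Real.sin t))
      (b := Real.sin t / (Real.sin (d - t) + Real.sin t)) (by positivity) (by positivity)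
      (by rw [← add_div, div_self hpos.ne'])
    have := smul_mem_patCone hc hpos
    rw [smul_add, smul_smul, smul_smul, mul_div_cancel₀ _ hpos.ne', mul_div_cancel₀ _ hpos.ne',
      ← key] at this
    exact this
  have := smul_mem_patCone hmem (inv_pos.2 hsd)
  rwa [smul_smul, inv_mul_cancel₀ hsd.ne', one_smul] at this

/-- `g` is inverse to `f` on the closure of the face `K`, which `f` maps onto a closed cell. -/
structure IsFaceChart {Q : Type*} [TopologicalSpace Q] (f : Q → UnitSphere)
    (n : Fin 3 → UnitSphere) (K : Set Q) (s : Fin 3 → SignType) (g : UnitSphere → Q) : Prop where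
  ne : ∀ i, s i ≠ 0
  cont : ContinuousOn g (closedCell n s)
  right : ∀ v ∈ closedCell n s, f (g v) = v
  mem_closure : ∀ v ∈ closedCell n s, g v ∈ closure K
  maps : ∀ x ∈ closure K, f x ∈ closedCell n s
  left : ∀ x ∈ closure K, g (f x) = x
  mem_iff : ∀ x ∈ closure K, x ∈ K ↔ pat n (f x) = s

namespace MarkedSphericalRectangle

variable {Q : Type*} [MetricSpace Q] {R : MarkedSphericalRectangle Q} {f : Q → UnitSphere}

namespace IsNetFrame

variable {n : Fin 3 → UnitSphere} {c : Fin 4 → Fin 3} (h : R.IsNetFrame f n c)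
include h

theorem notMem_net {x : Q} : x ∉ R.net f ↔ ∀ i, pat n (f x) i ≠ 0 := by
  rw [h.net_eq]
  simp [pat_eq_zero_iff]

theorem boundary_subset_net : R.boundary ⊆ R.net f := by
  intro x hx
  rw [h.net_eq]
  by_cases hc : x ∈ range R.corner
  · obtain ⟨j, rfl⟩ := hc
    exact ⟨_, h.corner_left j⟩
  · obtain ⟨j, hj⟩ := R.exists_mem_side hx hc
    exact ⟨_, h.zero j x hj⟩

theorem isLocalHomeomorphOn : IsLocalHomeomorphOn f R.boundaryᶜ := by
  intro x hx
  obtain ⟨r, hr⟩ := R.exists_capChart_of_interior h.dev hx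
  obtain ⟨e, he, hfe⟩ := hr.exists_openPartialHomeomorph h.dev.1
  exact ⟨e, he, hfe⟩

/-- The developing map has a section through a given point over an open cell. -/
theorem exists_section {y : Q} (hy : y ∉ R.net f) : ∃ g : UnitSphere → Q,
    ContinuousOn g {v | pat n v = pat n (f y)} ∧ (∀ v, pat n v = pat n (f y) → f (g v) = v) ∧
      g (f y) = y := by
  have := R.compactSpace
  set s := pat n (f y) with hs
  have hs0 : ∀ i, s i ≠ 0 := h.notMem_net.1 hy
  have hs1 : s ≠ 0 := h.span.pat_ne_zero _
  -- A local homeomorphism from a compact space is a covering over the cell.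
  have cov : IsCoveringMapOn f {v | pat n v = s} := by
    refine IsCoveringMapOn.of_isLocalHomeomorphOn h.dev.1 (h.isLocalHomeomorphOn.mono ?_)
    intro x hx hxb
    have hx' : pat n (f x) = s := hx
    exact h.notMem_net.2 (by rw [hx']; exact hs0) (h.boundary_subset_net hxb)
  have hy' : (f y : Space3) ∈ patCone n s := coe_mem_patCone.2 rfl
  have : ContractibleSpace (patCone n s) := (convex_patCone n s).contractibleSpace ⟨_, hy'⟩
  have : LocallyPathConnectedSpace (patCone n s) := (isOpen_patCone hs0).locallyPathConnectedSpace
  have hne : ∀ a : patCone n s, (a : Space3) ≠ 0 := fun a ha => zero_notMem_patCone hs1 (ha ▸ a.2)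
  -- The lift is taken on the cone over the cell, which is convex and open, hence contractible and
  -- locally path connected; it is then restricted to unit vectors.
  let F₀ : C(patCone n s, UnitSphere) := ⟨fun a => sphNormalize a, by
    exact (continuousOn_sphNormalize.mono fun a ha => hne ⟨a, ha⟩).domRestrict⟩
  obtain ⟨F, ⟨hF1, hF2⟩, -⟩ := cov.existsUnique_continuousMap_lifts F₀ (a₀ := ⟨_, hy'⟩) (e₀ := y)
    (sphNormalize_coe (f y)).symm fun a => pat_sphNormalize a.2 (hne a)
  classical
  have hval : ∀ (v : UnitSphere) (hv : pat n v = s),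
      (fun v : UnitSphere => if hv : (v : Space3) ∈ patCone n s then F ⟨v, hv⟩ else y) v =
        F ⟨v, coe_mem_patCone.2 hv⟩ := fun v hv => dif_pos (coe_mem_patCone.2 hv)
  refine ⟨fun v => if hv : (v : Space3) ∈ patCone n s then F ⟨v, hv⟩ else y, ?_, ?_, ?_⟩
  · rw [continuousOn_iff_continuous_domRestrict]
    refine (F.continuous.comp (f := fun v : {v | pat n v = s} =>
      (⟨(v : UnitSphere), coe_mem_patCone.2 v.2⟩ : patCone n s)) (by fun_prop)).congr fun v => ?_
    exact (hval v v.2).symm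
  · intro v hv
    rw [hval v hv]
    exact (congrFun hF2 _).trans (sphNormalize_coe v)
  · rw [hval _ rfl]
    exact hF1

theorem exists_isom_nhds {x : Q} (hx : x ∉ R.boundary) :
    ∃ U ∈ 𝓝 x, ∀ y ∈ U, ∀ z ∈ U, dist y z = sphDist (f y) (f z) :=
  h.dev.2 x fun ⟨j, hj⟩ => hx (hj ▸ R.corner_mem_boundary j)

/-- A section over a cell does not increase distances. -/
theorem dist_section_le {s : Fin 3 → SignType} (hs : ∀ i, s i ≠ 0) {g : UnitSphere → Q}
    (hg : ContinuousOn g {v | pat n v = s}) (hfg : ∀ v, pat n v = s → f (g v) = v)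
    {u v : UnitSphere} (hu : pat n u = s) (hv : pat n v = s) :
    dist (g u) (g v) ≤ sphDist u v := by
  have hs1 : s ≠ 0 := fun h0 => hs 0 (congrFun h0 0)
  have hne : sphInner u v ≠ -1 := by
    intro h1
    have h2 : sphInner (-u) v = 1 := by rw [sphInner_neg_left, h1, neg_neg]
    have huv := eq_of_sphInner_eq_one h2
    have h3 : SignType.sign (sphInner (n 0) u) = s 0 := congrFun hu 0
    have h4 : SignType.sign (sphInner (n 0) v) = s 0 := congrFun hv 0
    rw [← huv, sphInner_comm, sphInner_neg_left, sphInner_comm, Left.sign_neg, h3] at h4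
    have h5 := hs 0
    revert h4 h5
    cases s 0 <;> decide
  obtain ⟨m, hum, hm⟩ := exists_sphArc hne
  have harc : ∀ t ∈ Icc 0 (sphDist u v), pat n (sphArc u m hum t) = s :=
    fun t ht => pat_sphArc hs1 hu hv hm ht
  have hcont : ContinuousOn (fun t => g (sphArc u m hum t)) (Icc 0 (sphDist u v)) :=
    hg.comp (continuous_sphArc u m hum).continuousOn harc
  -- The lifted geodesic is locally isometrically parametrized, so the distance of its ends is at
  -- most its length.
  have key := edist_le_eVariationOn_of_local (u := fun t => g (sphArc u m hum t)) (w := fun t : ℝ => t)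
    (sphDist_nonneg u v) (fun t ht => ?_)
  · have h1 : eVariationOn (fun t : ℝ => t) (Icc 0 (sphDist u v)) ≤ ENNReal.ofReal (sphDist u v) := by
      have hmono : MonotoneOn (fun t : ℝ => t) univ := monotone_id.monotoneOn _
      have := hmono.eVariationOn_eq (mem_univ 0) (mem_univ (sphDist u v))
      simpa using this.le
    have h2 := key.trans h1
    simp only [sphArc_zero, hm] at h2
    rw [edist_dist] at h2
    exact (ENNReal.ofReal_le_ofReal_iff (sphDist_nonneg u v)).1 h2
  · have hnb : g (sphArc u m hum t) ∉ R.boundary := fun hb =>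
      h.notMem_net.2 (by rw [hfg _ (harc t ht), harc t ht]; exact hs) (h.boundary_subset_net hb)
    obtain ⟨U, hU, hUi⟩ := h.exists_isom_nhds hnb
    obtain ⟨V, hV, hVU⟩ := mem_nhdsWithin_iff_exists_mem_nhds_inter.1
      ((hcont t ht).preimage_mem_nhdsWithin hU)
    refine ⟨V, hV, fun a ha b hb hab => ?_⟩
    refine le_trans ?_ (eVariationOn.edist_le _ (left_mem_Icc.2 hab) (right_mem_Icc.2 hab))
    rw [edist_dist, edist_dist, hUi _ (hVU ha) _ (hVU hb), hfg _ (harc a ha.2),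
      hfg _ (harc b hb.2), sphDist_sphArc, Real.dist_eq]
    rw [abs_le]
    have := sphDist_le_pi u v
    constructor <;> linarith [ha.2.1, ha.2.2, hb.2.1, hb.2.2]

theorem eqOn_pat {K : Set Q} (hK : IsPreconnected K) (hKn : K ⊆ (R.net f)ᶜ) {x y : Q} (hx : x ∈ K)
    (hy : y ∈ K) : pat n (f x) = pat n (f y) := by
  funext i
  refine hK.constant_of_mapsTo (T := univ) (f := fun x => pat n (f x) i) IsDiscrete.univ ?_
    (mapsTo_univ _ _) hx hy
  intro z hz
  have hne : sphInner (n i) (f z) ≠ 0 := fun h0 => h.notMem_net.1 (hKn hz) i (pat_eq_zero_iff.2 h0)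
  have hc : ContinuousAt (fun z => sphInner (n i) (f z)) z :=
    ((continuous_sphInner_right (n i)).comp h.dev.1).continuousAt
  exact (ContinuousAt.comp (f := fun z => sphInner (n i) (f z)) (continuousAt_sign_of_ne_zero hne)
    hc).continuousWithinAt

/-- The closure of a face is mapped homeomorphically to a closed cell. -/
theorem exists_isFaceChart {y : Q} (hy : y ∉ R.net f) :
    ∃ g, IsFaceChart f n (connectedComponentIn (R.net f)ᶜ y) (pat n (f y)) g := by
  have := R.compactSpace
  obtain ⟨g, hg, hfg, hgy⟩ := h.exists_section hy
  set s := pat n (f y) with hs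
  set K := connectedComponentIn (R.net f)ᶜ y with hKdef
  have hs0 : ∀ i, s i ≠ 0 := h.notMem_net.1 hy
  have hs1 : s ≠ 0 := h.span.pat_ne_zero _
  have hK : IsPreconnected K := isPreconnected_connectedComponentIn
  have hKn : K ⊆ (R.net f)ᶜ := connectedComponentIn_subset _ _
  have hyK : y ∈ K := mem_connectedComponentIn hy
  have hpK : ∀ x ∈ K, pat n (f x) = s := fun x hx => h.eqOn_pat hK hKn hx hyK
  -- Both maps are lifts of `f` through itself on the connected set `K`, and they agree at `y`.
  have hleft : EqOn id (fun x => g (f x)) K := by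
    refine eqOn_of_lift (p := f) hK continuousOn_id (hg.comp h.dev.1.continuousOn hpK)
      (fun x hx => (hfg _ (hpK x hx)).symm) (fun x hx => ?_) hyK hgy.symm
    obtain ⟨U, hU, hUi⟩ := h.exists_isom_nhds fun hb => hKn hx (h.boundary_subset_net hb)
    refine ⟨U, hU, fun a ha b hb hab => ?_⟩
    rw [← dist_eq_zero, hUi a ha b hb, hab, sphDist_self]
  have himg : g '' {v | pat n v = s} ⊆ K := by
    refine ((isPreconnected_setOf_pat_eq n hs1).image g hg).subset_connectedComponentIn
      ⟨f y, rfl, hgy⟩ ?_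
    rintro _ ⟨v, hv, rfl⟩
    have hv' : pat n v = s := hv
    refine h.notMem_net.2 ?_
    rw [hfg v hv, hv']
    exact hs0
  -- The bound passes to the closure of the face. There it makes `f` injective with a nonexpanding,
  -- hence continuous, inverse.
  have hstar : ∀ x ∈ closure K, ∀ z ∈ closure K, dist x z ≤ sphDist (f x) (f z) := by
    have hcl : IsClosed {p : Q × Q | dist p.1 p.2 ≤ sphDist (f p.1) (f p.2)} :=
      isClosed_le continuous_dist
        ((h.dev.1.comp continuous_fst).sphDist (h.dev.1.comp continuous_snd))
    have hsub : K ×ˢ K ⊆ {p : Q × Q | dist p.1 p.2 ≤ sphDist (f p.1) (f p.2)} := by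
      rintro ⟨x, z⟩ ⟨hx, hz⟩
      have := h.dist_section_le hs0 hg hfg (hpK x hx) (hpK z hz)
      have h1 : x = g (f x) := hleft hx
      have h2 : z = g (f z) := hleft hz
      rwa [← h1, ← h2] at this
    intro x hx z hz
    have := hcl.closure_subset_iff.2 hsub
    rw [closure_prod_eq] at this
    exact @this (x, z) ⟨hx, hz⟩
  have himgK : f '' K = {v | pat n v = s} := by
    ext v
    constructor
    · rintro ⟨x, hx, rfl⟩
      exact hpK x hx
    · intro hv
      exact ⟨g v, himg ⟨v, hv, rfl⟩, hfg v hv⟩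
  have himgcl : f '' closure K = closedCell n s := by
    rw [← h.span.closure_cell s, ← himgK]
    exact image_closure_of_isCompact isClosed_closure.isCompact h.dev.1.continuousOn
  have : Nonempty Q := ⟨y⟩
  have hinj : InjOn f (closure K) := by
    intro x hx z hz hxz
    have := hstar x hx z hz
    rw [hxz, sphDist_self] at this
    exact dist_le_zero.1 this
  have hG : ∀ v ∈ closedCell n s, Function.invFunOn f (closure K) v ∈ closure K ∧
      f (Function.invFunOn f (closure K) v) = v := fun v hv =>
    Function.invFunOn_pos (himgcl.superset hv)
  refine ⟨Function.invFunOn f (closure K), hs0, continuousOn_of_dist_le_sphDist fun u hu v hv => ?_,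
    fun v hv => (hG v hv).2, fun v hv => (hG v hv).1, fun x hx => himgcl.subset ⟨x, hx, rfl⟩,
    fun x hx => hinj.leftInvOn_invFunOn hx, fun x hx => ⟨fun hxK => hpK x hxK, fun hp => ?_⟩⟩
  · have := hstar _ (hG u hu).1 _ (hG v hv).1
    rwa [(hG u hu).2, (hG v hv).2] at this
  · have : f x ∈ f '' K := himgK.superset hp
    obtain ⟨z, hz, hzx⟩ := this
    rwa [← hinj (subset_closure hz) hx hzx]

end IsNetFrame

end MarkedSphericalRectangle

/-! ### Faces near a point -/

theorem convex_capCone (u : Space3) {r : ℝ} (hr : r ≤ Real.pi / 2) (h0 : 0 ≤ r) :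
    Convex ℝ {w : Space3 | Real.cos r * ‖w‖ < inner ℝ u w} := by
  -- Here `r ≤ π / 2` matters: with a nonnegative factor, the multiple of the norm is convex.
  have hc : 0 ≤ Real.cos r := Real.cos_nonneg_of_neg_pi_div_two_le_of_le (by linarith [Real.pi_pos]) hr
  intro v hv w hw a b ha hb hab
  simp only [mem_ofPred_eq] at hv hw ⊢
  rw [inner_add_right, real_inner_smul_right, real_inner_smul_right]
  have h1 : ‖a • v + b • w‖ ≤ a * ‖v‖ + b * ‖w‖ := by
    refine (norm_add_le _ _).trans (le_of_eq ?_)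
    rw [norm_smul, norm_smul, Real.norm_of_nonneg ha, Real.norm_of_nonneg hb]
  have h2 := mul_le_mul_of_nonneg_left h1 hc
  rcases eq_or_lt_of_le ha with rfl | ha'
  · have : b = 1 := by linarith
    subst this
    simpa using hw
  · nlinarith [mul_lt_mul_of_pos_left hv ha', mul_le_mul_of_nonneg_left hw.le hb]

/-- The part of a cell in a small cap is preconnected. -/
theorem isPreconnected_cap_inter_cell (n : Fin 3 → UnitSphere) {s : Fin 3 → SignType} (hs : s ≠ 0)
    (u : UnitSphere) {r : ℝ} (h0 : 0 ≤ r) (hr : r ≤ Real.pi / 2) :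
    IsPreconnected {v | sphDist u v < r ∧ pat n v = s} := by
  have := isPreconnected_sphere_of_convex ((convex_capCone (u : Space3) hr h0).inter (convex_patCone n s))
    (fun h => zero_notMem_patCone hs h.2) fun w hw t ht => ⟨by
      have h1 : Real.cos r * ‖w‖ < inner ℝ (u : Space3) w := hw.1
      change Real.cos r * ‖t • w‖ < inner ℝ (u : Space3) (t • w)
      rw [norm_smul, real_inner_smul_right, Real.norm_of_nonneg ht.le]
      nlinarith, smul_mem_patCone hw.2 ht⟩
  convert this using 1
  ext v
  refine and_congr ?_ coe_mem_patCone.symm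
  rw [sphDist_lt_iff h0 (by linarith [Real.pi_pos])]
  change _ ↔ Real.cos r * ‖(v : Space3)‖ < _
  rw [v.norm_eq, mul_one]
  rfl

theorem pat_eq_zero_or_one {n : Fin 3 → UnitSphere} {v : UnitSphere} {i : Fin 3} :
    pat n v i = 0 ∨ pat n v i = 1 ↔ 0 ≤ sphInner (n i) v := by
  rw [pat, sign_eq_zero_iff, sign_eq_one_iff, le_iff_eq_or_lt, eq_comm]

theorem pat_eq_zero_or_neg_one {n : Fin 3 → UnitSphere} {v : UnitSphere} {i : Fin 3} :
    pat n v i = 0 ∨ pat n v i = -1 ↔ sphInner (n i) v ≤ 0 := by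
  rw [pat, sign_eq_zero_iff, sign_eq_neg_one_iff, le_iff_eq_or_lt]

/-- A chart whose image is cut out by at most one of the great circles of the net. -/
structure IsPatChart {Q : Type*} [MetricSpace Q] (f : Q → UnitSphere) (n : Fin 3 → UnitSphere)
    (x : Q) (r : ℝ) (I : Set (Fin 3)) (τ : Fin 3 → SignType) : Prop where
  chart : IsCapChart f x r {v | ∀ i ∈ I, pat n v i = 0 ∨ pat n v i = τ i}
  zero : ∀ i ∈ I, pat n (f x) i = 0
  ne : ∀ i, τ i ≠ 0
  subsingleton : I.Subsingleton

/-- Sign patterns of cells which can occur near `x`. -/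
structure IsAdmissible {Q : Type*} (f : Q → UnitSphere) (n : Fin 3 → UnitSphere)
    (x : Q) (I : Set (Fin 3)) (τ s : Fin 3 → SignType) : Prop where
  ne : ∀ i, s i ≠ 0
  eq : ∀ i, pat n (f x) i ≠ 0 → s i = pat n (f x) i
  side : ∀ i ∈ I, s i = τ i

/-- Points mapped to the intersection of two great circles of the net. -/
def IsVertex {Q : Type*} (f : Q → UnitSphere) (n : Fin 3 → UnitSphere) (x : Q) : Prop :=
  ∃ i j, i ≠ j ∧ pat n (f x) i = 0 ∧ pat n (f x) j = 0

theorem IsPatChart.shrink {Q : Type*} [MetricSpace Q] {f : Q → UnitSphere} {n : Fin 3 → UnitSphere}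
    {x : Q} {r : ℝ} {I : Set (Fin 3)} {τ : Fin 3 → SignType} (h : IsPatChart f n x r I τ) {r' : ℝ}
    (h0 : 0 < r') (hr : r' ≤ r) : IsPatChart f n x r' I τ :=
  ⟨h.chart.shrink h0 hr, h.zero, h.ne, h.subsingleton⟩

/-- A circle through `f x` that does not bound the image of the chart leaves the sign with respect
to it free. -/
theorem IsAdmissible.update {Q : Type*} [MetricSpace Q] {f : Q → UnitSphere}
    {n : Fin 3 → UnitSphere} {x : Q} {I : Set (Fin 3)} {τ : Fin 3 → SignType}
    {s : Fin 3 → SignType} (h : IsAdmissible f n x I τ s) {i : Fin 3} (hi : pat n (f x) i = 0)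
    (hI : i ∉ I) {σ : SignType} (hσ : σ ≠ 0) :
    IsAdmissible f n x I τ (Function.update s i σ) := by
  refine ⟨fun j => ?_, fun j hj => ?_, fun j hj => ?_⟩ <;> by_cases hij : j = i
  · rw [hij, Function.update_self]; exact hσ
  · rw [Function.update_of_ne hij]; exact h.ne j
  · exact absurd (hij ▸ hi) hj
  · rw [Function.update_of_ne hij]; exact h.eq j hj
  · exact absurd (hij ▸ hj) hI
  · rw [Function.update_of_ne hij]; exact h.side j hj

theorem IsPatChart.exists_isAdmissible {Q : Type*} [MetricSpace Q] {f : Q → UnitSphere}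
    {n : Fin 3 → UnitSphere} {x : Q} {r : ℝ} {I : Set (Fin 3)} {τ : Fin 3 → SignType}
    (h : IsPatChart f n x r I τ) : ∃ s, IsAdmissible f n x I τ s := by
  classical
  refine ⟨fun i => if pat n (f x) i = 0 then τ i else pat n (f x) i, fun i => ?_, fun i hi => ?_,
    fun i hi => ?_⟩
  · split_ifs with h1
    · exact h.ne i
    · exact h1
  · rw [if_neg hi]
  · rw [if_pos (h.zero i hi)]

namespace IsFaceChart

variable {Q : Type*} [MetricSpace Q] {f : Q → UnitSphere} {n : Fin 3 → UnitSphere} {K : Set Q}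
  {s : Fin 3 → SignType} {g : UnitSphere → Q}

/-- The sign pattern of a face near `x` is admissible. -/
theorem isAdmissible (hg : IsFaceChart f n K s g) {x : Q} {r : ℝ} {I : Set (Fin 3)}
    {τ : Fin 3 → SignType} (hx : IsPatChart f n x r I τ) (hxK : x ∈ closure K) :
    IsAdmissible f n x I τ s := by
  refine ⟨hg.ne, fun i hi => ((hg.maps x hxK i).resolve_left hi).symm, fun i hi => ?_⟩
  obtain ⟨y, hyK, hy⟩ := Metric.mem_closure_iff.1 hxK r hx.chart.pos
  have hys := (hg.mem_iff y (subset_closure hyK)).1 hyK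
  rw [dist_comm] at hy
  have := (hx.chart.image.subset ⟨y, hy, rfl⟩).2 i hi
  rw [hys] at this
  exact this.resolve_left (hg.ne i)

theorem pat_of_mem (hg : IsFaceChart f n K s g) {x : Q} (hx : x ∈ K) : pat n (f x) = s :=
  (hg.mem_iff x (subset_closure hx)).1 hx

theorem pat_eq_of_ne_zero (hg : IsFaceChart f n K s g) {x : Q} (hx : x ∈ closure K) {i : Fin 3}
    (hi : pat n (f x) i ≠ 0) : pat n (f x) i = s i := (hg.maps x hx i).resolve_left hi

theorem injOn (hg : IsFaceChart f n K s g) : InjOn f (closure K) := fun x hx y hy hxy => by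
  rw [← hg.left x hx, ← hg.left y hy, hxy]

end IsFaceChart

namespace MarkedSphericalRectangle

variable {Q : Type*} [MetricSpace Q] {R : MarkedSphericalRectangle Q} {f : Q → UnitSphere}

variable (R f) in
/-- The faces are the connected components of the complement of the net. -/
def IsFace (K : Set Q) : Prop := ∃ y ∉ R.net f, K = connectedComponentIn (R.net f)ᶜ y

namespace IsNetFrame

variable {n : Fin 3 → UnitSphere} {c : Fin 4 → Fin 3} (h : R.IsNetFrame f n c)
include h

/-- At an interior point the image is a full cap, so `I` is empty. At a point of the side `j` it is
the half-cap cut by the circle `c j`, and `τ` records which half. -/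
theorem exists_isPatChart {x : Q} (hx : x ∉ range R.corner) : ∃ r I τ, IsPatChart f n x r I τ ∧
    (x ∉ R.boundary → I = ∅) ∧ (x ∈ R.boundary → I.Nonempty) := by
  by_cases hb : x ∈ R.boundary
  · obtain ⟨j, hj⟩ := R.exists_mem_side hb hx
    have hz : pat n (f x) (c j) = 0 := pat_eq_zero_iff.2 (h.zero j x hj)
    rcases h.normal j x hj with ⟨-, r, hr, -⟩ | ⟨-, r, hr, -⟩
    · refine ⟨r, {c j}, fun _ => 1, ⟨?_, ?_, fun _ => one_ne_zero, subsingleton_singleton⟩,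
        fun h => absurd hb h, fun _ => singleton_nonempty _⟩
      · simpa only [mem_singleton_iff, forall_eq, pat_eq_zero_or_one] using hr
      · rintro i rfl; exact hz
    · refine ⟨r, {c j}, fun _ => -1, ⟨?_, ?_, fun _ => by decide, subsingleton_singleton⟩,
        fun h => absurd hb h, fun _ => singleton_nonempty _⟩
      · simpa only [mem_singleton_iff, forall_eq, pat_eq_zero_or_neg_one, sphInner_neg_left,
          Left.nonneg_neg_iff] using hr
      · rintro i rfl; exact hz
  · obtain ⟨r, hr⟩ := R.exists_capChart_of_interior h.dev hb
    refine ⟨r, ∅, fun _ => 1, ⟨?_, fun i hi => hi.elim, fun _ => one_ne_zero, subsingleton_empty⟩,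
      fun _ => rfl, fun h => absurd h hb⟩
    simpa using hr

theorem exists_chart_of_isFace {K : Set Q} (hK : R.IsFace f K) : ∃ s g, IsFaceChart f n K s g := by
  obtain ⟨y, hy, rfl⟩ := hK
  exact ⟨_, h.exists_isFaceChart hy⟩

variable {x : Q} {r : ℝ} {I : Set (Fin 3)} {τ s : Fin 3 → SignType}

/-- The chart identifies this set with the part of a cell in a cap, the trace of a convex cone; it
is nonempty since `f x` lies in the closure of the cell. So each admissible pattern belongs to
exactly one face near `x`. -/
theorem isPreconnected_ball_inter (hx : IsPatChart f n x r I τ) (hs : IsAdmissible f n x I τ s) :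
    IsPreconnected {y ∈ Metric.ball x r | pat n (f y) = s} ∧
      ∃ y ∈ Metric.ball x r, pat n (f y) = s := by
  have hs1 : s ≠ 0 := fun h0 => hs.ne 0 (congrFun h0 0)
  obtain ⟨g, hg1, hg2, hg3⟩ := hx.chart.exists_inverse
  have hH : ∀ v, pat n v = s → ∀ i ∈ I, pat n v i = 0 ∨ pat n v i = τ i := by
    rintro v rfl i hi
    exact .inr (hs.side i hi)
  have himg : {y ∈ Metric.ball x r | pat n (f y) = s} =
      g '' {v | sphDist (f x) v < r ∧ pat n v = s} := by
    ext y
    constructor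
    · rintro ⟨hy, hys⟩
      exact ⟨f y, ⟨(hx.chart.image.subset ⟨y, hy, rfl⟩).1, hys⟩, hg2 y hy⟩
    · rintro ⟨v, ⟨hv, hvs⟩, rfl⟩
      obtain ⟨h1, h2⟩ := hg1 v hv (hH v hvs)
      exact ⟨h1, by rw [h2, hvs]⟩
  constructor
  · rw [himg]
    refine (isPreconnected_cap_inter_cell n hs1 (f x) hx.chart.pos.le hx.chart.le).image g
      (hg3.mono fun v hv => ⟨hv.1, hH v hv.2⟩)
  · obtain ⟨v, hv, hvs⟩ := mem_closure_iff.1 (h.span.mem_closure_cell (u := f x) fun i hi => hs.eq i hi)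
      _ (isOpen_setOf_sphDist_lt (f x) r) (by
        change sphDist (f x) (f x) < r
        rw [sphDist_self]
        exact hx.chart.pos)
    obtain ⟨h1, h2⟩ := hg1 v hv (hH v hvs)
    exact ⟨g v, h1, by rw [h2, hvs]⟩

theorem subset_compl_net (hs : ∀ i, s i ≠ 0) :
    {y ∈ Metric.ball x r | pat n (f y) = s} ⊆ (R.net f)ᶜ := by
  rintro y ⟨-, hy⟩
  refine h.notMem_net.2 ?_
  rw [hy]
  exact hs

/-- Every admissible sign pattern is realized by a face. -/
theorem exists_face (hx : IsPatChart f n x r I τ) (hs : IsAdmissible f n x I τ s) :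
    ∃ K g, R.IsFace f K ∧ IsFaceChart f n K s g ∧ x ∈ closure K := by
  obtain ⟨hpre, y, hy, hys⟩ := h.isPreconnected_ball_inter hx hs
  have hyn : y ∉ R.net f := h.subset_compl_net hs.ne ⟨hy, hys⟩
  obtain ⟨g, hg⟩ := h.exists_isFaceChart hyn
  rw [hys] at hg
  refine ⟨_, g, ⟨y, hyn, rfl⟩, hg, Metric.mem_closure_iff.2 fun ε hε => ?_⟩
  obtain ⟨-, z, hz, hzs⟩ := h.isPreconnected_ball_inter
    (hx.shrink (r' := min r ε) (lt_min hx.chart.pos hε) (min_le_left _ _)) hs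
  refine ⟨z, hpre.subset_connectedComponentIn ⟨hy, hys⟩ (h.subset_compl_net hs.ne)
    ⟨Metric.ball_subset_ball (min_le_left _ _) hz, hzs⟩, ?_⟩
  rw [dist_comm]
  exact (Metric.mem_ball.1 hz).trans_le (min_le_right _ _)

/-- Two faces near `x` with the same sign pattern coincide. -/
theorem face_eq {K K' : Set Q} {g g' : UnitSphere → Q} (hx : x ∉ range R.corner)
    (hK : R.IsFace f K) (hK' : R.IsFace f K') (hg : IsFaceChart f n K s g)
    (hg' : IsFaceChart f n K' s g') (hxK : x ∈ closure K) (hxK' : x ∈ closure K') : K = K' := by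
  obtain ⟨r, I, τ, hr, -, -⟩ := h.exists_isPatChart hx
  have hs := hg.isAdmissible hr hxK
  have hpre := (h.isPreconnected_ball_inter hr hs).1
  have key : ∀ {L : Set Q} {k : UnitSphere → Q}, R.IsFace f L → IsFaceChart f n L s k → x ∈ closure L →
      L = connectedComponentIn (R.net f)ᶜ (h.isPreconnected_ball_inter hr hs).2.choose := by
    rintro L k ⟨y, hy, rfl⟩ hk hxL
    obtain ⟨z, hzL, hz⟩ := Metric.mem_closure_iff.1 hxL r hr.chart.pos
    have hzs := (hk.mem_iff z (subset_closure hzL)).1 hzL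
    rw [dist_comm] at hz
    have h1 := (h.isPreconnected_ball_inter hr hs).2.choose_spec
    have h2 := hpre.subset_connectedComponentIn (x := z) ⟨hz, hzs⟩ (h.subset_compl_net hs.ne) h1
    rw [connectedComponentIn_eq hzL, connectedComponentIn_eq h2]
  rw [key hK hg hxK, key hK' hg' hxK']

/-- Near a corner `f` need not be injective, but it preserves the distance to the corner, which
suffices. -/
theorem exists_nhds_fiber : ∀ e : Q, ∃ U ∈ 𝓝 e, ∀ y ∈ U, f y = f e → y = e := by
  intro e
  by_cases he : e ∈ range R.corner
  · obtain ⟨j, rfl⟩ := he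
    obtain ⟨U, hU, hd⟩ := R.exists_dist_corner_eq h.dev j
    refine ⟨U, hU, fun y hy hye => ?_⟩
    have := hd y hy
    rw [hye, sphDist_self] at this
    exact (dist_eq_zero.1 this).symm
  · obtain ⟨r, H, hr⟩ := R.exists_capChart h.dev he
    exact ⟨_, Metric.ball_mem_nhds _ hr.pos, fun y hy hye => hr.injOn hy hr.mem_self hye⟩

theorem finite_fiber (v : UnitSphere) : (f ⁻¹' {v}).Finite := by
  have := R.compactSpace
  refine ((isClosed_singleton.preimage h.dev.1).isCompact).finite ?_
  refine isDiscrete_iff_forall_mem_exists_isOpen.2 fun e he => ?_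
  obtain ⟨U, hU, hUe⟩ := h.exists_nhds_fiber e
  obtain ⟨V, hVU, hV, heV⟩ := mem_nhds_iff.1 hU
  refine ⟨V, hV, subset_antisymm (fun y hy => hUe y (hVU hy.1) ?_) (singleton_subset_iff.2 ⟨heV, he⟩)⟩
  exact hy.2.trans (Eq.symm he)

/-- The image of a vertex is determined by its signs, of which there are finitely many, and fibres
are finite. -/
theorem finite_setOf_isVertex : {x | IsVertex f n x}.Finite := by
  have hv : ∀ i j : Fin 3, i ≠ j → {v | pat n v i = 0 ∧ pat n v j = 0}.Finite := by
    intro i j hij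
    have : InjOn (pat n) {v | pat n v i = 0 ∧ pat n v j = 0} :=
      fun v hv w _ hvw => h.span.eq_of_pat_eq hvw hij hv.1 hv.2
    exact Set.Finite.of_finite_image (toFinite _) this
  have : {x | IsVertex f n x} ⊆ ⋃ (i : Fin 3) (j : Fin 3) (_ : i ≠ j),
      ⋃ v ∈ {v | pat n v i = 0 ∧ pat n v j = 0}, f ⁻¹' {v} := by
    rintro x ⟨i, j, hij, h1⟩
    simp only [mem_iUnion]
    exact ⟨i, j, hij, f x, h1, rfl⟩
  refine Finite.subset ?_ this
  refine finite_iUnion fun i => finite_iUnion fun j => finite_iUnion fun hij => ?_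
  exact (hv i j hij).biUnion fun v _ => h.finite_fiber v

/-- Each face is the component of a point over the chosen point `v s` of its cell, and fibres are
finite. -/
theorem finite_setOf_isFace : {K | R.IsFace f K}.Finite := by
  have hex : ∀ s : Fin 3 → SignType, ∃ v, s ≠ 0 → pat n v = s := fun s => by
    by_cases hs : s = 0
    · exact ⟨n 0, fun h => absurd hs h⟩
    · obtain ⟨v, hv⟩ := h.span.cell_nonempty hs
      exact ⟨v, fun _ => hv⟩
  choose v hv using hex
  have : {K | R.IsFace f K} ⊆ ⋃ s, connectedComponentIn (R.net f)ᶜ '' (f ⁻¹' {v s}) := by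
    rintro K ⟨y, hy, rfl⟩
    obtain ⟨g, hg⟩ := h.exists_isFaceChart hy
    have hvs := hv (pat n (f y)) (h.span.pat_ne_zero _)
    have hvc : v (pat n (f y)) ∈ closedCell n (pat n (f y)) := fun i => .inr (congrFun hvs i)
    refine mem_iUnion.2 ⟨pat n (f y), g (v (pat n (f y))), hg.right _ hvc, ?_⟩
    refine (connectedComponentIn_eq ?_).symm
    rw [hg.mem_iff _ (hg.mem_closure _ hvc), hg.right _ hvc, hvs]
  exact (finite_iUnion fun s => (h.finite_fiber _).image _).subset this

/-- The closed faces cover the rectangle. -/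
theorem exists_mem_closure_face (x : Q) : ∃ K, R.IsFace f K ∧ x ∈ closure K := by
  have h1 : ∀ x ∉ range R.corner, ∃ K, R.IsFace f K ∧ x ∈ closure K := by
    intro x hx
    obtain ⟨r, I, τ, hr, -, -⟩ := h.exists_isPatChart hx
    obtain ⟨s, hs⟩ := hr.exists_isAdmissible
    obtain ⟨K, g, hK, -, hxK⟩ := h.exists_face hr hs
    exact ⟨K, hK, hxK⟩
  by_cases hx : x ∈ range R.corner
  -- Corners have no such chart; they are limits of points of a side, and finitely many closed faces
  -- form a closed set.
  · obtain ⟨j, rfl⟩ := hx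
    have hcl : IsClosed (⋃ K ∈ {K | R.IsFace f K}, closure K) :=
      h.finite_setOf_isFace.isClosed_biUnion fun K _ => isClosed_closure
    have hsub : R.side j ⊆ ⋃ K ∈ {K | R.IsFace f K}, closure K := by
      intro y hy
      obtain ⟨K, hK, hyK⟩ := h1 y (R.side_subset_compl_corner j hy)
      exact mem_biUnion (show K ∈ {K | R.IsFace f K} from hK) hyK
    have := closure_minimal hsub hcl (R.corner_mem_closure_side j)
    simp only [mem_iUnion] at this
    obtain ⟨K, hK, hxK⟩ := this
    exact ⟨K, hK, hxK⟩
  · exact h1 x hx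

end IsNetFrame

end MarkedSphericalRectangle

/-! ### Vertices and the faces around them -/

theorem SignType.eq_neg_of_ne {a b : SignType} (ha : a ≠ 0) (hb : b ≠ 0) (hab : a ≠ b) : a = -b := by
  revert ha hb hab; cases a <;> cases b <;> decide

theorem exists_ne_mem_pair {i j k : Fin 3} (hij : i ≠ j) : ∃ l, (l = i ∨ l = j) ∧ l ≠ k := by
  by_cases h : i = k
  · exact ⟨j, .inr rfl, fun h' => hij (h.trans h'.symm)⟩
  · exact ⟨i, .inl rfl, h⟩

namespace MarkedSphericalRectangle

variable {Q : Type*} [MetricSpace Q] {R : MarkedSphericalRectangle Q} {f : Q → UnitSphere}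

namespace IsNetFrame

variable {n : Fin 3 → UnitSphere} {c : Fin 4 → Fin 3} (h : R.IsNetFrame f n c)
include h

theorem isVertex_corner (j : Fin 4) : IsVertex f n (R.corner j) := by
  have h1 := h.corner_right (j + 3)
  have h2 := h.adj (j + 3)
  rw [fin4_add_three] at h1 h2
  exact ⟨_, _, h2, pat_eq_zero_iff.2 h1, pat_eq_zero_iff.2 (h.corner_left j)⟩

theorem notMem_corner {x : Q} (hx : ¬ IsVertex f n x) : x ∉ range R.corner := by
  rintro ⟨j, rfl⟩
  exact hx (h.isVertex_corner j)

theorem isVertex_mem_net {x : Q} (hx : IsVertex f n x) : x ∈ R.net f := by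
  obtain ⟨i, j, -, hi, -⟩ := hx
  rw [h.net_eq]
  exact ⟨i, pat_eq_zero_iff.1 hi⟩

/-- The sign patterns of distinct faces meeting at a point which is not a vertex are opposite at
one index. -/
theorem exists_opposite {x : Q} (hx : ¬ IsVertex f n x) {K K' : Set Q} {s s' : Fin 3 → SignType}
    {g g' : UnitSphere → Q} (hK : R.IsFace f K) (hK' : R.IsFace f K') (hg : IsFaceChart f n K s g)
    (hg' : IsFaceChart f n K' s' g') (hxK : x ∈ closure K) (hxK' : x ∈ closure K') (hne : K ≠ K') :
    ∃ i, pat n (f x) i = 0 ∧ s i = -s' i ∧ ∀ j, j ≠ i → pat n (f x) j ≠ 0 := by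
  have hss : s ≠ s' := by
    rintro rfl
    exact hne (h.face_eq (h.notMem_corner hx) hK hK' hg hg' hxK hxK')
  obtain ⟨i, hi⟩ := Function.ne_iff.1 hss
  have hi0 : pat n (f x) i = 0 := by
    by_contra h0
    exact hi ((hg.pat_eq_of_ne_zero hxK h0).symm.trans (hg'.pat_eq_of_ne_zero hxK' h0))
  exact ⟨i, hi0, SignType.eq_neg_of_ne (hg.ne i) (hg'.ne i) hi,
    fun j hj hj0 => hx ⟨i, j, hj.symm, hi0, hj0⟩⟩

/-- The two faces adjacent to `x` across the circle `i`, when the rectangle extends to both of its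
sides. -/
theorem exists_face_pair {x : Q} {r : ℝ} {I : Set (Fin 3)} {τ s : Fin 3 → SignType}
    (hx : IsPatChart f n x r I τ) (hs : IsAdmissible f n x I τ s) {i : Fin 3}
    (hi : pat n (f x) i = 0) (hI : i ∉ I) : ∃ K g K' g', R.IsFace f K ∧ R.IsFace f K' ∧
      IsFaceChart f n K (Function.update s i 1) g ∧ IsFaceChart f n K' (Function.update s i (-1)) g' ∧
      x ∈ closure K ∧ x ∈ closure K' := by
  obtain ⟨K, g, h1, h2, h3⟩ := h.exists_face hx (hs.update hi hI (σ := 1) (by decide))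
  obtain ⟨K', g', h1', h2', h3'⟩ := h.exists_face hx (hs.update hi hI (σ := -1) (by decide))
  exact ⟨K, g, K', g', h1, h1', h2, h2', h3, h3'⟩

end IsNetFrame

theorem IsFace.nonempty {K : Set Q} (hK : R.IsFace f K) : K.Nonempty := by
  obtain ⟨y, hy, rfl⟩ := hK
  exact ⟨y, mem_connectedComponentIn hy⟩

theorem _root_.IsFaceChart.pattern_eq {n : Fin 3 → UnitSphere} {K : Set Q} {s s' : Fin 3 → SignType}
    {g g' : UnitSphere → Q} (hK : K.Nonempty) (hg : IsFaceChart f n K s g)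
    (hg' : IsFaceChart f n K s' g') : s = s' := by
  obtain ⟨y, hy⟩ := hK
  rw [← hg.pat_of_mem hy, ← hg'.pat_of_mem hy]

namespace IsNetFrame

variable {n : Fin 3 → UnitSphere} {c : Fin 4 → Fin 3} (h : R.IsNetFrame f n c)
include h

/-- Interior vertices are the points where at least three faces meet. -/
theorem isVertex_iff_of_interior {x : Q} (hx : x ∉ R.boundary) : IsVertex f n x ↔
    ∃ K₁ K₂ K₃, (R.IsFace f K₁ ∧ x ∈ closure K₁) ∧ (R.IsFace f K₂ ∧ x ∈ closure K₂) ∧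
      (R.IsFace f K₃ ∧ x ∈ closure K₃) ∧ K₁ ≠ K₂ ∧ K₁ ≠ K₃ ∧ K₂ ≠ K₃ := by
  constructor
  · rintro ⟨i, j, hij, hi, hj⟩
    obtain ⟨r, I, τ, hr, hI, -⟩ := h.exists_isPatChart (x := x)
      fun ⟨j, hj⟩ => hx (hj ▸ R.corner_mem_boundary j)
    obtain rfl := hI hx
    obtain ⟨s, hs⟩ := hr.exists_isAdmissible
    -- Both circles are crossed at an interior point, so all four sign choices at `i` and `j` occur;
    -- three of them suffice.
    obtain ⟨K₁, g₁, K₂, g₂, f1, f2, c1, c2, m1, m2⟩ := h.exists_face_pair hr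
      (hs.update hj (notMem_empty _) (σ := 1) (by decide)) hi (notMem_empty _)
    obtain ⟨K₃, g₃, -, -, f3, -, c3, -, m3, -⟩ := h.exists_face_pair hr
      (hs.update hj (notMem_empty _) (σ := -1) (by decide)) hi (notMem_empty _)
    refine ⟨K₁, K₂, K₃, ⟨f1, m1⟩, ⟨f2, m2⟩, ⟨f3, m3⟩, ?_, ?_, ?_⟩
    · rintro rfl
      have := congrFun (c1.pattern_eq f1.nonempty c2) i
      simp at this
    · rintro rfl
      have := congrFun (c1.pattern_eq f1.nonempty c3) j
      simp [Function.update_of_ne hij.symm] at this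
    · rintro rfl
      have := congrFun (c2.pattern_eq f2.nonempty c3) j
      simp [Function.update_of_ne hij.symm] at this
  · rintro ⟨K₁, K₂, K₃, ⟨f1, m1⟩, ⟨f2, m2⟩, ⟨f3, m3⟩, h12, h13, h23⟩
    by_contra hv
    obtain ⟨s₁, g₁, c1⟩ := h.exists_chart_of_isFace f1
    obtain ⟨s₂, g₂, c2⟩ := h.exists_chart_of_isFace f2
    obtain ⟨s₃, g₃, c3⟩ := h.exists_chart_of_isFace f3
    -- Three distinct faces would have pairwise opposite signs with respect to the only circle
    -- through `f x`.
    obtain ⟨i, hi, e1, hi'⟩ := h.exists_opposite hv f1 f2 c1 c2 m1 m2 h12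
    obtain ⟨j, hj, e2, -⟩ := h.exists_opposite hv f1 f3 c1 c3 m1 m3 h13
    obtain ⟨k, hk, e3, -⟩ := h.exists_opposite hv f2 f3 c2 c3 m2 m3 h23
    obtain rfl : j = i := by_contra fun hne => hi' j hne hj
    obtain rfl : k = j := by_contra fun hne => hi' k hne hk
    have h1 := c1.ne k
    rw [e1, e3, neg_neg] at e2
    have h3 := c3.ne k
    revert e2 h3
    cases s₃ k <;> decide

/-- Vertices on the boundary are the corners and the points where at least two faces meet. -/
theorem isVertex_iff_of_boundary {x : Q} (hx : x ∈ R.boundary) : IsVertex f n x ↔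
    x ∈ range R.corner ∨ ∃ K₁ K₂, (R.IsFace f K₁ ∧ x ∈ closure K₁) ∧
      (R.IsFace f K₂ ∧ x ∈ closure K₂) ∧ K₁ ≠ K₂ := by
  by_cases hc : x ∈ range R.corner
  · refine iff_of_true ?_ (.inl hc)
    obtain ⟨j, rfl⟩ := hc
    exact h.isVertex_corner j
  obtain ⟨r, I, τ, hr, -, hI⟩ := h.exists_isPatChart hc
  obtain ⟨k, hk⟩ := hI hx
  constructor
  · rintro ⟨i, j, hij, hi, hj⟩
    obtain ⟨s, hs⟩ := hr.exists_isAdmissible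
    -- Of two circles through `f x`, one is not that of the side, so both of its sides occur near
    -- `x`.
    obtain ⟨l, hl, hlk⟩ := exists_ne_mem_pair (k := k) hij
    have hl0 : pat n (f x) l = 0 := by rcases hl with rfl | rfl <;> assumption
    obtain ⟨K₁, g₁, K₂, g₂, f1, f2, c1, c2, m1, m2⟩ := h.exists_face_pair hr hs hl0
      fun hlI => hlk (hr.subsingleton hlI hk)
    refine .inr ⟨K₁, K₂, ⟨f1, m1⟩, ⟨f2, m2⟩, ?_⟩
    rintro rfl
    have := congrFun (c1.pattern_eq f1.nonempty c2) l
    simp at this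
  · rintro (hc' | ⟨K₁, K₂, ⟨f1, m1⟩, ⟨f2, m2⟩, h12⟩)
    · exact absurd hc' hc
    · by_contra hv
      obtain ⟨s₁, g₁, c1⟩ := h.exists_chart_of_isFace f1
      obtain ⟨s₂, g₂, c2⟩ := h.exists_chart_of_isFace f2
      obtain ⟨i, hi, e1, hi'⟩ := h.exists_opposite hv f1 f2 c1 c2 m1 m2 h12
      -- The only circle through `f x` is that of the side, and all faces lie on the same side of
      -- it.
      obtain rfl : k = i := by_contra fun hne => hi' k hne (hr.zero k hk)
      have h1 := (c1.isAdmissible hr m1).side k hk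
      have h2 := (c2.isAdmissible hr m2).side k hk
      have h3 := c1.ne k
      rw [h2, ← h1] at e1
      revert h3 e1
      cases s₁ k <;> decide

/-- A point of the net in a closed face which is not a vertex lies on an open edge of the face. -/
theorem exists_edge {x : Q} (hx : ¬ IsVertex f n x) (hn : x ∈ R.net f) {K : Set Q}
    {s : Fin 3 → SignType} {g : UnitSphere → Q} (hg : IsFaceChart f n K s g) (hxK : x ∈ closure K) :
    ∃ i, pat n (f x) = Function.update s i 0 := by
  rw [h.net_eq] at hn
  obtain ⟨i, hi⟩ := hn
  refine ⟨i, funext fun j => ?_⟩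
  by_cases hij : j = i
  · subst hij; rw [Function.update_self]; exact pat_eq_zero_iff.2 hi
  · rw [Function.update_of_ne hij]
    exact hg.pat_eq_of_ne_zero hxK fun hj => hx ⟨i, j, fun h => hij h.symm, pat_eq_zero_iff.2 hi, hj⟩

end IsNetFrame

/-! ### Combinatorial equivalence -/

section Two

variable {Q' : Type*} [MetricSpace Q'] {R' : MarkedSphericalRectangle Q'} {f' : Q' → UnitSphere}

variable (R f R' f') in
/-- A homeomorphism which respects boundaries, corners and nets. -/
structure IsNetHomeo (e : Q ≃ₜ Q') : Prop where
  boundary : ∀ x, e x ∈ R'.boundary ↔ x ∈ R.boundary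
  corner : ∀ j, e (R.corner j) = R'.corner j
  net : ∀ x, e x ∈ R'.net f' ↔ x ∈ R.net f

namespace IsNetHomeo

variable {e : Q ≃ₜ Q'} (he : IsNetHomeo R f R' f' e)
include he

theorem symm : IsNetHomeo R' f' R f e.symm where
  boundary x := by rw [← he.boundary, e.apply_symm_apply]
  corner j := by rw [← he.corner, e.symm_apply_apply]
  net x := by rw [← he.net, e.apply_symm_apply]

theorem isFace {K : Set Q} (hK : R.IsFace f K) : R'.IsFace f' (e '' K) := by
  obtain ⟨y, hy, rfl⟩ := hK
  refine ⟨e y, fun hn => hy ((he.net y).1 hn), ?_⟩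
  rw [e.image_connectedComponentIn (show y ∈ (R.net f)ᶜ from hy)]
  congr 1
  ext z
  obtain ⟨z, rfl⟩ := e.surjective z
  rw [e.injective.mem_set_image]
  exact not_congr (he.net z).symm

omit he in
theorem _root_.Homeomorph.apply_mem_closure_image (e : Q ≃ₜ Q') {K : Set Q} {x : Q} :
    e x ∈ closure (e '' K) ↔ x ∈ closure K := by
  rw [← e.image_closure, e.injective.mem_set_image]

variable {n n' : Fin 3 → UnitSphere} {c c' : Fin 4 → Fin 3} (h : R.IsNetFrame f n c)
  (h' : R'.IsNetFrame f' n' c')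
include h h'

/-- Vertices are characterised by faces, boundary and corners, all of which `e` respects. -/
theorem isVertex {x : Q} (hx : IsVertex f n x) : IsVertex f' n' (e x) := by
  by_cases hb : x ∈ R.boundary
  · rw [h'.isVertex_iff_of_boundary ((he.boundary x).2 hb)]
    rcases (h.isVertex_iff_of_boundary hb).1 hx with ⟨j, rfl⟩ | ⟨K₁, K₂, ⟨f1, m1⟩, ⟨f2, m2⟩, h12⟩
    · exact .inl ⟨j, (he.corner j).symm⟩
    · exact .inr ⟨e '' K₁, e '' K₂, ⟨he.isFace f1, e.apply_mem_closure_image.2 m1⟩,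
        ⟨he.isFace f2, e.apply_mem_closure_image.2 m2⟩, e.injective.image_injective.ne h12⟩
  · rw [h'.isVertex_iff_of_interior fun hb' => hb ((he.boundary x).1 hb')]
    obtain ⟨K₁, K₂, K₃, ⟨f1, m1⟩, ⟨f2, m2⟩, ⟨f3, m3⟩, h12, h13, h23⟩ :=
      (h.isVertex_iff_of_interior hb).1 hx
    exact ⟨e '' K₁, e '' K₂, e '' K₃, ⟨he.isFace f1, e.apply_mem_closure_image.2 m1⟩,
      ⟨he.isFace f2, e.apply_mem_closure_image.2 m2⟩, ⟨he.isFace f3, e.apply_mem_closure_image.2 m3⟩,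
      e.injective.image_injective.ne h12, e.injective.image_injective.ne h13,
      e.injective.image_injective.ne h23⟩

theorem isVertex_iff {x : Q} : IsVertex f' n' (e x) ↔ IsVertex f n x := by
  refine ⟨fun hx => ?_, he.isVertex h h'⟩
  have := he.symm.isVertex h' h hx
  rwa [e.symm_apply_apply] at this

omit he h in
/-- The sign pattern is constant on a connected subset of the open edges of a closed cell. -/
theorem pat_eq_of_isPreconnected {S : Set Q'} (hS : IsPreconnected S) {s : Fin 3 → SignType}
    (hs : ∀ i, s i ≠ 0) (hSs : ∀ y ∈ S, ∃ k, pat n' (f' y) = Function.update s k 0) {y z : Q'}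
    (hy : y ∈ S) (hz : z ∈ S) : pat n' (f' y) = pat n' (f' z) := by
  refine hS.induction₂ (fun a b => pat n' (f' a) = pat n' (f' b)) (fun a ha => ?_)
    (fun _ _ _ _ _ _ => Eq.trans) (fun _ _ _ _ => Eq.symm) hy hz
  obtain ⟨k, hk⟩ := hSs a ha
  -- Nonzero signs persist nearby, so the index at which the sign vanishes cannot jump.
  have hev : ∀ᶠ b in 𝓝 a, ∀ j, j ≠ k → pat n' (f' b) j ≠ 0 := by
    refine Filter.eventually_all.2 fun j => ?_
    by_cases hj : j = k
    · exact .of_forall fun b hb => absurd hj hb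
    · have hc : Continuous fun b => sphInner (n' j) (f' b) :=
        (continuous_sphInner_right (n' j)).comp h'.dev.1
      have hne : sphInner (n' j) (f' a) ≠ 0 := fun h0 => hs j (by
        rw [← Function.update_of_ne hj 0 s, ← hk]; exact pat_eq_zero_iff.2 h0)
      filter_upwards [hc.continuousAt.eventually_ne hne] with b hb _
      exact fun h0 => hb (pat_eq_zero_iff.1 h0)
  filter_upwards [nhdsWithin_le_nhds hev, self_mem_nhdsWithin] with b hb hbS
  obtain ⟨l, hl⟩ := hSs b hbS
  have : l = k := by
    by_contra hlk
    exact hb l hlk (by rw [hl, Function.update_self])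
  rw [hk, hl, this]

omit he h h' in
theorem _root_.IsFaceChart.edge_subset (n : Fin 3 → UnitSphere) (s : Fin 3 → SignType) (i : Fin 3) :
    {v | pat n v = Function.update s i 0} ⊆ closedCell n s := by
  intro v hv j
  have hv' : pat n v = Function.update s i 0 := hv
  rw [hv']
  by_cases hj : j = i
  · subst hj; simp
  · rw [Function.update_of_ne hj]; exact .inr rfl

/-- An equivalence of nets induces a map of the edges of a face. -/
theorem exists_edge_map {K : Set Q} {s s' : Fin 3 → SignType}
    {g : UnitSphere → Q} {g' : UnitSphere → Q'} (hg : IsFaceChart f n K s g) (hg' : IsFaceChart f' n' (e '' K) s' g') :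
    ∃ k : Fin 3 → Fin 3,
      (∀ i, ∀ x ∈ closure K, pat n (f x) = Function.update s i 0 →
        pat n' (f' (e x)) = Function.update s' (k i) 0) ∧
      ∀ i, ∀ x ∈ closure K, pat n (f x) i = 0 → pat n' (f' (e x)) (k i) = 0 := by
  have hupd : ∀ i, Function.update s i 0 ≠ 0 := fun i h0 => by
    obtain ⟨j, hj⟩ : ∃ j : Fin 3, j ≠ i := exists_ne i
    have := congrFun h0 j
    rw [Function.update_of_ne hj] at this
    exact hg.ne j this
  have hedge : ∀ i, ∀ x ∈ closure K, pat n (f x) = Function.update s i 0 →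
      ∃ k, pat n' (f' (e x)) = Function.update s' k 0 := by
    intro i x hx hxi
    have hv : ¬ IsVertex f n x := by
      rintro ⟨a, b, hab, ha, hb⟩
      obtain ⟨l, hl, hli⟩ := exists_ne_mem_pair (k := i) hab
      refine hg.ne l ?_
      rw [← Function.update_of_ne hli 0 s, ← hxi]
      rcases hl with rfl | rfl <;> assumption
    refine h'.exists_edge (fun hv' => hv ((he.isVertex_iff h h').1 hv')) ?_ hg'
      (e.apply_mem_closure_image.2 hx)
    rw [he.net, h.net_eq]
    exact ⟨i, pat_eq_zero_iff.1 (by rw [hxi, Function.update_self])⟩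
  -- The image of an open edge is connected and avoids vertices, so it lies in a single open edge.
  have hpre : ∀ i, IsPreconnected ((fun v => e (g v)) '' {v | pat n v = Function.update s i 0}) :=
    fun i => (isPreconnected_setOf_pat_eq n (hupd i)).image _
      (e.continuous.comp_continuousOn (hg.cont.mono (IsFaceChart.edge_subset n s i)))
  have hex : ∀ i, ∃ k, ∀ x ∈ closure K, pat n (f x) = Function.update s i 0 →
      pat n' (f' (e x)) = Function.update s' k 0 := by
    intro i
    obtain ⟨v, hv⟩ := h.span.cell_nonempty (hupd i)
    have hmem : ∀ w, pat n w = Function.update s i 0 → ∃ k, pat n' (f' (e (g w))) =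
        Function.update s' k 0 := fun w hw =>
      hedge i _ (hg.mem_closure _ (IsFaceChart.edge_subset n s i hw)) (by
        rw [hg.right _ (IsFaceChart.edge_subset n s i hw), hw])
    obtain ⟨k, hk⟩ := hmem v hv
    refine ⟨k, fun x hx hxi => ?_⟩
    rw [← hk]
    refine pat_eq_of_isPreconnected h' (hpre i) hg'.ne ?_ ⟨f x, hxi, by simp only [hg.left x hx]⟩
      ⟨v, hv, rfl⟩
    rintro _ ⟨w, hw, rfl⟩
    exact hmem w hw
  choose k hk using hex
  refine ⟨k, hk, fun i x hx hxi => ?_⟩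
  -- A closed edge is the closure of the open one, so the vanishing extends to vertices.
  have hcl : f x ∈ closure {v | pat n v = Function.update s i 0} := by
    refine h.span.mem_closure_cell fun j hj => ?_
    have hji : j ≠ i := fun hji => hj (hji ▸ hxi)
    rw [Function.update_of_ne hji, hg.pat_eq_of_ne_zero hx hj]
  have hc : IsClosed {y | pat n' (f' y) (k i) = 0} := by
    simp_rw [pat_eq_zero_iff]
    exact isClosed_eq ((continuous_sphInner_right _).comp h'.dev.1) continuous_const
  have hcont : ContinuousWithinAt (fun v => e (g v)) {v | pat n v = Function.update s i 0} (f x) :=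
    (e.continuous.continuousAt.comp_continuousWithinAt (hg.cont (f x) (hg.maps x hx))).mono
      (IsFaceChart.edge_subset n s i)
  have := hcont.mem_closure hcl (t := {y | pat n' (f' y) (k i) = 0}) (fun v hv => by
    have hvc := IsFaceChart.edge_subset n s i hv
    have := hk i (g v) (hg.mem_closure v hvc) (by rw [hg.right v hvc]; exact hv)
    change pat n' (f' (e (g v))) (k i) = 0
    rw [this, Function.update_self])
  rw [hc.closure_eq, hg.left x hx] at this
  exact this

end IsNetHomeo

end Two

end MarkedSphericalRectangle

/-! ### One matching of signs for the whole net -/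

theorem SignType.mul_mul_self_cancel {a b : SignType} (hb : b ≠ 0) : a = a * b * b := by
  revert hb; cases a <;> cases b <;> decide

theorem SignType.mul_right_cancel {a b c : SignType} (hc : c ≠ 0) (h : a * c = b * c) : a = b := by
  revert hc h; cases a <;> cases b <;> cases c <;> decide

theorem SignType.eq_of_mul_eq_neg_mul_neg {a b c : SignType} (hc : c ≠ 0)
    (h : a * c = -(b * -c)) : a = b := by
  revert hc h; cases a <;> cases b <;> cases c <;> decide

namespace MarkedSphericalRectangle

variable {Q : Type*} [MetricSpace Q] {R : MarkedSphericalRectangle Q} {f : Q → UnitSphere}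

/-- The interior without finitely many points is connected. -/
theorem isPreconnected_interior_diff (R : MarkedSphericalRectangle Q) {V : Set Q} (hV : V.Finite) :
    IsPreconnected (R.boundaryᶜ \ V) := by
  -- The open disk is homeomorphic to the plane, where the complement of a countable set is
  -- connected.
  set b := OpenPartialHomeomorph.univBall (0 : ℂ) 1 with hb
  have hbt : b.target = Metric.ball 0 1 := OpenPartialHomeomorph.univBall_target 0 one_pos
  have hbs : b.source = univ := OpenPartialHomeomorph.univBall_source 0 1
  have hlt : ∀ z, ‖b z‖ < 1 := fun z => by
    have := b.map_source (show z ∈ b.source by rw [hbs]; trivial)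
    rwa [hbt, mem_ball_zero_iff] at this
  let F : ℂ → Q := fun z => R.chart.symm ⟨b z, by
    rw [mem_closedBall_zero_iff]; exact (hlt z).le⟩
  have hFc : ∀ z, (R.chart (F z) : ℂ) = b z := fun z => by simp [F]
  have hF : Continuous F := R.chart.symm.continuous.comp
    ((OpenPartialHomeomorph.continuous_univBall (0 : ℂ) 1).subtype_mk _)
  have hinj : Function.Injective F := by
    intro z w hzw
    have h1 : b z = b w := by rw [← hFc, ← hFc, hzw]
    exact b.injOn (by rw [hbs]; trivial) (by rw [hbs]; trivial) h1
  have himg : R.boundaryᶜ \ V = F '' (F ⁻¹' V)ᶜ := by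
    ext x
    constructor
    · rintro ⟨hx, hxV⟩
      have hx' : (R.chart x : ℂ) ∈ b.target := by
        rw [hbt, mem_ball_zero_iff]; exact R.notMem_boundary.1 hx
      have : F (b.symm (R.chart x)) = x := R.chart_injective (by rw [hFc, b.right_inv hx'])
      exact ⟨b.symm (R.chart x), by rw [mem_compl_iff, mem_preimage, this]; exact hxV, this⟩
    · rintro ⟨z, hz, rfl⟩
      exact ⟨R.notMem_boundary.2 (by rw [hFc]; exact hlt z), hz⟩
  rw [himg]
  refine IsPreconnected.image ?_ F hF.continuousOn
  exact ((hV.preimage hinj.injOn).countable.isConnected_compl_of_one_lt_rank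
    (by rw [Complex.rank_real_complex]; norm_num)).isPreconnected

variable {Q' : Type*} [MetricSpace Q'] {R' : MarkedSphericalRectangle Q'} {f' : Q' → UnitSphere}

/-- On the closed face `K`, the signs of `f' ∘ e` are obtained from those of `f` by a permutation
and sign changes. -/
def IsMatch (f : Q → UnitSphere) (f' : Q' → UnitSphere) (n n' : Fin 3 → UnitSphere) (e : Q ≃ₜ Q')
    (K : Set Q) (σ : Equiv.Perm (Fin 3)) (ε : Fin 3 → SignType) : Prop :=
  ∀ x ∈ closure K, ∀ i, pat n' (f' (e x)) (σ i) = ε i * pat n (f x) i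

namespace IsNetHomeo

variable {e : Q ≃ₜ Q'} (he : IsNetHomeo R f R' f' e)
variable {n n' : Fin 3 → UnitSphere} {c c' : Fin 4 → Fin 3} (h : R.IsNetFrame f n c)
  (h' : R'.IsNetFrame f' n' c')
include he h h'

/-- The edge map of `e.symm` inverts that of `e`, so `k` is a permutation. On a closed face every
sign is zero or that of the face, whence the sign changes are quotients of the two face patterns. -/
theorem exists_isMatch {K : Set Q} (hK : R.IsFace f K) : ∃ σ ε, IsMatch f f' n n' e K σ ε := by
  obtain ⟨s, g, hg⟩ := h.exists_chart_of_isFace hK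
  obtain ⟨s', g', hg'⟩ := h'.exists_chart_of_isFace (he.isFace hK)
  obtain ⟨k, hk1, hk2⟩ := he.exists_edge_map h h' hg hg'
  have hKK : e.symm '' (e '' K) = K := by
    rw [← image_comp, e.symm_comp_self, image_id]
  obtain ⟨k', hk1', hk2'⟩ := he.symm.exists_edge_map h' h hg' (by rw [hKK]; exact hg)
  have hinv : ∀ i, k' (k i) = i := by
    intro i
    have h0 : Function.update s i 0 ≠ 0 := fun h0 => by
      obtain ⟨j, hj⟩ : ∃ j : Fin 3, j ≠ i := exists_ne i
      have := congrFun h0 j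
      rw [Function.update_of_ne hj] at this
      exact hg.ne j this
    obtain ⟨v, hv⟩ := h.span.cell_nonempty h0
    have hvc := IsFaceChart.edge_subset n s i hv
    have hx := hg.mem_closure v hvc
    have h1 : pat n (f (g v)) = Function.update s i 0 := by rw [hg.right v hvc, hv]
    have h2 := hk1' (k i) _ (e.apply_mem_closure_image.2 hx) (hk1 i _ hx h1)
    rw [e.symm_apply_apply, h1] at h2
    by_contra hne
    have h3 := congrFun h2 i
    rw [Function.update_self, Function.update_of_ne (Ne.symm hne)] at h3
    exact hg.ne i h3.symm
  have hinj : Function.Injective k := Function.LeftInverse.injective hinv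
  refine ⟨Equiv.ofBijective k (Finite.injective_iff_bijective.1 hinj), fun i => s' (k i) * s i,
    fun x hx i => ?_⟩
  change pat n' (f' (e x)) (k i) = s' (k i) * s i * pat n (f x) i
  by_cases h0 : pat n (f x) i = 0
  · rw [hk2 i x hx h0, h0, mul_zero]
  · have h1 : pat n' (f' (e x)) (k i) ≠ 0 := fun h1 => h0 (by
      have := hk2' (k i) (e x) (e.apply_mem_closure_image.2 hx) h1
      rwa [hinv, e.symm_apply_apply] at this)
    rw [hg'.pat_eq_of_ne_zero (e.apply_mem_closure_image.2 hx) h1, hg.pat_eq_of_ne_zero hx h0]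
    exact SignType.mul_mul_self_cancel (hg.ne i)

omit he h h' in
theorem _root_.MarkedSphericalRectangle.IsMatch.sign_eq {K : Set Q} {σ : Equiv.Perm (Fin 3)}
    {ε : Fin 3 → SignType} {s s' : Fin 3 → SignType} {g : UnitSphere → Q} {g' : UnitSphere → Q'}
    (hm : IsMatch f f' n n' e K σ ε) (hK : R.IsFace f K) (hg : IsFaceChart f n K s g)
    (hg' : IsFaceChart f' n' (e '' K) s' g') (i : Fin 3) : s' (σ i) = ε i * s i := by
  obtain ⟨y, hy⟩ := hK.nonempty
  rw [← hg.pat_of_mem hy, ← hg'.pat_of_mem (mem_image_of_mem e hy)]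
  exact hm y (subset_closure hy) i

omit he h' in
/-- Face charts of two faces with a common edge agree on the closed edge. -/
theorem _root_.MarkedSphericalRectangle.IsNetFrame.charts_eq {K₁ K₂ : Set Q}
    {s₁ s₂ : Fin 3 → SignType} {g₁ g₂ : UnitSphere → Q} (c1 : IsFaceChart f n K₁ s₁ g₁)
    (c2 : IsFaceChart f n K₂ s₂ g₂) {x : Q} (hx : ¬ IsVertex f n x) (m1 : x ∈ closure K₁)
    (m2 : x ∈ closure K₂) {v : UnitSphere} (hv : v ∈ closure {v | pat n v = pat n (f x)}) :
    g₁ v = g₂ v := by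
  have hsub : ∀ {K : Set Q} {s : Fin 3 → SignType} {g : UnitSphere → Q}, IsFaceChart f n K s g →
      x ∈ closure K → {v | pat n v = pat n (f x)} ⊆ closedCell n s := by
    intro K s g hg hxK v hv i
    have hv' : pat n v = pat n (f x) := hv
    rw [hv']
    exact hg.maps x hxK i
  have hS := isPreconnected_setOf_pat_eq n (h.span.pat_ne_zero (f x))
  have heq : EqOn g₁ g₂ {v | pat n v = pat n (f x)} := by
    refine eqOn_of_lift (p := f) hS (c1.cont.mono (hsub c1 m1)) (c2.cont.mono (hsub c2 m2))
      (fun v hv => by rw [c1.right v (hsub c1 m1 hv), c2.right v (hsub c2 m2 hv)]) (fun v hv => ?_)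
      (show f x ∈ {v | pat n v = pat n (f x)} from rfl) (by rw [c1.left x m1, c2.left x m2])
    have hnv : ¬ IsVertex f n (g₁ v) := by
      have hv' : pat n v = pat n (f x) := hv
      rw [IsVertex, c1.right v (hsub c1 m1 hv), hv']
      exact hx
    obtain ⟨r, H, hr⟩ := R.exists_capChart h.dev (h.notMem_corner hnv)
    exact ⟨_, Metric.ball_mem_nhds _ hr.pos, hr.injOn⟩
  have h1 := closure_minimal (hsub c1 m1) (isClosed_closedCell n s₁)
  have h2 := closure_minimal (hsub c2 m2) (isClosed_closedCell n s₂)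
  exact heq.of_subset_closure (c1.cont.mono h1) (c2.cont.mono h2) subset_closure subset_rfl hv

/-- The faces lie on opposite sides of one circle `i`, their images on opposite sides of one circle
`i'`, so both matchings send `i` to `i'`. The other values of the permutations are compared at an
end of the common edge; the signs are compared through opposition at `i` and at the point `x`
elsewhere. -/
theorem isMatch_unique {K₁ K₂ : Set Q} (f1 : R.IsFace f K₁) (f2 : R.IsFace f K₂) (hne : K₁ ≠ K₂)
    {x : Q} (hx : ¬ IsVertex f n x) (m1 : x ∈ closure K₁) (m2 : x ∈ closure K₂)
    {σ₁ σ₂ : Equiv.Perm (Fin 3)} {ε₁ ε₂ : Fin 3 → SignType} (h1 : IsMatch f f' n n' e K₁ σ₁ ε₁)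
    (h2 : IsMatch f f' n n' e K₂ σ₂ ε₂) : σ₁ = σ₂ ∧ ε₁ = ε₂ := by
  obtain ⟨s₁, g₁, c1⟩ := h.exists_chart_of_isFace f1
  obtain ⟨s₂, g₂, c2⟩ := h.exists_chart_of_isFace f2
  obtain ⟨s₁', g₁', c1'⟩ := h'.exists_chart_of_isFace (he.isFace f1)
  obtain ⟨s₂', g₂', c2'⟩ := h'.exists_chart_of_isFace (he.isFace f2)
  have hx' : ¬ IsVertex f' n' (e x) := fun hv => hx ((he.isVertex_iff h h').1 hv)
  obtain ⟨i, hi, e1, hij⟩ := h.exists_opposite hx f1 f2 c1 c2 m1 m2 hne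
  obtain ⟨i', hi', e1', hij'⟩ := h'.exists_opposite hx' (he.isFace f1) (he.isFace f2) c1' c2'
    (e.apply_mem_closure_image.2 m1) (e.apply_mem_closure_image.2 m2) (e.injective.image_injective.ne hne)
  have hi1 : σ₁ i = i' := by_contra fun hne => hij' _ hne (by rw [h1 x m1, hi, mul_zero])
  have hi2 : σ₂ i = i' := by_contra fun hne => hij' _ hne (by rw [h2 x m2, hi, mul_zero])
  have hε1 : ∀ j, ε₁ j ≠ 0 := fun j h0 => c1'.ne (σ₁ j) (by rw [h1.sign_eq f1 c1 c1', h0, zero_mul])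
  have hσ : σ₁ = σ₂ := by
    ext1 j
    by_cases hj : j = i
    · rw [hj, hi1, hi2]
    have hp : Function.update (pat n (f x)) j 0 ≠ 0 := by
      intro h0
      obtain ⟨k, hkj, hki⟩ : ∃ k, k ≠ j ∧ k ≠ i := by
        revert hj; clear * -; revert i j; decide
      have := congrFun h0 k
      rw [Function.update_of_ne hkj] at this
      exact hij k hki this
    -- `v` is the end of the common edge on the circle `j`.
    obtain ⟨v, hv⟩ := h.span.cell_nonempty hp
    have hvcl : v ∈ closure {v | pat n v = pat n (f x)} := by
      refine h.span.mem_closure_cell fun k hk => ?_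
      rw [hv] at hk ⊢
      by_cases hkj : k = j
      · rw [hkj, Function.update_self] at hk; exact absurd rfl hk
      · rw [Function.update_of_ne hkj]
    have hvc : ∀ {K : Set Q} {s : Fin 3 → SignType} {g : UnitSphere → Q}, IsFaceChart f n K s g →
        x ∈ closure K → v ∈ closedCell n s := by
      intro K s g hg hxK k
      rw [hv]
      by_cases hkj : k = j
      · rw [hkj, Function.update_self]; exact .inl rfl
      · rw [Function.update_of_ne hkj]; exact hg.maps x hxK k
    have hg12 := h.charts_eq c1 c2 hx m1 m2 hvcl
    have hy1 := c1.mem_closure v (hvc c1 m1)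
    have hy2 := c2.mem_closure v (hvc c2 m2)
    rw [← hg12] at hy2
    have hfy : f (g₁ v) = v := c1.right v (hvc c1 m1)
    have h3 := h2 _ hy2 j
    rw [hfy, hv, Function.update_self, mul_zero] at h3
    have h4 := h1 _ hy1 (σ₁.symm (σ₂ j))
    rw [σ₁.apply_symm_apply, h3, hfy, hv] at h4
    have h5 : σ₁.symm (σ₂ j) = j := by
      by_contra hne5
      rw [Function.update_of_ne hne5] at h4
      have h6 : σ₁.symm (σ₂ j) ≠ i := by
        intro h6
        rw [Equiv.symm_apply_eq, hi1, ← hi2] at h6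
        exact hj (σ₂.injective h6)
      exact mul_ne_zero (hε1 _) (hij _ h6) h4.symm
    rw [Equiv.symm_apply_eq] at h5
    exact h5.symm
  refine ⟨hσ, funext fun j => ?_⟩
  subst hσ
  by_cases hj : j = i
  · subst hj
    have a1 := h1.sign_eq f1 c1 c1' j
    have a2 := h2.sign_eq f2 c2 c2' j
    rw [hi1] at a1
    rw [hi1] at a2
    rw [a1, a2, e1] at e1'
    refine SignType.eq_of_mul_eq_neg_mul_neg (c := -s₂ j) ?_ (by rw [neg_neg]; exact e1')
    have := c2.ne j
    revert this
    cases s₂ j <;> decide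
  · have a1 := h1 x m1 j
    rw [h2 x m2 j] at a1
    exact (SignType.mul_right_cancel (hij j hj) a1).symm

/-- The signs of `f' ∘ e` are obtained from those of `f` by a permutation and sign changes. -/
theorem exists_match : ∃ (σ : Equiv.Perm (Fin 3)) (ε : Fin 3 → SignType), (∀ i, ε i ≠ 0) ∧
    ∀ x i, pat n' (f' (e x)) (σ i) = ε i * pat n (f x) i := by
  have hex : ∀ K, ∃ d : Equiv.Perm (Fin 3) × (Fin 3 → SignType), R.IsFace f K →
      IsMatch f f' n n' e K d.1 d.2 := by
    intro K
    by_cases hK : R.IsFace f K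
    · obtain ⟨σ, ε, hm⟩ := he.exists_isMatch h h' hK
      exact ⟨(σ, ε), fun _ => hm⟩
    · exact ⟨(1, 0), fun h => absurd h hK⟩
  choose d hd using hex
  -- At a point of `W` all faces around it have the same matching; `W` is connected and meets every
  -- closed face.
  set W := R.boundaryᶜ \ {x | IsVertex f n x} with hW
  have hWc : IsPreconnected W := R.isPreconnected_interior_diff h.finite_setOf_isVertex
  have hWf : ∀ K, R.IsFace f K → ∃ x ∈ W, x ∈ closure K := by
    rintro K ⟨y, hy, rfl⟩
    exact ⟨y, ⟨fun hb => hy (h.boundary_subset_net hb), fun hv => hy (h.isVertex_mem_net hv)⟩,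
      subset_closure (mem_connectedComponentIn hy)⟩
  have hloc : ∀ x ∈ W, ∀ K₁ K₂, R.IsFace f K₁ → R.IsFace f K₂ → x ∈ closure K₁ → x ∈ closure K₂ →
      d K₁ = d K₂ := by
    intro x hx K₁ K₂ f1 f2 m1 m2
    by_cases hne : K₁ = K₂
    · rw [hne]
    · have := he.isMatch_unique h h' f1 f2 hne hx.2 m1 m2 (hd K₁ f1) (hd K₂ f2)
      exact Prod.ext this.1 this.2
  have hall : ∀ K₁ K₂, R.IsFace f K₁ → R.IsFace f K₂ → d K₁ = d K₂ := by
    intro K₁ K₂ f1 f2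
    obtain ⟨x₁, w1, m1⟩ := hWf K₁ f1
    obtain ⟨x₂, w2, m2⟩ := hWf K₂ f2
    refine hWc.induction₂ (fun a b => ∀ K₁ K₂, R.IsFace f K₁ → R.IsFace f K₂ → a ∈ closure K₁ →
      b ∈ closure K₂ → d K₁ = d K₂) (fun a ha => ?_) ?_ ?_ w1 w2 K₁ K₂ f1 f2 m1 m2
    -- The finitely many closed faces that miss `a` stay away from it, so faces near `a` have `a` in
    -- their closure.
    · have hcl : IsClosed (⋃ K ∈ {K | R.IsFace f K ∧ a ∉ closure K}, closure K) :=
        (h.finite_setOf_isFace.subset fun K hK => hK.1).isClosed_biUnion fun K _ => isClosed_closure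
      have ha' : a ∈ (⋃ K ∈ {K | R.IsFace f K ∧ a ∉ closure K}, closure K)ᶜ := by
        intro hmem
        simp only [mem_iUnion] at hmem
        obtain ⟨K, hK, haK⟩ := hmem
        exact hK.2 haK
      filter_upwards [nhdsWithin_le_nhds (hcl.isOpen_compl.mem_nhds ha')] with b hb K₁ K₂ f1 f2 m1 m2
      refine hloc a ha K₁ K₂ f1 f2 m1 (by_contra fun hna => hb ?_)
      exact mem_biUnion (show K₂ ∈ {K | R.IsFace f K ∧ a ∉ closure K} from ⟨f2, hna⟩) m2
    · intro a b c _ hb _ hab hbc K₁ K₂ f1 f2 m1 m2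
      obtain ⟨K, fK, mK⟩ := h.exists_mem_closure_face b
      exact (hab K₁ K f1 fK m1 mK).trans (hbc K K₂ fK f2 mK m2)
    · intro a b _ _ hab K₁ K₂ f1 f2 m1 m2
      exact (hab K₂ K₁ f2 f1 m2 m1).symm
  obtain ⟨K₀, f0, -⟩ := h.exists_mem_closure_face (R.corner 0)
  refine ⟨(d K₀).1, (d K₀).2, fun i hi => ?_, fun x i => ?_⟩
  · obtain ⟨s₁, g₁, c1⟩ := h.exists_chart_of_isFace f0
    obtain ⟨s₁', g₁', c1'⟩ := h'.exists_chart_of_isFace (he.isFace f0)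
    have := (hd K₀ f0).sign_eq f0 c1 c1' i
    rw [hi, zero_mul] at this
    exact c1'.ne _ this
  · obtain ⟨K, fK, mK⟩ := h.exists_mem_closure_face x
    rw [hall K₀ K f0 fK]
    exact hd K fK x mK i

end IsNetHomeo

end MarkedSphericalRectangle

/-! ### Diagonals and the isometry between the configurations of circles -/

theorem fin4_add_two_add_two : ∀ j : Fin 4, j + 2 + 2 = j := by decide

theorem fin4_add_three_add_two : ∀ j : Fin 4, j + 3 + 2 = j + 1 := by decide

theorem fin4_side_of_corner : ∀ t j : Fin 4, ∃ l, (l = j ∨ l = j + 2) ∧ (l = t ∨ l = t + 1) := by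
  decide

namespace MarkedSphericalRectangle

variable {Q : Type*} [MetricSpace Q] {R : MarkedSphericalRectangle Q} {f : Q → UnitSphere}

theorem eq_or_eq_of_mem_boundary {x y : Q} (γ : Path x y) (hγ : γ '' Ioo 0 1 ⊆ R.boundaryᶜ)
    {t : unitInterval} (ht : γ t ∈ R.boundary) : γ t = x ∨ γ t = y := by
  by_cases h0 : t = 0
  · left; rw [h0, γ.source]
  by_cases h1 : t = 1
  · right; rw [h1, γ.target]
  · exact absurd ht (hγ ⟨t, ⟨unitInterval.pos_iff_ne_zero.2 h0, unitInterval.lt_one_iff_ne_one.2 h1⟩, rfl⟩)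

/-- Paths connecting the two pairs of opposite corners meet. -/
theorem exists_eq_of_diagonals (R : MarkedSphericalRectangle Q) {j : Fin 4}
    (γ : Path (R.corner j) (R.corner (j + 2))) (δ : Path (R.corner (j + 1)) (R.corner (j + 3))) :
    ∃ s t, γ s = δ t := by
  have hj := R.ccw_corner_succ j
  have hj' := R.ccw_corner_succ (j + 2)
  rw [fin4_add_two_add_one, fin4_add_two_add_two] at hj'
  obtain ⟨s, t, hst⟩ := exists_eq_of_interleaved (α := fun s => (R.chart (γ.extend s) : ℂ))
    (β := fun s => (R.chart (δ.extend s) : ℂ)) (R.continuous_chart.comp γ.continuous_extend)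
    (R.continuous_chart.comp δ.continuous_extend) (fun s => R.norm_chart_le _)
    (fun s => R.norm_chart_le _) (by simpa using R.corner_mem _) (by simpa using R.corner_mem _)
    (by simpa using R.corner_mem _) (by simpa using R.corner_mem _) (by simpa using hj)
    (by simpa using hj')
  exact ⟨_, _, R.chart_injective hst⟩

namespace IsNetFrame

variable {n : Fin 3 → UnitSphere} {c : Fin 4 → Fin 3} (h : R.IsNetFrame f n c)
include h

/-- Four sides lie on three circles, and adjacent sides on different ones, so the coincidence is
between opposite sides. -/
theorem exists_double : ∃ k, c k = c (k + 2) := by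
  have hni : ¬ Function.Injective c := fun hi => by
    have := Fintype.card_le_of_injective c hi
    simp at this
  simp only [Function.Injective, not_forall] at hni
  obtain ⟨a, b, hab, hne⟩ := hni
  refine ⟨a, ?_⟩
  rcases fin4_exhaust a b with rfl | rfl | rfl | rfl
  · exact absurd rfl hne
  · exact hab
  · exact absurd hab (h.adj a)
  · have := h.adj (a + 3)
    rw [fin4_add_three] at this
    exact absurd hab.symm this

variable {k : Fin 4} (hk : c k = c (k + 2))
include hk

/-- The double circle passes through the images of all corners. -/
theorem double_corner (j : Fin 4) : sphInner (n (c k)) (f (R.corner j)) = 0 := by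
  rcases fin4_exhaust k j with rfl | rfl | rfl | rfl
  · exact h.corner_left _
  · rw [hk]; exact h.corner_left _
  · exact h.corner_right _
  · have := h.corner_right (k + 2)
    rwa [fin4_add_two_add_one, ← hk] at this

theorem double_perp {t : Fin 4} (ht : c t ≠ c k) : sphInner (n (c k)) (n (c t)) = 0 := by
  rcases fin4_exhaust k t with rfl | rfl | rfl | rfl
  · exact absurd rfl ht
  · exact absurd hk.symm ht
  · exact h.perp _
  · have := h.perp (k + 2)
    rwa [fin4_add_two_add_one, ← hk] at this

/-- The arcs which define the angle lie on the double circle. -/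
theorem exists_diagonal {θ : ℝ} (hθ : θ ∈ Ioo (0 : ℝ) 1) (hR : R.HasAngle f θ) :
    ∃ (j : Fin 4) (γ : Path (R.corner j) (R.corner (j + 2))) (x : Q),
      sphInner (f (R.corner j)) (f (R.corner (j + 2))) = Real.cos (Real.pi * (1 - θ)) ∧
      x ∈ {x | pat n (f x) (c k) = 0} \ R.boundary ∧
      γ '' Ioo 0 1 = connectedComponentIn ({x | pat n (f x) (c k) = 0} \ R.boundary) x := by
  obtain ⟨j, γ, m, x, -, hcos, hm, hx, himg⟩ := hR.exists_path R h.dev hθ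
  have hpi := Real.pi_pos
  have hsin : 0 < Real.sin (Real.pi * (1 - θ)) :=
    Real.sin_pos_of_pos_of_lt_pi (by nlinarith [hθ.2]) (by nlinarith [hθ.1])
  have hsq := Real.sin_sq_add_cos_sq (Real.pi * (1 - θ))
  have h0 := hm 0
  have h1 := hm 1
  rw [γ.source] at h0
  rw [γ.target] at h1
  have hmn : m = n (c k) ∨ m = -n (c k) := by
    refine eq_or_eq_neg_of_orthogonal (u := f (R.corner j)) (v := f (R.corner (j + 2))) ?_ ?_ h0 h1
      (h.double_corner hk j) (h.double_corner hk (j + 2))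
    · intro heq
      rw [← heq, sphInner_self] at hcos
      rw [← hcos] at hsq
      nlinarith
    · intro heq
      rw [heq, sphInner_neg_left, sphInner_self] at hcos
      rw [← hcos] at hsq
      nlinarith
  have hset : f ⁻¹' {v | sphInner m v = 0} = {x | pat n (f x) (c k) = 0} := by
    ext y
    change sphInner m (f y) = 0 ↔ pat n (f y) (c k) = 0
    rw [pat_eq_zero_iff]
    rcases hmn with h | h <;> rw [h]
    rw [sphInner_neg_left, neg_eq_zero]
  rw [hset] at hx himg
  exact ⟨j, γ, x, hcos, hx, himg⟩

end IsNetFrame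

theorem _root_.Spanning.eq_of_eq_or_eq_neg {n : Fin 3 → UnitSphere}
    (hn : Spanning (range fun i => (n i : Space3))) {i j : Fin 3} (hij : n i = n j ∨ n i = -n j) :
    i = j := by
  by_contra hne
  obtain ⟨w, hw⟩ := hn.exists_inner_eq (Function.update 0 i 1)
  have h1 := hw i
  have h2 := hw j
  rw [Function.update_self] at h1
  rw [Function.update_of_ne (Ne.symm hne)] at h2
  rcases hij with h | h
  · rw [h, h2] at h1; simp at h1
  · have h3 : (n i : Space3) = -(n j : Space3) := by rw [h]; rfl
    rw [h3, inner_neg_left, h2] at h1; simp at h1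

variable {Q' : Type*} [MetricSpace Q'] {R' : MarkedSphericalRectangle Q'} {f' : Q' → UnitSphere}

namespace IsNetHomeo

variable {e : Q ≃ₜ Q'} (he : IsNetHomeo R f R' f' e)
variable {n n' : Fin 3 → UnitSphere} {c c' : Fin 4 → Fin 3} (h : R.IsNetFrame f n c)
  (h' : R'.IsNetFrame f' n' c') {σ : Equiv.Perm (Fin 3)} {ε : Fin 3 → SignType} (hε : ∀ i, ε i ≠ 0)
  (hσ : ∀ x i, pat n' (f' (e x)) (σ i) = ε i * pat n (f x) i)

include h h' hσ in
-- The circle `σ (c j)` contains the image of the side `j` of the second rectangle, and a side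
-- determines its circle.
theorem label_eq (hside : ∀ j, e '' R.side j = R'.side j) (j : Fin 4) : c' j = σ (c j) := by
  refine h'.span.eq_of_eq_or_eq_neg ?_
  have := R'.eq_or_eq_neg_of_side_zero (m := n' (σ (c j))) (h'.normal j) fun y hy => by
    rw [← hside] at hy
    obtain ⟨x, hx, rfl⟩ := hy
    rw [← pat_eq_zero_iff, hσ, pat_eq_zero_iff.2 (h.zero j x hx), mul_zero]
  rcases this with h | h
  · exact .inl h.symm
  · right; rw [h, neg_neg]

include he h h' hε hσ in
/-- The arcs which define the angles of two rectangles with equivalent nets connect corresponding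
pairs of corners. -/
theorem exists_diagonal (hc : ∀ j, c' j = σ (c j)) {θ : ℝ} (hθ : θ ∈ Ioo (0 : ℝ) 1)
    (hR : R.HasAngle f θ) (hR' : R'.HasAngle f' θ) : ∃ j,
      sphInner (f (R.corner j)) (f (R.corner (j + 2))) = Real.cos (Real.pi * (1 - θ)) ∧
      sphInner (f' (R'.corner j)) (f' (R'.corner (j + 2))) = Real.cos (Real.pi * (1 - θ)) := by
  obtain ⟨k, hk⟩ := h.exists_double
  have hk' : c' k = c' (k + 2) := by rw [hc, hc, hk]
  obtain ⟨j, γ, x, hcos, hx, himg⟩ := h.exists_diagonal hk hθ hR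
  obtain ⟨j', γ', x', hcos', hx', himg'⟩ := h'.exists_diagonal hk' hθ hR'
  set D := {x | pat n (f x) (c k) = 0} \ R.boundary
  set D' := {x | pat n' (f' x) (c' k) = 0} \ R'.boundary
  have hDD : e '' D = D' := by
    ext y
    obtain ⟨y, rfl⟩ := e.surjective y
    rw [e.injective.mem_set_image]
    change pat n (f y) (c k) = 0 ∧ y ∉ R.boundary ↔ pat n' (f' (e y)) (c' k) = 0 ∧ e y ∉ R'.boundary
    rw [he.boundary, hc, hσ, mul_eq_zero, or_iff_right (hε _)]
  have hcomp : e '' (γ '' Ioo 0 1) = connectedComponentIn D' (e x) := by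
    rw [himg, e.image_connectedComponentIn hx, hDD]
  have hγb : γ '' Ioo 0 1 ⊆ R.boundaryᶜ := by
    rw [himg]; exact (connectedComponentIn_subset _ _).trans fun y hy => hy.2
  have hγb' : γ' '' Ioo 0 1 ⊆ R'.boundaryᶜ := by
    rw [himg']; exact (connectedComponentIn_subset _ _).trans fun y hy => hy.2
  let δ : Path (R'.corner j) (R'.corner (j + 2)) :=
    (γ.map e.continuous).cast (he.corner j).symm (he.corner (j + 2)).symm
  have hδ : ∀ t, δ t = e (γ t) := fun t => rfl
  -- Arcs meeting in the interior are the same component of `D'`, so their closures contain the same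
  -- corners; on the boundary they could meet only at common ends.
  have key : ∀ s t, δ s = γ' t → j ≠ j' → j ≠ j' + 2 → False := by
    intro s t hst hj hj2
    have hend : ∀ t, γ' t ≠ R'.corner j := by
      intro t ht
      rcases eq_or_eq_of_mem_boundary γ' hγb' (t := t) (by rw [ht]; exact R'.corner_mem_boundary j)
        with h1 | h1 <;> rw [ht] at h1
      · exact hj (R'.corner_injective h1)
      · exact hj2 (R'.corner_injective h1)
    by_cases hb : γ' t ∈ R'.boundary
    · have hs : γ s ∈ R.boundary := by rwa [← he.boundary, ← hδ, hst]
      rcases eq_or_eq_of_mem_boundary γ hγb hs with h1 | h1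
      · rw [hδ, h1, he.corner] at hst
        exact hend t hst.symm
      · rw [hδ, h1, he.corner] at hst
        rcases eq_or_eq_of_mem_boundary γ' hγb' hb with h2 | h2 <;> rw [← hst] at h2
        · exact hj2 (by rw [← R'.corner_injective h2, fin4_add_two_add_two])
        · exact hj (add_right_cancel (R'.corner_injective h2))
    · have hs : s ∈ Ioo 0 1 := by
        refine ⟨unitInterval.pos_iff_ne_zero.2 ?_, unitInterval.lt_one_iff_ne_one.2 ?_⟩
        · rintro rfl
          exact hb (by rw [← hst, δ.source]; exact R'.corner_mem_boundary _)
        · rintro rfl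
          exact hb (by rw [← hst, δ.target]; exact R'.corner_mem_boundary _)
      have ht : t ∈ Ioo 0 1 := by
        refine ⟨unitInterval.pos_iff_ne_zero.2 ?_, unitInterval.lt_one_iff_ne_one.2 ?_⟩
        · rintro rfl
          exact hb (by rw [γ'.source]; exact R'.corner_mem_boundary _)
        · rintro rfl
          exact hb (by rw [γ'.target]; exact R'.corner_mem_boundary _)
      have m1 : γ' t ∈ connectedComponentIn D' (e x) := by
        rw [← hcomp, ← hst]; exact ⟨γ s, ⟨s, hs, rfl⟩, rfl⟩
      have m2 : γ' t ∈ connectedComponentIn D' x' := by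
        rw [← himg']; exact ⟨t, ht, rfl⟩
      have heq : e '' (γ '' Ioo 0 1) = γ' '' Ioo 0 1 := by
        rw [hcomp, himg', connectedComponentIn_eq m1, connectedComponentIn_eq m2]
      have hcl : R'.corner j ∈ closure (γ' '' Ioo 0 1) := by
        rw [← heq, ← he.corner, e.apply_mem_closure_image]
        have h0 : γ 0 ∈ closure (γ '' Ioo 0 1) := mem_closure_image γ.continuous.continuousAt (by
          rw [closure_Ioo zero_ne_one]
          exact ⟨le_rfl, zero_le_one⟩)
        rwa [γ.source] at h0
      have hcl' : closure (γ' '' Ioo 0 1) ⊆ range γ' :=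
        closure_minimal (image_subset_range _ _) (isCompact_range γ'.continuous).isClosed
      obtain ⟨t, ht⟩ := hcl' hcl
      exact hend t ht
  -- In the last two cases the arcs join different pairs of opposite corners and must cross.
  rcases fin4_exhaust j j' with rfl | rfl | rfl | rfl
  · exact ⟨_, hcos, hcos'⟩
  · rw [fin4_add_two_add_two, sphInner_comm] at hcos'
    exact ⟨_, hcos, hcos'⟩
  · exfalso
    obtain ⟨s, t, hst⟩ := R'.exists_eq_of_diagonals δ (γ'.cast rfl (by rw [fin4_add_one_add_two]))
    refine key s t hst ?_ ?_ <;> clear * - <;> revert j <;> decide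
  · exfalso
    obtain ⟨s, t, hst⟩ := R'.exists_eq_of_diagonals δ
      (γ'.symm.cast (by rw [fin4_add_three_add_two]) rfl)
    refine key s (unitInterval.symm t) hst ?_ ?_ <;> clear * - <;> revert j <;> decide

include he h h' hε hσ in
/-- The nets are related by an isometry of the sphere. -/
theorem exists_isometry (hc : ∀ j, c' j = σ (c j)) {θ : ℝ} (hθ : θ ∈ Ioo (0 : ℝ) 1)
    (hR : R.HasAngle f θ) (hR' : R'.HasAngle f' θ) : ∃ A : Space3 ≃ₗᵢ[ℝ] Space3,
      ∀ v i, pat n' (sphMap A v) (σ i) = ε i * pat n v i := by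
  obtain ⟨k, hk⟩ := h.exists_double
  have hk' : c' k = c' (k + 2) := by rw [hc, hc, hk]
  obtain ⟨j, hcos, hcos'⟩ := he.exists_diagonal h h' hε hσ hc hθ hR hR'
  have hpi := Real.pi_pos
  have hsin : 0 < Real.sin (Real.pi * (1 - θ)) :=
    Real.sin_pos_of_pos_of_lt_pi (by nlinarith [hθ.2]) (by nlinarith [hθ.1])
  have hsq := Real.sin_sq_add_cos_sq (Real.pi * (1 - θ))
  set C := Real.cos (Real.pi * (1 - θ)) with hC
  have hC1 : C ≠ 1 := fun h1 => by rw [h1] at hsq; nlinarith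
  have hC2 : C ≠ -1 := fun h1 => by rw [h1] at hsq; nlinarith
  set u := f (R.corner j) with hu
  set v := f (R.corner (j + 2)) with hv
  set u' := f' (R'.corner j) with hu'
  set v' := f' (R'.corner (j + 2)) with hv'
  set m := n (c k) with hm
  -- The normal of the second double circle, oriented so as to correspond to `m`.
  obtain ⟨m', hm', hm's⟩ : ∃ m' : UnitSphere, (m' = n' (σ (c k)) ∨ m' = -n' (σ (c k))) ∧
      ∀ w, SignType.sign (sphInner m' w) = ε (c k) * pat n' w (σ (c k)) := by
    have h1 := hε (c k)
    rcases (ε (c k)).trichotomy with h2 | h2 | h2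
    · refine ⟨-n' (σ (c k)), .inr rfl, fun w => ?_⟩
      rw [h2, sphInner_neg_left, Left.sign_neg, neg_one_mul]; rfl
    · exact absurd h2 h1
    · refine ⟨n' (σ (c k)), .inl rfl, fun w => ?_⟩
      rw [h2, one_mul]; rfl
  have hmu : sphInner m u = 0 := h.double_corner hk j
  have hmv : sphInner m v = 0 := h.double_corner hk (j + 2)
  have hnu' : sphInner (n' (σ (c k))) u' = 0 := by rw [← hc]; exact h'.double_corner hk' j
  have hnv' : sphInner (n' (σ (c k))) v' = 0 := by rw [← hc]; exact h'.double_corner hk' (j + 2)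
  have hmu' : sphInner m' u' = 0 := by
    rcases hm' with h | h <;> rw [h]
    · exact hnu'
    · rw [sphInner_neg_left, hnu', neg_zero]
  have hmv' : sphInner m' v' = 0 := by
    rcases hm' with h | h <;> rw [h]
    · exact hnv'
    · rw [sphInner_neg_left, hnv', neg_zero]
  have huv : u ≠ v := by
    intro heq
    rw [← heq, sphInner_self] at hcos
    exact hC1 hcos.symm
  have huv' : u ≠ -v := by
    intro heq
    rw [heq, sphInner_neg_left, sphInner_self] at hcos
    exact hC2 hcos.symm
  have hspan : Spanning (range ![(u : Space3), v, m]) := by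
    intro w hw
    have h1 : inner ℝ w (u : Space3) = 0 := hw _ ⟨0, rfl⟩
    have h2 : inner ℝ w (v : Space3) = 0 := hw _ ⟨1, rfl⟩
    have h3 : inner ℝ w (m : Space3) = 0 := hw _ ⟨2, rfl⟩
    by_contra h0
    have hz : ∀ z : UnitSphere, inner ℝ w (z : Space3) = 0 → sphInner (sphNormalize w) z = 0 := by
      intro z hz
      rw [sphInner_comm, sphInner_sphNormalize z h0, real_inner_comm, hz, mul_zero]
    have h4 := hz m h3
    rcases eq_or_eq_neg_of_orthogonal huv huv' (hz u h1) (hz v h2) hmu hmv with h5 | h5 <;>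
      rw [h5] at h4
    · rw [sphInner_self] at h4; norm_num at h4
    · rw [sphInner_neg_left, sphInner_self] at h4; norm_num at h4
  -- The Gram matrices agree because the angles do and both double circles contain the images of the
  -- corners.
  obtain ⟨A, hA⟩ := exists_isometry_of_gram_eq (b := ![(u' : Space3), v', m']) hspan (by
    have e1 : inner ℝ (u : Space3) (v : Space3) = C := hcos
    have e2 : inner ℝ (u' : Space3) (v' : Space3) = C := hcos'
    have e3 : inner ℝ (m : Space3) (u : Space3) = 0 := hmu
    have e4 : inner ℝ (m : Space3) (v : Space3) = 0 := hmv
    have e5 : inner ℝ (m' : Space3) (u' : Space3) = 0 := hmu'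
    have e6 : inner ℝ (m' : Space3) (v' : Space3) = 0 := hmv'
    have e1' := (real_inner_comm (v : Space3) (u : Space3)).symm.trans e1
    have e2' := (real_inner_comm (v' : Space3) (u' : Space3)).symm.trans e2
    have e3' := (real_inner_comm (m : Space3) (u : Space3)).trans e3
    have e4' := (real_inner_comm (m : Space3) (v : Space3)).trans e4
    have e5' := (real_inner_comm (m' : Space3) (u' : Space3)).trans e5
    have e6' := (real_inner_comm (m' : Space3) (v' : Space3)).trans e6
    intro a b
    fin_cases a <;> fin_cases b <;>
      simp [e1, e2, e3, e4, e5, e6, e1', e2', e3', e4', e5', e6'])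
  have hAu : sphMap A u = u' := Subtype.ext (hA 0).symm
  have hAv : sphMap A v = v' := Subtype.ext (hA 1).symm
  have hAm : sphMap A m = m' := Subtype.ext (hA 2).symm
  refine ⟨A, fun w i => ?_⟩
  have hεε : ∀ a b : SignType, a ≠ 0 → b = a * (a * b) := by
    intro a b; cases a <;> cases b <;> decide
  by_cases hik : i = c k
  · subst hik
    have h1 := hm's (sphMap A w)
    rw [← hAm, sphInner_sphMap] at h1
    change pat n w (c k) = _ at h1
    rw [h1]
    exact hεε _ _ (hε _)
  obtain ⟨t, rfl⟩ := h.surj i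
  have hperp : sphInner m (n (c t)) = 0 := h.double_perp hk hik
  have hperp' : sphInner (n' (σ (c k))) (n' (σ (c t))) = 0 := by
    rw [← hc, ← hc]
    exact h'.double_perp hk' (by rw [hc, hc]; exact fun h0 => hik (σ.injective h0))
  have hperp'' : sphInner m' (n' (σ (c t))) = 0 := by
    rcases hm' with h | h <;> rw [h]
    · exact hperp'
    · rw [sphInner_neg_left, hperp', neg_zero]
  -- The side `t` has one end `p` of the diagonal among its corners, and its circle misses the other
  -- end `q`. So the circle is determined by `p` and perpendicularity to the double circle, and `q`
  -- decides the sign of its normal.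
  obtain ⟨p, q, p', q', hp, hp', hq, hAp, hAq, hmp, hpat⟩ : ∃ p q p' q' : UnitSphere,
      sphInner (n (c t)) p = 0 ∧ sphInner (n' (σ (c t))) p' = 0 ∧ sphInner (n (c t)) q ≠ 0 ∧
      sphMap A p = p' ∧ sphMap A q = q' ∧ sphInner m p = 0 ∧
      pat n' q' (σ (c t)) = ε (c t) * pat n q (c t) := by
    have hnz : sphInner (n (c t)) u = 0 → sphInner (n (c t)) v = 0 → False := by
      intro h1 h2
      rcases eq_or_eq_neg_of_orthogonal huv huv' hmu hmv h1 h2 with h5 | h5 <;> rw [h5] at hperp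
      · rw [sphInner_self] at hperp; norm_num at hperp
      · rw [sphInner_neg_left, sphInner_self] at hperp; norm_num at hperp
    have hcor : ∀ l, pat n' (f' (R'.corner l)) (σ (c t)) = ε (c t) * pat n (f (R.corner l)) (c t) := by
      intro l; rw [← he.corner]; exact hσ _ _
    obtain ⟨l, hl, hlt⟩ := fin4_side_of_corner t j
    have hl0 : sphInner (n (c t)) (f (R.corner l)) = 0 := by
      rcases hlt with rfl | rfl
      · exact h.corner_left _
      · exact h.corner_right _
    have hl0' : sphInner (n' (σ (c t))) (f' (R'.corner l)) = 0 := by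
      rw [← pat_eq_zero_iff, hcor, pat_eq_zero_iff.2 hl0, mul_zero]
    rcases hl with rfl | rfl
    · exact ⟨u, v, u', v', hl0, hl0', fun h1 => hnz hl0 h1, hAu, hAv, hmu, hcor _⟩
    · exact ⟨v, u, v', u', hl0, hl0', fun h1 => hnz h1 hl0, hAv, hAu, hmv, hcor _⟩
  have hmp' : sphInner m' p' = 0 := by rw [← hAm, ← hAp, sphInner_sphMap, hmp]
  have hw := eq_or_eq_neg_of_orthogonal (u := m') (v := p') (w := n' (σ (c t)))
    (w' := sphMap A (n (c t)))
    (fun h0 => by rw [h0, sphInner_self] at hmp'; norm_num at hmp')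
    (fun h0 => by rw [h0, sphInner_neg_left, sphInner_self] at hmp'; norm_num at hmp')
    (by rw [sphInner_comm]; exact hperp'') hp'
    (by rw [← hAm, sphInner_sphMap, sphInner_comm]; exact hperp)
    (by rw [← hAp, sphInner_sphMap]; exact hp)
  have hq0 : pat n q (c t) ≠ 0 := fun h0 => hq (pat_eq_zero_iff.1 h0)
  rcases hw with hw | hw
  · have h1 : ∀ w, pat n' (sphMap A w) (σ (c t)) = pat n w (c t) := fun w => by
      rw [pat, hw, sphInner_sphMap]; rfl
    have h2 : 1 = ε (c t) := SignType.mul_right_cancel hq0 (by rw [one_mul, ← hpat, ← hAq, h1])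
    rw [h1, ← h2, one_mul]
  · have h1 : ∀ w, pat n' (sphMap A w) (σ (c t)) = -1 * pat n w (c t) := fun w => by
      rw [pat, hw, sphInner_neg_left, sphInner_sphMap, Left.sign_neg, neg_one_mul]; rfl
    have h2 : -1 = ε (c t) := SignType.mul_right_cancel hq0 (by rw [← hpat, ← hAq, h1])
    rw [h1, ← h2]

end IsNetHomeo

end MarkedSphericalRectangle

/-! ### The congruence -/

namespace MarkedSphericalRectangle

variable {Q : Type*} [MetricSpace Q] {R : MarkedSphericalRectangle Q} {f : Q → UnitSphere}
variable {Q' : Type*} [MetricSpace Q'] {R' : MarkedSphericalRectangle Q'} {f' : Q' → UnitSphere}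

variable (R f f') in
/-- A continuous map which covers the isometry `A` and maps closed faces to the closed faces which
correspond to them under `e`. -/
structure IsTransfer (e : Q ≃ₜ Q') (A : Space3 ≃ₗᵢ[ℝ] Space3) (φ : Q → Q') : Prop where
  cont : Continuous φ
  dev : ∀ x, f' (φ x) = sphMap A (f x)
  face : ∀ x K, R.IsFace f K → x ∈ closure K → φ x ∈ closure (e '' K)

section

variable {e : Q ≃ₜ Q'} (he : IsNetHomeo R f R' f' e)
variable {n n' : Fin 3 → UnitSphere} {c c' : Fin 4 → Fin 3} (h : R.IsNetFrame f n c)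
  (h' : R'.IsNetFrame f' n' c') {A : Space3 ≃ₗᵢ[ℝ] Space3}
  (hA : ∀ x, pat n' (sphMap A (f x)) = pat n' (f' (e x)))
include he h'

include hA in
-- A vertex is determined by its signs, so `φ x` and `e x` have the same image; they lie in a common
-- closed face, where `f'` is injective.
theorem IsTransfer.eq_of_isVertex {φ : Q → Q'} (hφ : IsTransfer R f f' e A φ)
    (h : R.IsNetFrame f n c) {x : Q} (hx : IsVertex f n x) : φ x = e x := by
  obtain ⟨K, hK, hxK⟩ := h.exists_mem_closure_face x
  obtain ⟨s, g, hg⟩ := h'.exists_chart_of_isFace (he.isFace hK)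
  refine hg.injOn (hφ.face x K hK hxK) (e.apply_mem_closure_image.2 hxK) ?_
  rw [hφ.dev]
  obtain ⟨i, j, hij, hi, hj⟩ := he.isVertex h h' hx
  exact h'.span.eq_of_pat_eq (hA x) hij ((congrFun (hA x) i).trans hi) ((congrFun (hA x) j).trans hj)

include hA

/-- At a vertex both points equal `e x`. Elsewhere the inverse charts of the two faces agree on the
cell that contains the image of `e x`. -/
theorem transfer_unique {x : Q} {K₁ K₂ : Set Q} (f1 : R.IsFace f K₁) (f2 : R.IsFace f K₂)
    (m1 : x ∈ closure K₁) (m2 : x ∈ closure K₂) {y₁ y₂ : Q'} (hy1 : y₁ ∈ closure (e '' K₁))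
    (hy2 : y₂ ∈ closure (e '' K₂)) (e1 : f' y₁ = sphMap A (f x)) (e2 : f' y₂ = sphMap A (f x)) :
    y₁ = y₂ := by
  obtain ⟨s₁, g₁, c1⟩ := h'.exists_chart_of_isFace (he.isFace f1)
  obtain ⟨s₂, g₂, c2⟩ := h'.exists_chart_of_isFace (he.isFace f2)
  have m1' := e.apply_mem_closure_image.2 m1
  have m2' := e.apply_mem_closure_image.2 m2
  by_cases hv : IsVertex f' n' (e x)
  · have hAx : sphMap A (f x) = f' (e x) := by
      obtain ⟨i, j, hij, hi, hj⟩ := hv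
      exact h'.span.eq_of_pat_eq (hA x) hij ((congrFun (hA x) i).trans hi)
        ((congrFun (hA x) j).trans hj)
    rw [c1.injOn hy1 m1' (e1.trans hAx), c2.injOn hy2 m2' (e2.trans hAx)]
  · rw [← c1.left y₁ hy1, ← c2.left y₂ hy2, e1, e2]
    exact h'.charts_eq c1 c2 hv m1' m2' (subset_closure (hA x))

include h in
-- On each closed face take `A ∘ f` followed by the inverse chart of the image face. The pieces
-- agree on overlaps, and the closed faces are finite in number, so the result is continuous.
theorem exists_isTransfer : ∃ φ, IsTransfer R f f' e A φ := by
  have hsurj : ∀ K, R.IsFace f K → ∃ φ : Q → Q', ContinuousOn φ (closure K) ∧ ∀ x ∈ closure K,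
      φ x ∈ closure (e '' K) ∧ f' (φ x) = sphMap A (f x) := by
    intro K hK
    obtain ⟨s, g, hg⟩ := h'.exists_chart_of_isFace (he.isFace hK)
    have hmem : ∀ x ∈ closure K, sphMap A (f x) ∈ closedCell n' s := by
      intro x hx i
      rw [hA]
      exact hg.maps _ (e.apply_mem_closure_image.2 hx) i
    exact ⟨fun x => g (sphMap A (f x)),
      hg.cont.comp ((continuous_sphMap A).comp h.dev.1).continuousOn hmem,
      fun x hx => ⟨hg.mem_closure _ (hmem x hx), hg.right _ (hmem x hx)⟩⟩
  have hex : ∀ x, ∃ y, ∀ K, R.IsFace f K → x ∈ closure K →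
      y ∈ closure (e '' K) ∧ f' y = sphMap A (f x) := by
    intro x
    obtain ⟨K₀, f0, m0⟩ := h.exists_mem_closure_face x
    obtain ⟨φ₀, -, h0⟩ := hsurj K₀ f0
    refine ⟨φ₀ x, fun K fK mK => ⟨?_, (h0 x m0).2⟩⟩
    obtain ⟨φ₁, -, h1⟩ := hsurj K fK
    rw [transfer_unique he h' hA f0 fK m0 mK (h0 x m0).1 (h1 x mK).1 (h0 x m0).2 (h1 x mK).2]
    exact (h1 x mK).1
  choose φ hφ using hex
  refine ⟨φ, ?_, fun x => ?_, fun x K hK hx => (hφ x K hK hx).1⟩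
  · have : Finite {K | R.IsFace f K} := h.finite_setOf_isFace
    refine (locallyFinite_of_finite fun K : {K | R.IsFace f K} => closure (K : Set Q)).continuous
      ?_ (fun K => isClosed_closure) fun K => ?_
    · refine eq_univ_of_forall fun x => ?_
      obtain ⟨K, hK, hx⟩ := h.exists_mem_closure_face x
      exact mem_iUnion.2 ⟨⟨K, hK⟩, hx⟩
    · obtain ⟨φ₁, hc, h1⟩ := hsurj K K.2
      refine hc.congr fun x hx => ?_
      exact transfer_unique he h' hA K.2 K.2 hx hx (hφ x K K.2 hx).1 (h1 x hx).1
        (hφ x K K.2 hx).2 (h1 x hx).2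
  · obtain ⟨K, hK, hx⟩ := h.exists_mem_closure_face x
    exact (hφ x K hK hx).2

end

namespace IsTransfer

variable {e : Q ≃ₜ Q'} {n n' : Fin 3 → UnitSphere} {c c' : Fin 4 → Fin 3}
  {A : Space3 ≃ₗᵢ[ℝ] Space3} {φ : Q → Q'} {ψ : Q' → Q} (hφ : IsTransfer R f f' e A φ)
  (hψ : IsTransfer R' f' f e.symm A.symm ψ) (he : IsNetHomeo R f R' f' e)
  (h : R.IsNetFrame f n c) (h' : R'.IsNetFrame f' n' c')

include hφ hψ he h in
-- `ψ (φ x)` and `x` lie in one closed face and have the same image under `f`.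
theorem left_inverse (x : Q) : ψ (φ x) = x := by
  obtain ⟨K, hK, hx⟩ := h.exists_mem_closure_face x
  obtain ⟨s, g, hg⟩ := h.exists_chart_of_isFace hK
  have h1 := hψ.face _ _ (he.isFace hK) (hφ.face x K hK hx)
  rw [← image_comp, e.symm_comp_self, image_id] at h1
  refine hg.injOn h1 hx ?_
  rw [hψ.dev, hφ.dev, sphMap_symm_sphMap]

include hφ hψ he h h' in
-- If `φ x` were interior, two faces would meet there across the net and `ψ` would bring both back
-- to `x`, but a boundary point that is not a vertex lies in only one closed face.
theorem mem_boundary (hA : ∀ x, pat n' (sphMap A (f x)) = pat n' (f' (e x))) {x : Q}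
    (hx : x ∈ R.boundary) : φ x ∈ R'.boundary := by
  by_cases hv : IsVertex f n x
  · rw [hφ.eq_of_isVertex he h' hA h hv, he.boundary]
    exact hx
  by_contra hb
  have hn : e x ∈ R'.net f' := (he.net x).2 (h.boundary_subset_net hx)
  rw [h'.net_eq] at hn
  obtain ⟨i, hi⟩ := hn
  have hi' : pat n' (f' (φ x)) i = 0 := by
    rw [hφ.dev, hA, pat_eq_zero_iff, hi]
  obtain ⟨r, I, τ, hr, hI, -⟩ := h'.exists_isPatChart (x := φ x)
    fun ⟨j, hj⟩ => hb (hj ▸ R'.corner_mem_boundary j)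
  obtain ⟨s, hs⟩ := hr.exists_isAdmissible
  obtain ⟨K₁, g₁, K₂, g₂, f1, f2, c1, c2, m1, m2⟩ := h'.exists_face_pair hr hs hi' (by
    rw [hI hb]; exact notMem_empty _)
  have hne : K₁ ≠ K₂ := by
    rintro rfl
    have := congrFun (c1.pattern_eq f1.nonempty c2) i
    simp at this
  have h1 := hψ.face _ _ f1 m1
  have h2 := hψ.face _ _ f2 m2
  rw [hφ.left_inverse hψ he h] at h1 h2
  exact hv ((h.isVertex_iff_of_boundary hx).2 (.inr ⟨_, _, ⟨he.symm.isFace f1, h1⟩,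
    ⟨he.symm.isFace f2, h2⟩, e.symm.injective.image_injective.ne hne⟩))

include hφ in
theorem exists_isom_nhds (hf : R.IsDevelopingMap f) (hf' : R'.IsDevelopingMap f') {x : Q}
    (hx : x ∉ range R.corner) (hx' : φ x ∉ range R'.corner) :
    ∃ U ∈ 𝓝 x, ∀ y ∈ U, ∀ z ∈ U, edist (φ y) (φ z) = edist y z := by
  obtain ⟨U, hU, hUi⟩ := hf.2 x hx
  obtain ⟨V, hV, hVi⟩ := hf'.2 _ hx'
  refine ⟨U ∩ φ ⁻¹' V, Filter.inter_mem hU (hφ.cont.continuousAt hV), fun y hy z hz => ?_⟩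
  rw [edist_dist, edist_dist, hVi _ hy.2 _ hz.2, hUi y hy.1 z hz.1, hφ.dev, hφ.dev, sphDist_sphMap]

include hφ in
theorem exists_corner_nhds (hf : R.IsDevelopingMap f) (hf' : R'.IsDevelopingMap f')
    (hc : ∀ j, φ (R.corner j) = R'.corner j) (j : Fin 4) :
    ∃ U ∈ 𝓝 (R.corner j), ∀ y ∈ U, edist (φ (R.corner j)) (φ y) = edist (R.corner j) y := by
  obtain ⟨U, hU, hUi⟩ := R.exists_dist_corner_eq hf j
  obtain ⟨V, hV, hVi⟩ := R'.exists_dist_corner_eq hf' j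
  rw [← hc j] at hV
  refine ⟨U ∩ φ ⁻¹' V, Filter.inter_mem hU (hφ.cont.continuousAt hV), fun y hy => ?_⟩
  rw [edist_dist, edist_dist, hc, hVi _ hy.2, hUi y hy.1, ← hc, hφ.dev, hφ.dev, sphDist_sphMap]

include hφ in
/-- A transfer does not increase distances. -/
theorem edist_le (hf : R.IsDevelopingMap f) (hf' : R'.IsDevelopingMap f')
    (hc : ∀ j, φ (R.corner j) = R'.corner j) (hinj : Function.Injective φ) (x y : Q) :
    edist (φ x) (φ y) ≤ edist x y := by
  rw [R.length_metric]
  refine le_iInf fun γ => ?_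
  rw [eVariationOn_path]
  have hγ : Continuous γ.extend := γ.continuous_extend
  have hreg : ∀ a b : ℝ, a ≤ b → (∀ t ∈ Icc a b, γ.extend t ∉ range R.corner) →
      edist (φ (γ.extend a)) (φ (γ.extend b)) ≤ eVariationOn γ.extend (Icc a b) := by
    intro a b hab hcor
    refine edist_le_eVariationOn_of_local (u := fun t => φ (γ.extend t)) hab fun t ht => ?_
    obtain ⟨U, hU, hUi⟩ := hφ.exists_isom_nhds hf hf' (hcor t ht) (by
      rintro ⟨j, hj⟩
      rw [← hc] at hj
      exact hcor t ht ⟨j, hinj hj⟩)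
    refine ⟨_, hγ.continuousAt hU, fun s hs s' hs' hss => ?_⟩
    rw [hUi _ hs.1 _ hs'.1]
    exact eVariationOn.edist_le _ (left_mem_Icc.2 hss) (right_mem_Icc.2 hss)
  have key := edist_le_eVariationOn_of_local (u := fun t => φ (γ.extend t)) (w := γ.extend)
    zero_le_one fun t _ => ?_
  · simpa using key
  by_cases ht : γ.extend t ∈ range R.corner
  · obtain ⟨j, hj⟩ := ht
    obtain ⟨U, hU, hUi⟩ := hφ.exists_corner_nhds hf hf' hc j
    have hV : (R.corner '' {k | k ≠ j})ᶜ ∈ 𝓝 (R.corner j) := by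
      refine ((toFinite _).isClosed.isOpen_compl).mem_nhds ?_
      rintro ⟨k, hk, hkj⟩
      exact hk (R.corner_injective hkj)
    have hW : γ.extend ⁻¹' (U ∩ (R.corner '' {k | k ≠ j})ᶜ) ∈ 𝓝 t :=
      hγ.continuousAt (by rw [← hj]; exact Filter.inter_mem hU hV)
    obtain ⟨ρ, hρ, hρW⟩ := Metric.mem_nhds_iff.1 hW
    refine ⟨Metric.ball t ρ, Metric.ball_mem_nhds t hρ, fun s hs s' hs' hss => ?_⟩
    -- A path through the corner is split at such a time `p`, since distances to the corner are
    -- preserved; a path that avoids the corners is covered by `hreg`.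
    by_cases hcor : ∃ p ∈ Icc s s', γ.extend p ∈ range R.corner
    · obtain ⟨p, hp, k, hk⟩ := hcor
      have hpW : p ∈ Metric.ball t ρ := by
        have hc1 := (convex_ball t ρ).ordConnected
        exact hc1.out hs.1 hs'.1 hp
      have hkj : k = j := by
        by_contra hne
        exact (hρW hpW).2 ⟨k, hne, hk⟩
      subst hkj
      calc edist (φ (γ.extend s)) (φ (γ.extend s'))
          ≤ edist (φ (γ.extend s)) (φ (R.corner k)) + edist (φ (R.corner k)) (φ (γ.extend s')) :=
            edist_triangle _ _ _
        _ = edist (γ.extend s) (γ.extend p) + edist (γ.extend p) (γ.extend s') := by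
            rw [edist_comm (φ (γ.extend s)), hUi _ (hρW hs.1).1, hUi _ (hρW hs'.1).1, hk,
              edist_comm (γ.extend s)]
        _ ≤ eVariationOn γ.extend (Icc s p) + eVariationOn γ.extend (Icc p s') :=
            add_le_add (eVariationOn.edist_le _ (left_mem_Icc.2 hp.1) (right_mem_Icc.2 hp.1))
              (eVariationOn.edist_le _ (left_mem_Icc.2 hp.2) (right_mem_Icc.2 hp.2))
        _ = _ := by simpa using eVariationOn.Icc_add_Icc γ.extend (s := univ) hp.1 hp.2 (mem_univ _)
    · exact hreg s s' hss fun p hp hpc => hcor ⟨p, hp, hpc⟩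
  · obtain ⟨U, hU, hUi⟩ := hφ.exists_isom_nhds hf hf' ht (by
      rintro ⟨j, hj⟩
      rw [← hc] at hj
      exact ht ⟨j, hinj hj⟩)
    refine ⟨_, hγ.continuousAt hU, fun s hs s' hs' hss => ?_⟩
    rw [hUi _ hs.1 _ hs'.1]
    exact eVariationOn.edist_le _ (left_mem_Icc.2 hss) (right_mem_Icc.2 hss)

end IsTransfer

/-- A homeomorphism which respects the boundary and the corners preserves the orientation. -/
theorem orientationPreserving_of_corner (R : MarkedSphericalRectangle Q)
    (R' : MarkedSphericalRectangle Q') {φ : Q ≃ₜ Q'} (hb : ∀ x, φ x ∈ R'.boundary ↔ x ∈ R.boundary)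
    (hc : ∀ j, φ (R.corner j) = R'.corner j) : R.OrientationPreserving R' φ := by
  refine ⟨hb, ?_⟩
  have hpi := Real.pi_pos
  -- Positively ordered triples of boundary points have arguments in this convex set. The
  -- orientation determinant of their images is continuous and, by injectivity, nonzero on it, so
  -- its sign is that of three corners.
  set T : Set (ℝ × ℝ × ℝ) := {p | p.1 < p.2.1 ∧ p.2.1 < p.2.2 ∧ p.2.2 < p.1 + 2 * Real.pi} with hT
  have hTc : Convex ℝ T := by
    rintro ⟨a, b, c⟩ ⟨h1, h2, h3⟩ ⟨a', b', c'⟩ ⟨h1', h2', h3'⟩ s t hs ht hst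
    simp only at h1 h2 h3 h1' h2' h3'
    have key : ∀ {p q p' q' : ℝ}, p < q → p' < q' → s * p + t * p' < s * q + t * q' := by
      intro p q p' q' hpq hpq'
      rcases eq_or_lt_of_le hs with rfl | hs'
      · have : t = 1 := by linarith
        subst this; linarith
      · nlinarith [mul_lt_mul_of_pos_left hpq hs', mul_le_mul_of_nonneg_left hpq'.le ht]
    refine ⟨key h1 h1', key h2 h2', ?_⟩
    have := key h3 h3'
    change s * c + t * c' < s * a + t * a' + 2 * Real.pi
    have e : s * (a + 2 * Real.pi) + t * (a' + 2 * Real.pi) = s * a + t * a' + (s + t) * (2 * Real.pi) := by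
      ring
    rwa [e, hst, one_mul] at this
  let P : ℝ → ℂ := fun t => R'.chart (φ (R.boundaryPt t))
  have hP : Continuous P := R'.continuous_chart.comp (φ.continuous.comp R.continuous_boundaryPt)
  have hP1 : ∀ t, ‖P t‖ = 1 := fun t => (hb _).2 (R.boundaryPt_mem t)
  have hPi : ∀ s t, P s = P t → circlePt s = circlePt t := fun s t hst => by
    rw [← R.chart_boundaryPt, ← R.chart_boundaryPt, φ.injective (R'.chart_injective hst)]
  let F : ℝ × ℝ × ℝ → ℝ := fun p => ((starRingEnd ℂ) (P p.2.1 - P p.1) * (P p.2.2 - P p.1)).im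
  have hF : Continuous F := by fun_prop
  have hF0 : ∀ p ∈ T, F p ≠ 0 := by
    rintro ⟨a, b, c⟩ ⟨h1, h2, h3⟩ h0
    simp only at h1 h2 h3
    have hccw : Ccw (circlePt a) (circlePt b) (circlePt c) :=
      (ccw_circlePt_iff ⟨h1.le, by linarith⟩ ⟨by linarith, h3⟩).2 ⟨h1, h2⟩
    have hz : ∀ {x y z : ℂ}, Ccw x y z ∨ Ccw x z y →
        ((starRingEnd ℂ) (y - x) * (z - x)).im ≠ 0 := by
      rintro x y z (h | h)
      · exact ne_of_gt h
      · unfold Ccw at h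
        rw [ccw_det] at h ⊢
        intro h0
        linarith
    exact hz (ccw_or_ccw (hP1 a) (hP1 b) (hP1 c) (fun he => hccw.ne (hPi _ _ he))
      (fun he => hccw.rotate.rotate.ne (hPi _ _ he).symm) fun he => hccw.rotate.ne (hPi _ _ he)) h0
  have hrep : ∀ x ∈ R.boundary, ∀ y ∈ R.boundary, ∀ z ∈ R.boundary,
      Ccw (R.chart x) (R.chart y) (R.chart z) → ∃ p ∈ T, x = R.boundaryPt p.1 ∧
        y = R.boundaryPt p.2.1 ∧ z = R.boundaryPt p.2.2 := by
    intro x hx y hy z hz hxyz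
    obtain ⟨a, -, ha⟩ := exists_circlePt (z := R.chart x) hx 0
    obtain ⟨b, hb1, hb2⟩ := exists_circlePt (z := R.chart y) hy a
    obtain ⟨c, hc1, hc2⟩ := exists_circlePt (z := R.chart z) hz a
    rw [ha, hb2, hc2, ccw_circlePt_iff hb1 hc1] at hxyz
    refine ⟨(a, b, c), ⟨hxyz.1, hxyz.2, hc1.2⟩, ?_, ?_, ?_⟩ <;> apply R.chart_injective <;>
      rw [chart_boundaryPt] <;> assumption
  have h0 := R.corner_order 0 1 2 (by decide) (by decide)
  obtain ⟨p₀, hp₀, e1, e2, e3⟩ := hrep _ (R.corner_mem_boundary 0) _ (R.corner_mem_boundary 1) _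
    (R.corner_mem_boundary 2) h0
  have hpos : 0 < F p₀ := by
    have := R'.corner_order 0 1 2 (by decide) (by decide)
    rw [← hc, ← hc, ← hc, e1, e2, e3] at this
    exact this
  intro x hx y hy z hz hxyz
  obtain ⟨p, hp, rfl, rfl, rfl⟩ := hrep x hx y hy z hz hxyz
  change 0 < F p
  by_contra hle
  obtain ⟨q, hq, hq0⟩ := hTc.isPreconnected.intermediate_value hp hp₀ hF.continuousOn
    (show (0 : ℝ) ∈ Icc (F p) (F p₀) from ⟨not_lt.1 hle, hpos.le⟩)
  exact hF0 q hq hq0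

end MarkedSphericalRectangle

theorem mainTheorem6 {Q Q' : Type*} [MetricSpace Q] [MetricSpace Q']
    (R : MarkedSphericalRectangle Q) (R' : MarkedSphericalRectangle Q')
    (f : Q → UnitSphere) (f' : Q' → UnitSphere)
    (hf : R.IsDevelopingMap f) (hf' : R'.IsDevelopingMap f')
    (hnet : R.NetEquivalent R' f f')
    (θ : ℝ) (hθ : θ ∈ Set.Ioo (0 : ℝ) 1)
    (hR : R.HasAngle f θ) (hR' : R'.HasAngle f' θ) :
    R.Congruent R' := by
  obtain ⟨e, ⟨heb, -⟩, hec, hes, hen⟩ := hnet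
  have he : MarkedSphericalRectangle.IsNetHomeo R f R' f' e :=
    ⟨heb, hec, fun x => by rw [← hen, e.injective.mem_set_image]⟩
  obtain ⟨n, c, h⟩ := hR.exists_isNetFrame R hf hθ
  obtain ⟨n', c', h'⟩ := hR'.exists_isNetFrame R' hf' hθ
  obtain ⟨σ, ε, hε, hσ⟩ := he.exists_match h h'
  have hc := MarkedSphericalRectangle.IsNetHomeo.label_eq h h' hσ hes
  obtain ⟨A, hA⟩ := he.exists_isometry h h' hε hσ hc hθ hR hR'
  have hA1 : ∀ x, pat n' (sphMap A (f x)) = pat n' (f' (e x)) := fun x => funext fun i => by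
    obtain ⟨i, rfl⟩ := σ.surjective i
    rw [hA, hσ]
  -- The same compatibility for `A.symm` and `e.symm`, which provides the inverse map.
  have hA2 : ∀ y, pat n (sphMap A.symm (f' y)) = pat n (f (e.symm y)) := fun y => funext fun i => by
    have h1 := hA (sphMap A.symm (f' y)) i
    have h2 := hσ (e.symm y) i
    rw [sphMap_sphMap_symm] at h1
    rw [e.apply_symm_apply, h1] at h2
    rw [mul_comm, mul_comm (ε i)] at h2
    exact SignType.mul_right_cancel (hε i) h2
  obtain ⟨φ, hφ⟩ := MarkedSphericalRectangle.exists_isTransfer he h h' hA1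
  obtain ⟨ψ, hψ⟩ := MarkedSphericalRectangle.exists_isTransfer he.symm h' h hA2
  have hφψ := hφ.left_inverse hψ he h
  have hψφ := hψ.left_inverse (e := e.symm) (A := A.symm) hφ he.symm h'
  have hφc : ∀ j, φ (R.corner j) = R'.corner j := fun j => by
    rw [hφ.eq_of_isVertex he h' hA1 h (h.isVertex_corner j), hec]
  have hψc : ∀ j, ψ (R'.corner j) = R.corner j := fun j => by rw [← hφc, hφψ]
  let Φ : Q ≃ Q' := ⟨φ, ψ, hφψ, hψφ⟩
  have hiso : Isometry Φ := fun x y => le_antisymm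
    (hφ.edist_le hf hf' hφc Φ.injective x y) (by
      have := hψ.edist_le hf' hf hψc Φ.symm.injective (φ x) (φ y)
      rwa [hφψ, hφψ] at this)
  refine ⟨⟨Φ, hiso⟩, MarkedSphericalRectangle.orientationPreserving_of_corner R R' (fun x => ⟨fun hx => ?_, fun hx => ?_⟩)
    hφc, hφc⟩
  · have := hψ.mem_boundary (e := e.symm) (A := A.symm) hφ he.symm h' h hA2 hx
    exact (hφψ x) ▸ this
  · exact hφ.mem_boundary hψ he h h' hA1 hx

end
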